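/- Let $T=(t_{ij})$ be a $p\times q$ table of non-negative integers. The \emph{skew graph} of $T$ is the graph $G$ that has $t_{ij}$ vertices in the box in row $i$ and column $j$, two vertices being adjacent if and only if their boxes are in different rows and in different columns; let $n$ be the number of vertices of $G$. For a finite graph $H$ and $S\subseteq V(H)$ let $c(H\setminus S)$ be the number of connected components of $H\setminus S$. A vertex $v$ of $H$ is \emph{tough} in $H$ if for every $S\subseteq V(H)\setminus\{v\}$ we have $c(H\setminus\{v\}\setminus S)\le |S|+1$, and $c(H\setminus\{v\}\setminus S)\le |S|$ whenever $S$ contains all neighbours of $v$. There is an algorithm that, given a table $T$ and a tough vertex $v$ of its skew graph $G$, generates all Hamiltonian paths of $G$ that start at $v$, each exactly once, and then stops. The generation of each individual path takes $O(pqn)$ time steps: the first path is completely printed $O(pqn)$ steps after the start, every further one $O(pqn)$ steps after the previous one, and the algorithm stops $O(pqn)$ steps after the last one. The implied constant is absolute; time steps are those of a unit-cost random access machine (with addition, truncated subtraction, multiplication, comparison and indirect addressing) all of whose numbers remain bounded by a fixed polynomial in $pqn$. Moreover, the paths generated are exactly those obtained by extending through neighbours that remain tough: a sequence of vertices is a Hamiltonian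 path of $G$ starting at $v$ if and only if it has $n$ terms, its first term is $v$, and each further term $w$ is a neighbour of the preceding term and is a tough vertex of the graph obtained from $G$ by deleting all terms before $w$. -/

import Mathlib

namespace SkewGen

/-! ### Toughness -/

section Toughness

variable {V : Type*}

/-- `numComp G S` is the number of connected components of `G ∖ S`
(meant for finite graphs). -/
noncomputable def numComp (G : SimpleGraph V) (S : Set V) : ℕ :=
  Nat.card (G.induce Sᶜ).ConnectedComponent

/-- `v` is a tough vertex of the finite graph `G`. -/
def IsTough (G : SimpleGraph V) (v : V) : Prop :=
  (∀ S : Set V, S ⊆ {v}ᶜ → numComp G ({v} ∪ S) ≤ S.ncard + 1) ∧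
  (∀ S : Set V, S ⊆ {v}ᶜ → G.neighborSet v ⊆ S → numComp G ({v} ∪ S) ≤ S.ncard)

/-- The sequences of vertices that start at `v` and are extended, one vertex at a time, by a
neighbour `w` of the last vertex `u` that is a tough vertex of the graph that remains when all
vertices of the sequence so far (including `u`) are deleted. -/
inductive IsToughRun (G : SimpleGraph V) (v : V) : List V → Prop
  | start : IsToughRun G v [v]
  | extend (l : List V) (u w : V) (hrun : IsToughRun G v (l ++ [u])) (hadj : G.Adj u w)
      (hw : w ∉ l ++ [u])
      (htough : IsTough (G.induce {x | x ∉ l ++ [u]}) ⟨w, hw⟩) :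
      IsToughRun G v (l ++ [u] ++ [w])

/-- The list `P` is the vertex sequence of a Hamiltonian path of `G` that starts at `v`. -/
def IsHamPathFrom [DecidableEq V] (G : SimpleGraph V) (v : V) (P : List V) : Prop :=
  ∃ (b : V) (w : G.Walk v b), w.IsHamiltonian ∧ w.support = P

end Toughness

/-! ### Skew graphs in table form -/

section Skew

variable {p q : ℕ}

/-- The vertices of the skew graph of the table `T`: the box in row `i` and column `j` holds
`T i j` vertices, numbered `0, …, T i j - 1`. -/
abbrev Vertex (T : Fin p → Fin q → ℕ) : Type :=
  (b : Fin p × Fin q) × Fin (T b.1 b.2)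

/-- The skew graph of the table `T`: two vertices are adjacent iff their boxes are in
different rows and in different columns. -/
def skewGraph (T : Fin p → Fin q → ℕ) : SimpleGraph (Vertex T) where
  Adj u v := u.1.1 ≠ v.1.1 ∧ u.1.2 ≠ v.1.2
  symm := ⟨fun _ _ h => ⟨h.1.symm, h.2.symm⟩⟩
  loopless := ⟨fun _ h => h.1 rfl⟩

end Skew

/-! ### A random access machine with an output tape -/

/-- Instructions. The arguments `d a b s` name registers; `l` is a position in the program. -/
inductive Instr where
  /-- put the constant `c` into register `d` -/
  | const (d c : ℕ)
  /-- copy register `a` to register `d` -/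
  | move (d a : ℕ)
  /-- register `d` becomes the sum of registers `a` and `b` -/
  | add (d a b : ℕ)
  /-- register `d` becomes the truncated difference of registers `a` and `b` -/
  | sub (d a b : ℕ)
  /-- register `d` becomes the product of registers `a` and `b` -/
  | mul (d a b : ℕ)
  /-- register `d` becomes the content of the memory cell whose address is in register `a` -/
  | load (d a : ℕ)
  /-- write register `s` to the memory cell whose address is in register `a` -/
  | store (a s : ℕ)
  /-- go to `l` -/
  | jump (l : ℕ)
  /-- go to `l` if register `a` is smaller than register `b`, else to the next instruction -/
  | jumpLT (a b l : ℕ)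
  /-- append the content of register `a` to the output tape -/
  | print (a : ℕ)
  /-- stop -/
  | halt

/-- A program is a finite list of instructions. -/
abbrev Program : Type := List Instr

/-- Configurations: program counter, registers, memory, and the output printed so far. -/
structure Config where
  pc : ℕ
  reg : ℕ → ℕ
  mem : ℕ → ℕ
  out : List ℕ

/-- The effect of one instruction. -/
def Instr.exec (c : Config) : Instr → Config
  | .const d k => { c with pc := c.pc + 1, reg := Function.update c.reg d k }
  | .move d a => { c with pc := c.pc + 1, reg := Function.update c.reg d (c.reg a) }
  | .add d a b => { c with pc := c.pc + 1, reg := Function.update c.reg d (c.reg a + c.reg b) }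
  | .sub d a b => { c with pc := c.pc + 1, reg := Function.update c.reg d (c.reg a - c.reg b) }
  | .mul d a b => { c with pc := c.pc + 1, reg := Function.update c.reg d (c.reg a * c.reg b) }
  | .load d a => { c with pc := c.pc + 1, reg := Function.update c.reg d (c.mem (c.reg a)) }
  | .store a s => { c with pc := c.pc + 1, mem := Function.update c.mem (c.reg a) (c.reg s) }
  | .jump l => { c with pc := l }
  | .jumpLT a b l => { c with pc := if c.reg a < c.reg b then l else c.pc + 1 }
  | .print a => { c with pc := c.pc + 1, out := c.out ++ [c.reg a] }
  | .halt => c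

/-- The machine has stopped: it is at a `halt` instruction or outside the program. -/
def Halted (prog : Program) (c : Config) : Prop :=
  prog[c.pc]? = none ∨ prog[c.pc]? = some Instr.halt

/-- One time step; a halted machine does not move. -/
def step (prog : Program) (c : Config) : Config :=
  match prog[c.pc]? with
  | none => c
  | some i => i.exec c

/-- The configuration after `t` time steps from `c`. -/
def run (prog : Program) (c : Config) (t : ℕ) : Config :=
  (step prog)^[t] c

/-! ### Input, output and delay -/

section Interface

variable {p q : ℕ}

/-- The input: registers `0, …, 4` hold `p`, `q` and the row, the column and the number of the
vertex `v`; the memory holds the table row by row, the entry `T i j` in cell `q * i + j`;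
everything else is `0`. -/
def inputConfig (T : Fin p → Fin q → ℕ) (v : Vertex T) : Config where
  pc := 0
  reg r := [p, q, v.1.1.val, v.1.2.val, v.2.val].getD r 0
  mem a :=
    if h : a < p * q then
      T (finProdFinEquiv.symm ⟨a, h⟩).1 (finProdFinEquiv.symm ⟨a, h⟩).2
    else 0
  out := []

/-- A path is printed vertex by vertex; a vertex is printed as its row, its column and its number
within its box. -/
def encodePath {T : Fin p → Fin q → ℕ} (P : List (Vertex T)) : List ℕ :=
  P.flatMap fun v => [v.1.1.val, v.1.2.val, v.2.val]

/-- Started in `c₀`, the program prints the paths in the list `L` one after the other and stops.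
Each path is complete at most `D` steps after the previous one was complete (the first one at most
`D` steps after the start), and the machine stops at most `D` steps after the last one. Here `τ m`
is a time at which exactly the first `m` paths have been printed. -/
def GeneratesWithDelay {T : Fin p → Fin q → ℕ} (prog : Program) (c₀ : Config)
    (L : List (List (Vertex T))) (D : ℕ) : Prop :=
  ∃ τ : ℕ → ℕ, τ 0 = 0 ∧
    (∀ m < L.length, τ (m + 1) ≤ τ m + D ∧
      (run prog c₀ (τ (m + 1))).out = (L.take (m + 1)).flatMap encodePath) ∧
    Halted prog (run prog c₀ (τ L.length + D)) ∧
    (run prog c₀ (τ L.length + D)).out = L.flatMap encodePath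

/-- Started in `c₀`, the machine never holds a number larger than `B`. -/
def WordsBounded (prog : Program) (c₀ : Config) (B : ℕ) : Prop :=
  ∀ t k : ℕ, (run prog c₀ t).reg k ≤ B ∧ (run prog c₀ t).mem k ≤ B

end Interface

end SkewGen

namespace SkewGen

set_option linter.unusedSectionVars false

/-! ### Arithmetic of tables -/

section Arithmetic

variable {ι κ : Type*} [Fintype ι] [Fintype κ]

/-! The core is an arithmetic criterion: the skew graph of a table has a Hamiltonian path starting
in the box (i, j) exactly if `Good` holds there. Write r, c for row and column sums and N for the
total. Deleting everything outside row k leaves r_k isolated vertices, and a path that passes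
through the N - r_k deleted vertices falls into at most N - r_k + 1 pieces, or N - r_k if it starts
at a deleted vertex; this gives the row bounds, and dually the column bounds. Deleting everything
outside the union of row k and column l isolates the t_kl vertices of their common box and leaves at
least one more component, unless row and column lie wholly in that box; this gives `cross`, and
`off_cross` if the path starts outside the union. Two small obstructions remain. In `ColumnStuck`
the path has to alternate between column j and its complement, and once it has left its first vertex
it uses one of the rows k, k' inside the column and the other outside, so part of the column is
never reached. In `FullSquare` the graph that remains after the first vertex is disconnected.

Formally the criterion rests on two one-step lemmas about tables rather than on component counts.
`good_addOne` says that prepending a vertex in another row and column to a path from a good box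
starts in a good box again, so every Hamiltonian path starts in a good box of its own table
(`good_boxTable`). `exists_good_of_good_addOne` says that after the vertex of a good box is removed,
a nonempty remainder has a good box in a different row and column. Hence a depth-first search that
enters only good boxes misses no path and has no dead ends.

For the running time, `good_iff_test` replaces the conditions by comparing one global sum with a
credit of the row and a credit of the column, so all boxes are tested in O(pq) steps. Between two
outputs the search removes at most n vertices and adds at most n, at O(pq) each, and printing costs
O(n); `NodeSpec` carries this accounting through the search tree. If the first box is not good, no
path exists and the machine halts at once. The program is written in a small structured language
whose compiler is proved correct with exact step counts (`Ex.correct`, `Cmd.correct`), and static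
polynomial bounds on all numbers that occur (`Cmd.polyBdd_bd`) give the word size.

The description by tough vertices is proved separately. What is left of a Hamiltonian path covers
the remaining graph, so its first vertex is tough there. Conversely, a run is a chain of neighbours
without repetition, and with n terms it meets every vertex. -/

theorem sum_eq_pair [DecidableEq ι] {f : ι → ℕ} {k k' : ι} (h : k ≠ k')
    (h0 : ∀ x, x ≠ k → x ≠ k' → f x = 0) : ∑ x, f x = f k + f k' :=
  Fintype.sum_eq_add k k' h fun x hx => h0 x hx.1 hx.2

theorem single_le_sum' (f : ι → ℕ) (k : ι) : f k ≤ ∑ x, f x :=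
  Finset.single_le_sum (fun _ _ => Nat.zero_le _) (Finset.mem_univ k)

theorem pair_le_sum [DecidableEq ι] (f : ι → ℕ) {k k' : ι} (h : k ≠ k') :
    f k + f k' ≤ ∑ x, f x := by
  rw [← Finset.sum_pair h]
  exact Finset.sum_le_sum_of_subset (Finset.subset_univ _)

theorem triple_le_sum [DecidableEq ι] (f : ι → ℕ) {k k' l : ι} (h : k ≠ k') (h1 : l ≠ k)
    (h2 : l ≠ k') : f l + f k + f k' ≤ ∑ x, f x := by
  have : f l + f k + f k' = ∑ x ∈ {l, k, k'}, f x := by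
    rw [Finset.sum_insert (by simp [h1, h2]), Finset.sum_pair h, add_assoc]
  rw [this]
  exact Finset.sum_le_sum_of_subset (Finset.subset_univ _)

theorem exists_ne_of_lt_sum [DecidableEq ι] {f : ι → ℕ} {k : ι} (h : f k < ∑ x, f x) :
    ∃ x, x ≠ k ∧ f x ≠ 0 := by
  by_contra! h0
  rw [Fintype.sum_eq_single k h0] at h
  exact lt_irrefl _ h

/-- The sum of row `i`. -/
def rowSum (t : ι → κ → ℕ) (i : ι) : ℕ := ∑ j, t i j

/-- The sum of column `j`. -/
def colSum (t : ι → κ → ℕ) (j : κ) : ℕ := ∑ i, t i j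

/-- The sum of all entries. -/
def total (t : ι → κ → ℕ) : ℕ := ∑ i, rowSum t i

theorem rowSum_flip (t : ι → κ → ℕ) (i : ι) : colSum (fun j i => t i j) i = rowSum t i := rfl

theorem colSum_flip (t : ι → κ → ℕ) (j : κ) : rowSum (fun j i => t i j) j = colSum t j := rfl

theorem total_eq_sum_colSum (t : ι → κ → ℕ) : total t = ∑ j, colSum t j := Finset.sum_comm

theorem total_flip (t : ι → κ → ℕ) : total (fun j i => t i j) = total t :=
  (total_eq_sum_colSum t).symm

/-- The column of the box `(i, j)` holds half of the table and meets three rows, the only ones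
that are not empty, and row `i` has just one vertex. -/
def ColumnStuck (t : ι → κ → ℕ) (i : ι) (j : κ) : Prop :=
  rowSum t i = 1 ∧ 2 * colSum t j = total t + 1 ∧
    ∃ k k', k ≠ i ∧ k' ≠ i ∧ k ≠ k' ∧ t k j ≠ 0 ∧ t k' j ≠ 0 ∧
      ∀ x, x ≠ i → x ≠ k → x ≠ k' → rowSum t x = 0

/-- Apart from the single vertex in the box `(i, j)`, the table is a full `2 × 2` table in other
rows and columns. -/
def FullSquare (t : ι → κ → ℕ) (i : ι) (j : κ) : Prop :=
  rowSum t i = 1 ∧ colSum t j = 1 ∧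
    ∃ k k' l l', (k ≠ i ∧ k' ≠ i ∧ k ≠ k') ∧ (l ≠ j ∧ l' ≠ j ∧ l ≠ l') ∧
      (t k l ≠ 0 ∧ t k l' ≠ 0 ∧ t k' l ≠ 0 ∧ t k' l' ≠ 0) ∧
      (∀ x, x ≠ i → x ≠ k → x ≠ k' → rowSum t x = 0) ∧
      ∀ y, y ≠ j → y ≠ l → y ≠ l' → colSum t y = 0

/-- The arithmetic conditions under which the skew graph of `t` has a Hamiltonian path that starts
in the box `(i, j)`. -/
structure Good (t : ι → κ → ℕ) (i : ι) (j : κ) : Prop where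
  pos : t i j ≠ 0
  row_self : 2 * rowSum t i ≤ total t + 1
  row : ∀ k, k ≠ i → 2 * rowSum t k ≤ total t
  col_self : 2 * colSum t j ≤ total t + 1
  col : ∀ l, l ≠ j → 2 * colSum t l ≤ total t
  cross : ∀ k l, 2 * t k l < rowSum t k + colSum t l → rowSum t k + colSum t l ≤ total t
  off_cross : ∀ k l, k ≠ i → l ≠ j → 2 * t k l < rowSum t k + colSum t l →
    rowSum t k + colSum t l < total t
  not_columnStuck : ¬ ColumnStuck t i j
  not_rowStuck : ¬ ColumnStuck (fun j i => t i j) j i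
  not_fullSquare : ¬ FullSquare t i j

theorem FullSquare.flip {t : ι → κ → ℕ} {i : ι} {j : κ} (h : FullSquare t i j) :
    FullSquare (fun j i => t i j) j i := by
  obtain ⟨h1, h2, k, k', l, l', hk, hl, ⟨a, b, c, d⟩, hr, hc⟩ := h
  exact ⟨h2, h1, l, l', k, k', hl, hk, ⟨a, c, b, d⟩, hc, hr⟩

theorem Good.flip {t : ι → κ → ℕ} {i : ι} {j : κ} (h : Good t i j) :
    Good (fun j i => t i j) j i := by
  constructor
  · exact h.pos
  · rw [total_flip]; exact h.col_self
  · rw [total_flip]; exact h.col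
  · rw [total_flip]; exact h.row_self
  · rw [total_flip]; exact h.row
  · intro k l
    simp only [total_flip, rowSum_flip, colSum_flip]
    intro hh; have := h.cross l k (by omega); omega
  · intro k l hk hl
    simp only [total_flip, rowSum_flip, colSum_flip]
    intro hh; have := h.off_cross l k hl hk (by omega); omega
  · exact h.not_rowStuck
  · exact h.not_columnStuck
  · exact fun hh => h.not_fullSquare hh.flip

theorem entry_le_rowSum (t : ι → κ → ℕ) (i : ι) (j : κ) : t i j ≤ rowSum t i :=
  single_le_sum' (t i) j

theorem entry_le_colSum (t : ι → κ → ℕ) (i : ι) (j : κ) : t i j ≤ colSum t j :=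
  single_le_sum' (fun i => t i j) i

theorem rowSum_le_total (t : ι → κ → ℕ) (i : ι) : rowSum t i ≤ total t :=
  single_le_sum' (rowSum t) i

theorem colSum_le_total (t : ι → κ → ℕ) (j : κ) : colSum t j ≤ total t := by
  rw [total_eq_sum_colSum]; exact single_le_sum' (colSum t) j

variable [DecidableEq ι] [DecidableEq κ]

theorem rowSum_pair_le (t : ι → κ → ℕ) {k k' : ι} (h : k ≠ k') :
    rowSum t k + rowSum t k' ≤ total t := pair_le_sum _ h

theorem colSum_pair_le (t : ι → κ → ℕ) {k k' : κ} (h : k ≠ k') :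
    colSum t k + colSum t k' ≤ total t := by
  rw [total_eq_sum_colSum]; exact pair_le_sum _ h

theorem rowSum_triple_le (t : ι → κ → ℕ) {k k' x : ι} (h : k ≠ k') (h1 : x ≠ k) (h2 : x ≠ k') :
    rowSum t x + rowSum t k + rowSum t k' ≤ total t := triple_le_sum _ h h1 h2

theorem colSum_triple_le (t : ι → κ → ℕ) {k k' x : κ} (h : k ≠ k') (h1 : x ≠ k) (h2 : x ≠ k') :
    colSum t x + colSum t k + colSum t k' ≤ total t := by
  rw [total_eq_sum_colSum]; exact triple_le_sum _ h h1 h2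

/-! ### Necessity of the conditions: prepending a vertex -/

/-- Adding one vertex to the box `(a, b)`. -/
def addOne (s : ι → κ → ℕ) (a : ι) (b : κ) : ι → κ → ℕ :=
  fun i j => s i j + if i = a ∧ j = b then 1 else 0

theorem addOne_flip (s : ι → κ → ℕ) (a : ι) (b : κ) :
    (fun j i => addOne s a b i j) = addOne (fun j i => s i j) b a := by
  funext j i; simp [addOne, and_comm]

theorem rowSum_addOne (s : ι → κ → ℕ) (a : ι) (b : κ) (k : ι) :
    rowSum (addOne s a b) k = rowSum s k + if k = a then 1 else 0 := by
  unfold rowSum addOne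
  rw [Finset.sum_add_distrib]
  congr 1
  by_cases h : k = a <;> simp [h]

theorem colSum_addOne (s : ι → κ → ℕ) (a : ι) (b : κ) (l : κ) :
    colSum (addOne s a b) l = colSum s l + if l = b then 1 else 0 := by
  have := rowSum_addOne (fun j i => s i j) b a l
  rwa [← addOne_flip, colSum_flip, colSum_flip] at this

theorem total_addOne (s : ι → κ → ℕ) (a : ι) (b : κ) :
    total (addOne s a b) = total s + 1 := by
  unfold total
  simp [rowSum_addOne, Finset.sum_add_distrib]

theorem good_of_total_one {t : ι → κ → ℕ} {i : ι} {j : κ} (h1 : total t = 1) (h : t i j ≠ 0) :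
    Good t i j := by
  have hr := entry_le_rowSum t i j
  have hc := entry_le_colSum t i j
  have hr1 := rowSum_le_total t i
  have hc1 := colSum_le_total t j
  have hr2 : ∀ k, k ≠ i → rowSum t k = 0 := fun k hk => by
    have := rowSum_pair_le t hk; omega
  have hc2 : ∀ k, k ≠ j → colSum t k = 0 := fun k hk => by
    have := colSum_pair_le t hk; omega
  refine ⟨h, by omega, fun k hk => by rw [hr2 k hk]; omega, by omega,
    fun k hk => by rw [hc2 k hk]; omega, ?_, ?_, ?_, ?_, ?_⟩
  · intro k l hkl
    by_cases hk : k = i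
    · by_cases hl : l = j
      · subst hk hl; omega
      · have := hc2 l hl; have := rowSum_le_total t k; omega
    · have := hr2 k hk; have := colSum_le_total t l; omega
  · intro k l hk hl
    rw [hr2 k hk, hc2 l hl]; omega
  · rintro ⟨-, -, k, k', hk, -, -, h2, -⟩
    have := entry_le_rowSum t k j
    have := hr2 k hk
    omega
  · rintro ⟨-, -, k, k', hk, -, -, h2, -⟩
    change t i k ≠ 0 at h2
    have := entry_le_colSum t i k
    have := hc2 k hk
    omega
  · rintro ⟨-, -, k, k', l, l', ⟨hk, -⟩, -, ⟨h2, -⟩, -⟩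
    have := entry_le_rowSum t k l
    have := hr2 k hk
    omega

/-- One half of `good_addOne`: a column cannot get stuck before a good box. -/
theorem not_columnStuck_addOne {s : ι → κ → ℕ} {i a : ι} {j b : κ} (hg : Good s i j)
    (hj : j ≠ b) : ¬ ColumnStuck (addOne s a b) a b := by
  rintro ⟨h1, h2, k, k', hk, hk', hkk, h3, h4, h5⟩
  simp only [rowSum_addOne, colSum_addOne, total_addOne, if_true] at h1 h2 h5
  have ek : addOne s a b k b = s k b := by simp [addOne, hk]
  have ek' : addOne s a b k' b = s k' b := by simp [addOne, hk']
  rw [ek] at h3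
  rw [ek'] at h4
  have hz : ∀ x, x ≠ k → x ≠ k' → rowSum s x = 0 := by
    intro x hx hx'
    by_cases hxa : x = a
    · subst hxa; omega
    · have := h5 x hxa hx hx'; omega
  have ht : total s = rowSum s k + rowSum s k' := sum_eq_pair hkk hz
  have hcb : s k b + s k' b ≤ colSum s b := pair_le_sum (fun x => s x b) hkk
  have hgp := hg.pos
  have hir := entry_le_rowSum s i j
  have hcj := entry_le_colSum s i j
  have hik : i = k ∨ i = k' := by
    by_contra! hne
    have := hz i hne.1 hne.2
    omega
  have := hg.row_self
  have e1 := hg.row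
  -- Column b holds exactly half of `s`, and only the rows x and y are nonempty. Row y and column b
  -- both avoid the start (i, j), so `off_cross` puts row y strictly below half, while `cross` keeps
  -- row i at no more than half. The two rows cannot add up to the total.
  have key : ∀ x y, x ≠ y → i = x → s y b ≠ 0 → s x b ≠ 0 → s x b + s y b ≤ colSum s b →
      total s = rowSum s x + rowSum s y → False := by
    intro x y hxy hix hy hx hcb ht
    subst hix
    have h6 := hg.row y hxy.symm
    have h8 : s i b + s i j ≤ rowSum s i := pair_le_sum (s i) hj.symm
    have h7 := hg.cross y b
    have h9 := hg.off_cross y b hxy.symm hj.symm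
    have := hg.row_self
    have := hg.cross i b (by have := entry_le_rowSum s y b; omega)
    have := entry_le_rowSum s y b
    omega
  rcases hik with h | h
  · exact key k k' hkk h h4 h3 hcb ht
  · exact key k' k hkk.symm h h3 h4 (by omega) (by omega)

/-- Without its odd vertex the square is a full 2 × 2 table with the start in one of its boxes.
There `cross` at the start box makes that entry at most the opposite entry, and `off_cross` at the
opposite box makes the opposite entry strictly smaller. -/
theorem not_fullSquare_addOne {s : ι → κ → ℕ} {i a : ι} {j b : κ} (hg : Good s i j) :
    ¬ FullSquare (addOne s a b) a b := by
  rintro ⟨h1, h2, k, k', l, l', ⟨hk, hk', hkk⟩, ⟨hl, hl', hll⟩, ⟨n1, n2, n3, n4⟩, hr, hc⟩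
  simp only [rowSum_addOne, colSum_addOne, if_true] at h1 h2 hr hc
  simp only [addOne, hk, hk', false_and, if_false, add_zero] at n1 n2 n3 n4
  have hz : ∀ x, x ≠ k → x ≠ k' → rowSum s x = 0 := by
    intro x hx hx'
    by_cases hxa : x = a
    · subst hxa; omega
    · have := hr x hxa hx hx'; omega
  have hy : ∀ x, x ≠ l → x ≠ l' → colSum s x = 0 := by
    intro x hx hx'
    by_cases hxa : x = b
    · subst hxa; omega
    · have := hc x hxa hx hx'; omega
  have er : ∀ x, rowSum s x = s x l + s x l' := fun x => sum_eq_pair hll fun y h1 h2 => by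
    have := entry_le_colSum s x y; have := hy y h1 h2; omega
  have ec : ∀ y, colSum s y = s k y + s k' y := fun y => sum_eq_pair hkk fun x h1 h2 => by
    have := entry_le_rowSum s x y; have := hz x h1 h2; omega
  have ht : total s = rowSum s k + rowSum s k' := sum_eq_pair hkk hz
  have hgp := hg.pos
  have hir := entry_le_rowSum s i j
  have hcj := entry_le_colSum s i j
  have hik : i = k ∨ i = k' := by
    by_contra! hne
    have := hz i hne.1 hne.2
    omega
  have hjl : j = l ∨ j = l' := by
    by_contra! hne
    have := hy j hne.1 hne.2
    omega
  have c1 := hg.cross k l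
  have c2 := hg.cross k l'
  have c3 := hg.cross k' l
  have c4 := hg.cross k' l'
  have o1 := hg.off_cross k l
  have o2 := hg.off_cross k l'
  have o3 := hg.off_cross k' l
  have o4 := hg.off_cross k' l'
  simp only [er, ec, ht] at c1 c2 c3 c4 o1 o2 o3 o4
  rcases hik with rfl | rfl <;> rcases hjl with rfl | rfl
  · have := o4 hkk.symm hll.symm; omega
  · have := o3 hkk.symm hll; omega
  · have := o2 hkk hll.symm; omega
  · have := o1 hkk hll; omega

/-- This is necessity in one step: the weaker bounds move from row i and column j to row a and
column b. The total grows by one, so the bounds with slack one at i and j become the strict ones.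
Since a ≠ i and b ≠ j, row a and column b obeyed the strict bounds before and can absorb the added
vertex. -/
theorem good_addOne {s : ι → κ → ℕ} {i a : ι} {j b : κ} (hg : Good s i j) (hi : i ≠ a)
    (hj : j ≠ b) : Good (addOne s a b) a b := by
  have ra := hg.row a hi.symm
  have cb := hg.col b hj.symm
  have hrow : ∀ k, 2 * rowSum s k ≤ total s + 1 := fun k => by
    by_cases h : k = i
    · subst h; exact hg.row_self
    · have := hg.row k h; omega
  have hcol : ∀ k, 2 * colSum s k ≤ total s + 1 := fun k => by
    by_cases h : k = j
    · subst h; exact hg.col_self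
    · have := hg.col k h; omega
  constructor
  · simp [addOne]
  · simp only [rowSum_addOne, total_addOne, if_true]; omega
  · intro k hk
    simp only [rowSum_addOne, total_addOne, hk, if_false]; have := hrow k; omega
  · simp only [colSum_addOne, total_addOne, if_true]; omega
  · intro k hk
    simp only [colSum_addOne, total_addOne, hk, if_false]; have := hcol k; omega
  · intro k l
    simp only [rowSum_addOne, colSum_addOne, total_addOne, addOne]
    by_cases hk : k = a <;> by_cases hl : l = b
    · subst hk hl
      simp only [and_self, if_true]
      have := hg.off_cross k l hi.symm hj.symm
      omega
    · subst hk
      simp only [hl, and_false, if_false, if_true]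
      have := hg.cross k l
      have := entry_le_rowSum s k l
      omega
    · subst hl
      simp only [hk, false_and, if_false, if_true]
      have := hg.cross k l
      have := entry_le_colSum s k l
      omega
    · simp only [hk, false_and, if_false, hl]
      have := hg.cross k l
      omega
  · intro k l hk hl
    simp only [rowSum_addOne, colSum_addOne, total_addOne, addOne, hk, hl, false_and, if_false]
    have := hg.cross k l
    omega
  · exact not_columnStuck_addOne hg hj
  · rw [addOne_flip]
    exact not_columnStuck_addOne hg.flip hi
  · exact not_fullSquare_addOne hg

/-! ### Sufficiency of the conditions: continuing from a good box -/

/-- The conditions that are left in the table when the vertex of a good box `(a, b)` has been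
removed. -/
structure Aft (s : ι → κ → ℕ) (a : ι) (b : κ) : Prop where
  row : ∀ k, 2 * rowSum s k ≤ total s + 1
  row_self : 2 * rowSum s a ≤ total s
  col : ∀ k, 2 * colSum s k ≤ total s + 1
  col_self : 2 * colSum s b ≤ total s
  cross : ∀ k l, 2 * s k l < rowSum s k + colSum s l → rowSum s k + colSum s l ≤ total s
  cross_self : 2 * s a b < rowSum s a + colSum s b → rowSum s a + colSum s b < total s
  not_columnStuck : rowSum s a = 0 → 2 * colSum s b = total s → ∀ k k', k ≠ a → k' ≠ a →
    k ≠ k' → s k b ≠ 0 → s k' b ≠ 0 → (∀ x, x ≠ k → x ≠ k' → rowSum s x = 0) → False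
  not_rowStuck : colSum s b = 0 → 2 * rowSum s a = total s → ∀ k k', k ≠ b → k' ≠ b →
    k ≠ k' → s a k ≠ 0 → s a k' ≠ 0 → (∀ x, x ≠ k → x ≠ k' → colSum s x = 0) → False
  not_fullSquare : rowSum s a = 0 → colSum s b = 0 → ∀ k k' l l', k ≠ a → k' ≠ a → k ≠ k' →
    l ≠ b → l' ≠ b → l ≠ l' → s k l ≠ 0 → s k l' ≠ 0 → s k' l ≠ 0 → s k' l' ≠ 0 →
    (∀ x, x ≠ k → x ≠ k' → rowSum s x = 0) → (∀ x, x ≠ l → x ≠ l' → colSum s x = 0) → False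

theorem Aft.flip {s : ι → κ → ℕ} {a : ι} {b : κ} (h : Aft s a b) :
    Aft (fun j i => s i j) b a := by
  constructor
  · rw [total_flip]; exact h.col
  · rw [total_flip]; exact h.col_self
  · rw [total_flip]; exact h.row
  · rw [total_flip]; exact h.row_self
  · intro k l
    simp only [total_flip, rowSum_flip, colSum_flip]
    intro hh; have := h.cross l k (by omega); omega
  · simp only [total_flip, rowSum_flip, colSum_flip]
    intro hh; have := h.cross_self (by omega); omega
  · rw [total_flip]; exact h.not_rowStuck
  · rw [total_flip]; exact h.not_columnStuck
  · intro h1 h2 k k' l l' a1 a2 a3 a4 a5 a6 a7 a8 a9 a10 a11 a12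
    exact h.not_fullSquare h2 h1 l l' k k' a4 a5 a6 a1 a2 a3 a7 a9 a8 a10 a12 a11

theorem aft_of_good {s : ι → κ → ℕ} {a : ι} {b : κ} (hg : Good (addOne s a b) a b) :
    Aft s a b := by
  have hE : ∀ (s : ι → κ → ℕ), ¬ ColumnStuck (addOne s a b) a b → rowSum s a = 0 →
      2 * colSum s b = total s → ∀ k k', k ≠ a → k' ≠ a →
      k ≠ k' → s k b ≠ 0 → s k' b ≠ 0 → (∀ x, x ≠ k → x ≠ k' → rowSum s x = 0) → False := by
    intro s hs h1 h2 k k' hk hk' hkk n1 n2 hx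
    refine hs ⟨?_, ?_, k, k', hk, hk', hkk, ?_, ?_, ?_⟩
    · simp [rowSum_addOne, h1]
    · simp only [colSum_addOne, total_addOne, if_true]; omega
    · simpa [addOne, hk] using n1
    · simpa [addOne, hk'] using n2
    · intro x hxa h3 h4
      simp [rowSum_addOne, hxa, hx x h3 h4]
  have h1 := hg.row_self
  have h2 := hg.row
  have h3 := hg.col_self
  have h4 := hg.col
  have h5 := hg.cross
  have h6 := hg.off_cross
  simp only [rowSum_addOne, colSum_addOne, total_addOne, if_true] at h1 h2 h3 h4 h5 h6
  constructor
  · intro k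
    by_cases hk : k = a
    · subst hk; omega
    · have := h2 k hk; simp only [hk, if_false] at this; omega
  · omega
  · intro k
    by_cases hk : k = b
    · subst hk; omega
    · have := h4 k hk; simp only [hk, if_false] at this; omega
  · omega
  · intro k l hkl
    have h5 := h5 k l
    have h6 := h6 k l
    by_cases hk : k = a <;> by_cases hl : l = b <;> simp [addOne, hk, hl] at h5 h6 <;>
      (try subst hk) <;> (try subst hl) <;> omega
  · intro hab
    have h5 := h5 a b
    simp [addOne] at h5
    omega
  · exact hE s hg.not_columnStuck
  · intro e1 e2 k k' hk hk' hkk n1 n2 hx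
    refine hg.not_rowStuck ⟨?_, ?_, k, k', hk, hk', hkk, ?_, ?_, ?_⟩
    · rw [colSum_flip]; simp [colSum_addOne, e1]
    · rw [rowSum_flip, total_flip]; simp only [rowSum_addOne, total_addOne, if_true]; omega
    · simpa [addOne, hk] using n1
    · simpa [addOne, hk'] using n2
    · intro x hxa h3 h4
      rw [colSum_flip]
      simp [colSum_addOne, hxa, hx x h3 h4]
  · intro e1 e2 k k' l l' hk hk' hkk hl hl' hll n1 n2 n3 n4 hx hy
    refine hg.not_fullSquare ⟨?_, ?_, k, k', l, l', ⟨hk, hk', hkk⟩, ⟨hl, hl', hll⟩, ?_, ?_, ?_⟩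
    · simp [rowSum_addOne, e1]
    · simp [colSum_addOne, e2]
    · simpa [addOne, hk, hk'] using ⟨n1, n2, n3, n4⟩
    · intro x hxa h3 h4
      simp [rowSum_addOne, hxa, hx x h3 h4]
    · intro x hxa h3 h4
      simp [colSum_addOne, hxa, hy x h3 h4]

/-- A box that meets all numerical requirements is good if no configuration blocks it. -/
theorem Aft.good {s : ι → κ → ℕ} {a i : ι} {b j : κ} (h : Aft s a b) (hp : s i j ≠ 0)
    (hr : ∀ k, k ≠ i → 2 * rowSum s k ≤ total s) (hc : ∀ l, l ≠ j → 2 * colSum s l ≤ total s)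
    (ho : ∀ k l, k ≠ i → l ≠ j → 2 * s k l < rowSum s k + colSum s l →
      rowSum s k + colSum s l ≠ total s)
    (h1 : ¬ ColumnStuck s i j) (h2 : ¬ ColumnStuck (fun j i => s i j) j i)
    (h3 : ¬ FullSquare s i j) : Good s i j :=
  ⟨hp, h.row i, hr, h.col j, hc, h.cross,
    fun k l hk hl hkl => lt_of_le_of_ne (h.cross k l hkl) (ho k l hk hl hkl), h1, h2, h3⟩

/-- A row that holds more than half of the vertices contains a good box. -/
theorem Aft.exists_good_of_majority {s : ι → κ → ℕ} {a : ι} {b : κ} (h : Aft s a b) {ρ : ι}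
    (hρ : 2 * rowSum s ρ = total s + 1) : ∃ i j, i ≠ a ∧ j ≠ b ∧ Good s i j := by
  have hρa : ρ ≠ a := fun e => by subst e; have := h.row_self; omega
  have hk : ∀ k, k ≠ ρ → 2 * rowSum s k + 1 ≤ total s := fun k hk => by
    have := rowSum_pair_le s hk; omega
  by_cases hm : ∃ γ, 2 * colSum s γ = total s + 1
  · obtain ⟨γ, hγ⟩ := hm
    have hγb : γ ≠ b := fun e => by subst e; have := h.col_self; omega
    have hl : ∀ k, k ≠ γ → 2 * colSum s k + 1 ≤ total s := fun k hk => by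
      have := colSum_pair_le s hk; omega
    -- Both sums together are N + 1, which `cross` forbids unless row and column lie completely
    -- inside the box (ρ, γ). So this box is nonempty, and it is the forced choice.
    have h1 := h.cross ρ γ
    have h2 := entry_le_rowSum s ρ γ
    refine ⟨ρ, γ, hρa, hγb, h.good (by omega) (fun k h => by have := hk k h; omega)
      (fun k h => by have := hl k h; omega) (fun k l h1 h2 _ => ?_) ?_ ?_ ?_⟩
    · have := hk k h1; have := hl l h2; omega
    · rintro ⟨h3, -, k, k', hkρ, -, -, h4, -⟩
      have := entry_le_rowSum s k γ
      have := hk k hkρ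
      omega
    · rintro ⟨h3, -, k, k', hkρ, -, -, h4, -⟩
      change s ρ k ≠ 0 at h4
      have := entry_le_colSum s ρ k
      have := hl k hkρ
      rw [colSum_flip] at h3
      omega
    · rintro ⟨h3, -, k, k', l, l', ⟨hkρ, -⟩, -, ⟨h4, -⟩, -⟩
      have := entry_le_rowSum s k l
      have := hk k hkρ
      omega
  · push Not at hm
    have hl : ∀ k, 2 * colSum s k + 1 ≤ total s := fun k => by
      have := hm k; have := h.col k; omega
    have hw : ∀ j, s ρ j ≠ 0 → ¬ ColumnStuck (fun j i => s i j) j ρ → Good s ρ j := by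
      -- With no column in the majority, the only obstruction left in the majority row is a stuck
      -- row: every other row, and every column, is strictly below half, which rules out equality in
      -- `cross`.
      intro j hj hn
      refine h.good hj (fun k h => by have := hk k h; omega)
        (fun k _ => by have := hl k; omega) (fun k l h1 h2 _ => ?_) ?_ hn ?_
      · have := hk k h1; have := hl l; omega
      · rintro ⟨-, h3, -⟩
        exact hm j h3
      · rintro ⟨h3, -, k, k', l, l', ⟨hkρ, -⟩, -, ⟨h4, -⟩, -⟩
        have := entry_le_rowSum s k l
        have := hk k hkρ
        omega
    have hb : s ρ b < ∑ j, s ρ j := by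
      have h1 := entry_le_colSum s ρ b
      have h2 := hl b
      change s ρ b < rowSum s ρ
      omega
    obtain ⟨j, hjb, hj⟩ := exists_ne_of_lt_sum hb
    -- If the row is stuck at column j, it meets two further columns k, k', and one of them differs
    -- from b. It cannot be stuck there as well: two columns of sum one leave N - 2 for the third,
    -- while the row has at least three vertices, so N ≥ 5 and the third column would exceed half.
    by_cases hs : ColumnStuck (fun j i => s i j) j ρ
    · obtain ⟨h1, h2, k, k', hkj, hkj', hkk, n1, n2, hz⟩ := hs
      change s ρ k ≠ 0 at n1
      change s ρ k' ≠ 0 at n2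
      simp only [rowSum_flip, colSum_flip] at h1 h2 hz
      have hother : ∀ x, x ≠ j → s ρ x ≠ 0 → ¬ ColumnStuck (fun j i => s i j) x ρ := by
        rintro x hxj hx ⟨h3, -, k1, k2, hk1, hk2, hk12, m1, m2, hz'⟩
        change s ρ k1 ≠ 0 at m1
        change s ρ k2 ≠ 0 at m2
        rw [colSum_flip] at h3
        have e1 := triple_le_sum (s ρ) hk12 hk1.symm hk2.symm
        change _ ≤ rowSum s ρ at e1
        have e2 : ∃ y, y ≠ j ∧ y ≠ x ∧ ∀ z, z ≠ y → z ≠ j → z ≠ x → colSum s z = 0 := by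
          by_cases hxk : x = k
          · subst hxk
            exact ⟨k', hkj', hkk.symm, fun z a1 a2 a3 => hz z a2 a3 a1⟩
          · by_cases hxk' : x = k'
            · subst hxk'
              exact ⟨k, hkj, hkk, fun z a1 a2 a3 => hz z a2 a1 a3⟩
            · have := hz x hxj hxk hxk'; omega
        obtain ⟨y, hyj, hyx, hy⟩ := e2
        have e3 : total s = colSum s y + colSum s j + colSum s x := by
          rw [total_eq_sum_colSum, ← Finset.sum_subset (Finset.subset_univ {y, j, x}),
            Finset.sum_insert (by simp [hyj, hyx]), Finset.sum_pair hxj.symm, add_assoc]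
          intro z _ hz
          simp only [Finset.mem_insert, Finset.mem_singleton, not_or] at hz
          exact hy z hz.1 hz.2.1 hz.2.2
        have := hl y
        omega
      by_cases hkb : k = b
      · exact ⟨ρ, k', hρa, fun e => hkk (hkb.trans e.symm), hw k' n2 (hother k' hkj' n2)⟩
      · exact ⟨ρ, k, hρa, hkb, hw k n1 (hother k hkj n1)⟩
    · exact ⟨ρ, j, hρa, hjb, hw j hj hs⟩

/-- The pair of row `k` and column `l` is tight: together they hold as many vertices as a table with
a Hamiltonian path can have there. -/
def Tight (s : ι → κ → ℕ) (k : ι) (l : κ) : Prop :=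
  2 * s k l < rowSum s k + colSum s l ∧ rowSum s k + colSum s l = total s

theorem Tight.flip {s : ι → κ → ℕ} {k : ι} {l : κ} (h : Tight s k l) :
    Tight (fun j i => s i j) l k := by
  obtain ⟨h1, h2⟩ := h
  refine ⟨?_, ?_⟩
  · change 2 * s k l < colSum s l + rowSum s k
    omega
  · rw [rowSum_flip, colSum_flip, total_flip]
    omega

/-- In the balanced case the row and the column of a tight pair each hold exactly half. Two disjoint
tight pairs therefore leave only two rows and two columns, with entries x, y in the first row and y,
x in the second, where y ≠ 0. If x ≠ 0, one of `cross_self`, `not_rowStuck`, `not_columnStuck` and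
`not_fullSquare` fails, depending on whether a and b occur among these rows and columns. So x = 0,
and either box with entry y meets both tight pairs; one of the two avoids row a and column b. -/
theorem Aft.exists_box_of_two_tight {s : ι → κ → ℕ} {a : ι} {b : κ} (h : Aft s a b)
    (hr : ∀ k, 2 * rowSum s k ≤ total s)
    (hc : ∀ l, 2 * colSum s l ≤ total s) {k k' : ι} {l l' : κ} (h1 : Tight s k l)
    (h2 : Tight s k' l') (hk : k ≠ k') (hl : l ≠ l') :
    ∃ i j, i ≠ a ∧ j ≠ b ∧ s i j ≠ 0 ∧
      ∀ k0 l0, Tight s k0 l0 → k0 = i ∨ l0 = j := by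
  obtain ⟨h1, h1'⟩ := h1
  obtain ⟨h2, h2'⟩ := h2
  have r1 := hr k
  have r2 := hr k'
  have c1 := hc l
  have c2 := hc l'
  have hz : ∀ x, x ≠ k → x ≠ k' → rowSum s x = 0 := fun x hx hx' => by
    have := rowSum_triple_le s hk hx hx'; omega
  have hy : ∀ x, x ≠ l → x ≠ l' → colSum s x = 0 := fun x hx hx' => by
    have := colSum_triple_le s hl hx hx'; omega
  have er : ∀ x, rowSum s x = s x l + s x l' := fun x => sum_eq_pair hl fun y h1 h2 => by
    have := entry_le_colSum s x y; have := hy y h1 h2; omega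
  have ec : ∀ y, colSum s y = s k y + s k' y := fun y => sum_eq_pair hk fun x h1 h2 => by
    have := entry_le_rowSum s x y; have := hz x h1 h2; omega
  have e1 := er k
  have e2 := er k'
  have e3 := ec l
  have e4 := ec l'
  have hz0 : s k l = 0 := by
    by_contra hne
    have hcs := h.cross_self
    by_cases ha : a = k ∨ a = k'
    · by_cases hb : b = l ∨ b = l'
      · rcases ha with rfl | rfl <;> rcases hb with rfl | rfl <;> omega
      · push Not at hb
        refine h.not_rowStuck (hy b hb.1 hb.2) ?_ l l' hb.1.symm hb.2.symm hl ?_ ?_ hy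
        all_goals rcases ha with rfl | rfl <;> omega
    · push Not at ha
      by_cases hb : b = l ∨ b = l'
      · refine h.not_columnStuck (hz a ha.1 ha.2) ?_ k k' ha.1.symm ha.2.symm hk ?_ ?_ hz
        all_goals rcases hb with rfl | rfl <;> omega
      · push Not at hb
        exact h.not_fullSquare (hz a ha.1 ha.2) (hy b hb.1 hb.2) k k' l l' ha.1.symm ha.2.symm hk
          hb.1.symm hb.2.symm hl (by omega) (by omega) (by omega) (by omega) hz hy
  have ht : ∀ k0 l0, Tight s k0 l0 → (k0 = k ∧ l0 = l) ∨ (k0 = k' ∧ l0 = l') := by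
    rintro k0 l0 ⟨t1, t2⟩
    have := hr k0
    have := hc l0
    have hk0 : k0 = k ∨ k0 = k' := by
      by_contra! hne
      have := hz k0 hne.1 hne.2; omega
    have hl0 : l0 = l ∨ l0 = l' := by
      by_contra! hne
      have := hy l0 hne.1 hne.2; omega
    rcases hk0 with rfl | rfl <;> rcases hl0 with rfl | rfl
    · exact Or.inl ⟨rfl, rfl⟩
    · omega
    · omega
    · exact Or.inr ⟨rfl, rfl⟩
  have hcs := h.cross_self
  by_cases hab : k = a ∨ l' = b
  · refine ⟨k', l, ?_, ?_, by omega, fun k0 l0 h0 => ?_⟩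
    · rintro rfl
      rcases hab with rfl | rfl
      · exact hk rfl
      · omega
    · rintro rfl
      rcases hab with rfl | rfl
      · omega
      · exact hl rfl
    · rcases ht k0 l0 h0 with ⟨rfl, rfl⟩ | ⟨rfl, rfl⟩
      · exact Or.inr rfl
      · exact Or.inl rfl
  · push Not at hab
    refine ⟨k, l', hab.1, hab.2, by omega, fun k0 l0 h0 => ?_⟩
    rcases ht k0 l0 h0 with ⟨rfl, rfl⟩ | ⟨rfl, rfl⟩
    · exact Or.inl rfl
    · exact Or.inr rfl

/-- The two tight columns hold everything, and tightness makes both entries of row k nonzero. The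
case k = a would violate `cross_self` or `not_rowStuck`, so one of the two boxes of row k can be
used: the one outside column b. -/
theorem Aft.exists_box_of_tight_row {s : ι → κ → ℕ} {a : ι} {b : κ} (h : Aft s a b)
    (hr : ∀ k, 2 * rowSum s k ≤ total s)
    (hc : ∀ l, 2 * colSum s l ≤ total s) {k : ι} {l l' : κ} (h1 : Tight s k l)
    (h2 : Tight s k l') (hl : l ≠ l') (ht : ∀ k0 l0, Tight s k0 l0 → k0 = k) :
    ∃ i j, i ≠ a ∧ j ≠ b ∧ s i j ≠ 0 ∧ ∀ k0 l0, Tight s k0 l0 → k0 = i ∨ l0 = j := by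
  obtain ⟨h1, h1'⟩ := h1
  obtain ⟨h2, h2'⟩ := h2
  have r1 := hr k
  have c1 := hc l
  have c2 := hc l'
  have hy : ∀ x, x ≠ l → x ≠ l' → colSum s x = 0 := fun x hx hx' => by
    have := colSum_triple_le s hl hx hx'; omega
  have er : ∀ x, rowSum s x = s x l + s x l' := fun x => sum_eq_pair hl fun y h1 h2 => by
    have := entry_le_colSum s x y; have := hy y h1 h2; omega
  have e1 := er k
  have hka : k ≠ a := by
    rintro rfl
    have hcs := h.cross_self
    by_cases hb : b = l ∨ b = l'
    · rcases hb with rfl | rfl <;> omega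
    · push Not at hb
      exact h.not_rowStuck (hy b hb.1 hb.2) (by omega) l l' hb.1.symm hb.2.symm hl (by omega)
        (by omega) hy
  by_cases hb : l = b
  · exact ⟨k, l', hka, fun e => hl (hb.trans e.symm), by omega,
      fun k0 l0 h0 => Or.inl (ht k0 l0 h0)⟩
  · exact ⟨k, l, hka, hb, by omega, fun k0 l0 h0 => Or.inl (ht k0 l0 h0)⟩

/-- By `off_cross`, the next box must share its row or its column with every tight pair. The cases
are two disjoint tight pairs, several in one row, several in one column (by transposition), and a
single pair. -/
theorem Aft.exists_box_of_tight {s : ι → κ → ℕ} {a : ι} {b : κ} (h : Aft s a b)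
    (hr : ∀ k, 2 * rowSum s k ≤ total s)
    (hc : ∀ l, 2 * colSum s l ≤ total s) {k : ι} {l : κ} (h1 : Tight s k l) :
    ∃ i j, i ≠ a ∧ j ≠ b ∧ s i j ≠ 0 ∧
      ∀ k0 l0, Tight s k0 l0 → k0 = i ∨ l0 = j := by
  by_cases hX : ∃ k0 l0, Tight s k0 l0 ∧ k ≠ k0 ∧ l ≠ l0
  · obtain ⟨k0, l0, h0, hk, hl⟩ := hX
    exact h.exists_box_of_two_tight hr hc h1 h0 hk hl
  push Not at hX
  by_cases hR : ∃ l0, Tight s k l0 ∧ l ≠ l0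
  · obtain ⟨l0, h0, hl⟩ := hR
    by_cases hk : ∀ k1 l1, Tight s k1 l1 → k1 = k
    · exact h.exists_box_of_tight_row hr hc h1 h0 hl hk
    · push Not at hk
      obtain ⟨k1, l1, h2, hk⟩ := hk
      have := hX k1 l1 h2 hk.symm
      subst this
      exact h.exists_box_of_two_tight hr hc h0 h2 hk.symm hl.symm
  push Not at hR
  by_cases hC : ∃ k0, Tight s k0 l ∧ k ≠ k0
  · obtain ⟨k0, h0, hk⟩ := hC
    have hall : ∀ l1 k1, Tight (fun j i => s i j) l1 k1 → l1 = l := by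
      intro l1 k1 h2
      by_cases hk1 : k = k1
      · subst hk1
        exact (hR l1 h2.flip).symm
      · exact (hX k1 l1 h2.flip hk1).symm
    obtain ⟨j, i, hj, hi, hp, ho⟩ := h.flip.exists_box_of_tight_row
      (by simpa only [colSum_flip, total_flip] using hc)
      (by simpa only [rowSum_flip, total_flip] using hr) h1.flip h0.flip hk hall
    exact ⟨i, j, hi, hj, hp, fun k0 l0 h0 => (ho l0 k0 h0.flip).symm⟩
  push Not at hC
  have huniq : ∀ k0 l0, Tight s k0 l0 → k0 = k ∧ l0 = l := by
    intro k0 l0 h0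
    by_cases hk : k = k0
    · subst hk
      exact ⟨rfl, (hR l0 h0).symm⟩
    · have := hX k0 l0 h0 hk
      subst this
      exact absurd (hC k0 h0) hk
  -- With a single tight pair any nonempty box of row k or of column l will do, provided that it
  -- avoids row a and column b.
  obtain ⟨h1, h1'⟩ := h1
  have r1 := hr k
  have c1 := hc l
  by_cases hak : k = a
  · have hlb : l ≠ b := by
      rintro rfl
      subst hak
      have := h.cross_self
      omega
    obtain ⟨i, hik, hi⟩ := exists_ne_of_lt_sum (f := fun x => s x l) (k := k)
      (show _ < colSum s l by have := entry_le_rowSum s k l; omega)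
    exact ⟨i, l, fun e => hik (e.trans hak.symm), hlb, hi,
      fun k0 l0 h0 => Or.inr (huniq k0 l0 h0).2⟩
  · by_cases hrow : s k b < ∑ j, s k j
    · obtain ⟨j, hjb, hj⟩ := exists_ne_of_lt_sum hrow
      exact ⟨k, j, hak, hjb, hj, fun k0 l0 h0 => Or.inl (huniq k0 l0 h0).1⟩
    · change ¬ s k b < rowSum s k at hrow
      have hcb := hc b
      have := entry_le_colSum s k b
      have hlb : l ≠ b := by rintro rfl; omega
      by_cases hcol : s a l < ∑ i, s i l
      · obtain ⟨i, hia, hi⟩ := exists_ne_of_lt_sum (f := fun x => s x l) hcol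
        exact ⟨i, l, hia, hlb, hi, fun k0 l0 h0 => Or.inr (huniq k0 l0 h0).2⟩
      -- Now row k lies inside column b and column l inside row a, so row a and column b each hold
      -- half of the table. As l ≠ b, row a is not contained in the box (a, b), and `cross_self` is
      -- violated.
      · change ¬ s a l < colSum s l at hcol
        have := pair_le_sum (s a) hlb
        change _ ≤ rowSum s a at this
        have := hr a
        have := h.cross_self
        omega

/-- When no row and no column exceeds half, neither kind of stuck line can occur. It remains to meet
all tight pairs and to avoid the odd vertex beside a full square. -/
theorem Aft.exists_good_of_balanced {s : ι → κ → ℕ} {a : ι} {b : κ} (h : Aft s a b)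
    (hN : total s ≠ 0) (hr : ∀ k, 2 * rowSum s k ≤ total s)
    (hc : ∀ l, 2 * colSum s l ≤ total s) : ∃ i j, i ≠ a ∧ j ≠ b ∧ Good s i j := by
  have hw : ∀ i j, s i j ≠ 0 → (∀ k l, k ≠ i → l ≠ j → 2 * s k l < rowSum s k + colSum s l →
      rowSum s k + colSum s l ≠ total s) → ¬ FullSquare s i j → Good s i j := by
    intro i j h1 h2 h3
    refine h.good h1 (fun k _ => hr k) (fun l _ => hc l) h2 ?_ ?_ h3
    · rintro ⟨-, h4, -⟩
      have := hc j; omega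
    · rintro ⟨-, h4, -⟩
      rw [rowSum_flip, total_flip] at h4
      have := hr i; omega
  by_cases hZ : ∃ k l, 2 * s k l < rowSum s k + colSum s l ∧ rowSum s k + colSum s l = total s
  · obtain ⟨k, l, hkl, htight⟩ := hZ
    have hrk : 2 * rowSum s k = total s := by have := hr k; have := hc l; omega
    have hcl : 2 * colSum s l = total s := by have := hr k; have := hc l; omega
    -- a box on the cross of a tight pair is not the odd vertex beside a full square
    have hF : ∀ i j, i = k ∨ j = l → ¬ FullSquare s i j := by
      rintro i j hij ⟨f1, f2, k1, k2, l1, l2, ⟨hk1, hk2, hk12⟩, -, ⟨n1, n2, n3, n4⟩, -⟩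
      have h1 := pair_le_sum (fun x => s x l1) hk12
      have h2 := pair_le_sum (s k1) (k := l1) (k' := l2)
      have h3 := entry_le_rowSum s k1 l1
      have h4 := entry_le_rowSum s k2 l1
      have h5 := rowSum_triple_le s hk12 hk1.symm hk2.symm
      rcases hij with rfl | rfl <;> omega
    obtain ⟨i, j, hi, hj, hp, ho⟩ := h.exists_box_of_tight hr hc ⟨hkl, htight⟩
    refine ⟨i, j, hi, hj, hw i j hp (fun k l h1 h2 h3 h4 => ?_) (hF i j (by
      have := ho k l ⟨hkl, htight⟩; tauto))⟩
    rcases ho k l ⟨h3, h4⟩ with h5 | h5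
    · exact h1 h5
    · exact h2 h5
  · push Not at hZ
    have hw' : ∀ i j, s i j ≠ 0 → ¬ FullSquare s i j → Good s i j := fun i j h1 h2 =>
      hw i j h1 (fun k l _ _ h3 => hZ k l h3) h2
    obtain ⟨i, j, hi, hj, hp⟩ : ∃ i j, i ≠ a ∧ j ≠ b ∧ s i j ≠ 0 := by
      -- If everything lay in row a and column b, then N + s_ab = r_a + c_b. By `cross_self` this
      -- forces the whole table into the box (a, b), against the bound of one half for row a.
      by_contra! h0
      have e1 : ∀ i, i ≠ a → rowSum s i = s i b := fun i hi =>
        Fintype.sum_eq_single b fun j hj => h0 i j hi hj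
      have e2 : total s + s a b = rowSum s a + colSum s b := by
        unfold total colSum
        rw [← Finset.add_sum_erase _ _ (Finset.mem_univ a),
          ← Finset.add_sum_erase _ (fun i => s i b) (Finset.mem_univ a),
          Finset.sum_congr rfl fun i hi => e1 i (Finset.ne_of_mem_erase hi)]
        ring
      have := h.cross_self
      have := hr a
      have := hc b
      have := entry_le_rowSum s a b
      have := entry_le_colSum s a b
      omega
    -- If the chosen box is the odd one, a box of the square itself is taken instead. Its row has
    -- two nonempty boxes, so it is not the odd vertex of another square; one of the four boxes
    -- avoids row a and column b.
    by_cases hF : FullSquare s i j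
    · obtain ⟨f1, f2, k1, k2, l1, l2, ⟨hk1, hk2, hk12⟩, ⟨-, -, hl12⟩, ⟨n1, n2, n3, n4⟩, -⟩ := hF
      have hF' : ∀ k l l', l ≠ l' → s k l ≠ 0 → s k l' ≠ 0 → ∀ j, ¬ FullSquare s k j := by
        rintro k l l' hl h1 h2 j ⟨f3, -⟩
        have := pair_le_sum (s k) hl
        change _ ≤ rowSum s k at this
        omega
      by_cases ha : k1 = a
      · have ha' : k2 ≠ a := fun e => hk12 (ha.trans e.symm)
        by_cases hb : l1 = b
        · exact ⟨k2, l2, ha', fun e => hl12 (hb.trans e.symm), hw' _ _ n4 (hF' _ _ _ hl12 n3 n4 _)⟩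
        · exact ⟨k2, l1, ha', hb, hw' _ _ n3 (hF' _ _ _ hl12 n3 n4 _)⟩
      · by_cases hb : l1 = b
        · exact ⟨k1, l2, ha, fun e => hl12 (hb.trans e.symm), hw' _ _ n2 (hF' _ _ _ hl12 n1 n2 _)⟩
        · exact ⟨k1, l1, ha, hb, hw' _ _ n1 (hF' _ _ _ hl12 n1 n2 _)⟩
    · exact ⟨i, j, hi, hj, hw' i j hp hF⟩

/-- From a good box the path can be extended. -/
theorem exists_good_of_good_addOne {s : ι → κ → ℕ} {a : ι} {b : κ}
    (hg : Good (addOne s a b) a b) (hN : total s ≠ 0) : ∃ i j, i ≠ a ∧ j ≠ b ∧ Good s i j := by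
  have h := aft_of_good hg
  by_cases hr : ∃ ρ, 2 * rowSum s ρ = total s + 1
  · obtain ⟨ρ, hρ⟩ := hr
    exact h.exists_good_of_majority hρ
  by_cases hc : ∃ γ, 2 * colSum s γ = total s + 1
  · obtain ⟨γ, hγ⟩ := hc
    obtain ⟨j, i, hj, hi, h1⟩ := h.flip.exists_good_of_majority (ρ := γ)
      (by simpa only [colSum_flip, total_flip] using hγ)
    exact ⟨i, j, hi, hj, h1.flip⟩
  push Not at hr hc
  exact h.exists_good_of_balanced hN (fun k => by have := h.row k; have := hr k; omega)
    (fun k => by have := h.col k; have := hc k; omega)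

end Arithmetic

end SkewGen

namespace SkewGen

/-! ### Hamiltonian paths as lists -/

section Paths

variable {V : Type*}

theorem exists_walk_of_isChain (G : SimpleGraph V) (v : V) (l : List V)
    (h : (v :: l).IsChain G.Adj) : ∃ (b : V) (w : G.Walk v b), w.support = v :: l := by
  induction l generalizing v with
  | nil => exact ⟨v, .nil, rfl⟩
  | cons x l ih =>
    rw [List.isChain_cons_cons] at h
    obtain ⟨b, w, hw⟩ := ih x h.2
    exact ⟨b, .cons h.1 w, by simp [hw]⟩

theorem isHamPathFrom_iff [DecidableEq V] (G : SimpleGraph V) (v : V) (P : List V) :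
    IsHamPathFrom G v P ↔
      (∃ l, P = v :: l) ∧ P.IsChain G.Adj ∧ P.Nodup ∧ ∀ x, x ∈ P := by
  constructor
  · rintro ⟨b, w, hw, rfl⟩
    exact ⟨⟨_, w.cons_tail_support.symm⟩, w.isChain_adj_support, hw.isPath.support_nodup, hw.mem_support⟩
  · rintro ⟨⟨l, rfl⟩, hc, hn, hall⟩
    obtain ⟨b, w, hw⟩ := exists_walk_of_isChain G v l hc
    refine ⟨b, w, fun a => ?_, hw⟩
    rw [hw]
    exact List.count_eq_one_of_mem hn (hall a)

/-- Along a list of consecutive neighbours, the number of components of `H ∖ S` is bounded by the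
number of terms in `S`, plus one if the first term exists and is not in `S`. -/
theorem exists_components_of_isChain (H : SimpleGraph V) (S : Set V) (L : List V)
    (hL : L.IsChain H.Adj) : ∃ F : Finset (H.induce Sᶜ).ConnectedComponent,
      (∀ x ∈ L, ∀ hx : x ∈ Sᶜ, (H.induce Sᶜ).connectedComponentMk ⟨x, hx⟩ ∈ F) ∧
      (∃ A : Finset V, (∀ a ∈ A, a ∈ S ∧ a ∈ L) ∧ (L.Nodup → F.card ≤ A.card + 1) ∧
        (L.Nodup → (∀ x ∈ L.head?, x ∈ S) → F.card ≤ A.card)) := by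
  classical
  induction L with
  | nil => exact ⟨∅, by simp, ∅, by simp⟩
  | cons x L ih =>
    obtain ⟨F, hF, A, hA, h1, h2⟩ := ih hL.tail
    by_cases hx : x ∈ S
    · refine ⟨F, ?_, insert x A, ?_, ?_, ?_⟩
      · intro y hy hyS
        rcases List.mem_cons.1 hy with rfl | hy
        · exact absurd hx hyS
        · exact hF y hy hyS
      · intro a ha
        rcases Finset.mem_insert.1 ha with rfl | ha
        · exact ⟨hx, List.mem_cons_self⟩
        · exact ⟨(hA a ha).1, List.mem_cons_of_mem _ (hA a ha).2⟩
      all_goals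
        intro hn
        rw [List.nodup_cons] at hn
        rw [Finset.card_insert_of_notMem fun h => hn.1 (hA x h).2]
        have := h1 hn.2
        omega
    · cases L with
      | nil =>
        refine ⟨{(H.induce Sᶜ).connectedComponentMk ⟨x, hx⟩}, ?_, ∅, by simp, by simp, ?_⟩
        · intro y hy hyS
          rw [List.mem_singleton] at hy
          subst hy
          exact Finset.mem_singleton_self _
        · intro _ h
          exact absurd (h x rfl) hx
      | cons y L =>
        rw [List.isChain_cons_cons] at hL
        by_cases hy : y ∈ S
        -- The component of x may be new, but the tail begins in S, so the sharper bound without the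
        -- extra one applies to the tail.
        · refine ⟨insert ((H.induce Sᶜ).connectedComponentMk ⟨x, hx⟩) F, ?_, A, ?_, ?_, ?_⟩
          · intro z hz hzS
            rcases List.mem_cons.1 hz with rfl | hz
            · exact Finset.mem_insert_self _ _
            · exact Finset.mem_insert_of_mem (hF z hz hzS)
          · exact fun a ha => ⟨(hA a ha).1, List.mem_cons_of_mem _ (hA a ha).2⟩
          · intro hn
            have := h2 (List.nodup_cons.1 hn).2 (by simpa using hy)
            have := Finset.card_insert_le ((H.induce Sᶜ).connectedComponentMk ⟨x, hx⟩) F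
            omega
          · intro _ h
            exact absurd (h x rfl) hx
        · refine ⟨F, ?_, A, ?_, ?_, ?_⟩
          · intro z hz hzS
            rcases List.mem_cons.1 hz with rfl | hz
            · have : (H.induce Sᶜ).connectedComponentMk ⟨z, hx⟩ =
                  (H.induce Sᶜ).connectedComponentMk ⟨y, hy⟩ :=
                SimpleGraph.ConnectedComponent.connectedComponentMk_eq_of_adj
                  (show H.Adj z y from hL.1)
              rw [this]
              exact hF y List.mem_cons_self hy
            · exact hF z hz hzS
          · exact fun a ha => ⟨(hA a ha).1, List.mem_cons_of_mem _ (hA a ha).2⟩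
          · exact fun hn => h1 (List.nodup_cons.1 hn).2
          · intro _ h
            exact absurd (h x rfl) hx

/-- Removing S from the rest of the path cuts it into at most |S| + 1 pieces. If S contains all
neighbours of w, it contains the second vertex of the path, and one piece is saved. -/
theorem isTough_of_isChain [Finite V] (H : SimpleGraph V) (w : V) (L : List V)
    (hc : (w :: L).IsChain H.Adj) (hn : (w :: L).Nodup) (hall : ∀ x, x ∈ w :: L) :
    IsTough H w := by
  classical
  rw [List.nodup_cons] at hn
  have key : ∀ S : Set V, S ⊆ {w}ᶜ → numComp H ({w} ∪ S) ≤ S.ncard + 1 ∧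
      ((∀ x ∈ L.head?, x ∈ S) → numComp H ({w} ∪ S) ≤ S.ncard) := by
    intro S hS
    obtain ⟨F, hF, A, hA, h1, h2⟩ := exists_components_of_isChain H ({w} ∪ S) L hc.tail
    have hcard : numComp H ({w} ∪ S) ≤ F.card := by
      have hall' : ∀ c, c ∈ F := by
        intro c
        induction c using SimpleGraph.ConnectedComponent.ind with
        | h v =>
          obtain ⟨x, hx⟩ := v
          refine hF x ?_ hx
          rcases List.mem_cons.1 (hall x) with rfl | h
          · exact absurd (Or.inl rfl) hx
          · exact h
      have : Set.univ ⊆ (F : Set _) := fun c _ => hall' c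
      unfold numComp
      rw [← Set.ncard_univ, ← Set.ncard_coe_finset]
      exact Set.ncard_le_ncard this F.finite_toSet
    have hAS : A.card ≤ S.ncard := by
      rw [← Set.ncard_coe_finset]
      refine Set.ncard_le_ncard (fun a ha => ?_) (Set.toFinite S)
      obtain ⟨h3, h4⟩ := hA a ha
      rcases h3 with rfl | h3
      · exact absurd h4 hn.1
      · exact h3
    refine ⟨by have := h1 hn.2; omega, fun hh => ?_⟩
    have := h2 hn.2 fun x hx => Or.inr (hh x hx)
    omega
  refine ⟨fun S hS => (key S hS).1, fun S hS hN => (key S hS).2 fun x hx => hN ?_⟩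
  cases L with
  | nil => simp at hx
  | cons y L =>
    simp only [List.head?_cons, Option.mem_def, Option.some.injEq] at hx
    subst hx
    exact (List.isChain_cons_cons.1 hc).1

theorem IsToughRun.exists_cons {G : SimpleGraph V} {v : V} {P : List V} (h : IsToughRun G v P) :
    (∃ l, P = v :: l) ∧ P.IsChain G.Adj ∧ P.Nodup := by
  induction h with
  | start => exact ⟨⟨[], rfl⟩, by simp, by simp⟩
  | extend l u w hrun hadj hw htough ih =>
    obtain ⟨⟨l', hl'⟩, hc, hn⟩ := ih
    refine ⟨⟨l' ++ [w], by simp [hl']⟩, ?_, ?_⟩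
    · rw [List.isChain_append]
      refine ⟨hc, by simp, ?_⟩
      intro x hx y hy
      simp at hx hy
      subst hx hy
      exact hadj
    · rw [List.nodup_append]
      refine ⟨hn, by simp, ?_⟩
      rintro a ha b hb rfl
      rw [List.mem_singleton] at hb
      subst hb
      exact hw ha

/-- The part of the path from w on, read inside the induced subgraph, is a Hamiltonian path of what
is left after the deletion of the prefix. -/
theorem isTough_induce_of_isChain [Finite V] (G : SimpleGraph V) (l : List V) (w : V) (r : List V)
    (hc : (l ++ w :: r).IsChain G.Adj) (hn : (l ++ w :: r).Nodup)
    (hall : ∀ x, x ∈ l ++ w :: r) (hw : w ∉ l) :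
    IsTough (G.induce {x | x ∉ l}) ⟨w, hw⟩ := by
  rw [List.nodup_append] at hn
  have hr : ∀ x ∈ r, x ∈ {x | x ∉ l} := fun x hx hxl =>
    hn.2.2 x hxl x (List.mem_cons_of_mem _ hx) rfl
  lift r to List {x | x ∉ l} using hr
  have hmap : w :: List.map Subtype.val r = List.map Subtype.val (⟨w, hw⟩ :: r) := rfl
  rw [hmap] at hc hn hall
  refine isTough_of_isChain _ ⟨w, hw⟩ r ?_ (List.Nodup.of_map _ hn.2.1) ?_
  · exact List.isChain_of_isChain_map Subtype.val (fun a b h => h) (List.isChain_append.1 hc).2.1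
  · rintro ⟨x, hx⟩
    have := (List.mem_append.1 (hall x)).resolve_left hx
    obtain ⟨y, hy, hyx⟩ := List.mem_map.1 this
    have : y = ⟨x, hx⟩ := Subtype.ext hyx
    exact this ▸ hy

/-- From left to right every prefix of the path is a run, because the remaining suffix witnesses
toughness. From right to left a repetition-free chain with as many terms as there are vertices is
spanning. -/
theorem isHamPathFrom_iff_isToughRun [Fintype V] [DecidableEq V] (G : SimpleGraph V) (v : V)
    (P : List V) :
    IsHamPathFrom G v P ↔ IsToughRun G v P ∧ P.length = Fintype.card V := by
  rw [isHamPathFrom_iff]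
  constructor
  · rintro ⟨⟨l, rfl⟩, hc, hn, hall⟩
    refine ⟨?_, ?_⟩
    · suffices h : ∀ m r, v :: l = (v :: m) ++ r → IsToughRun G v (v :: m) from
        h l [] (by simp)
      intro m
      induction m using List.reverseRecOn with
      | nil => exact fun _ _ => .start
      | append_singleton m w ih =>
        intro r hr
        have h1 := ih (w :: r) (by simpa using hr)
        obtain ⟨m', u, hm'⟩ : ∃ m' u, v :: m = m' ++ [u] :=
          ⟨_, _, (List.dropLast_append_getLast (List.cons_ne_nil v m)).symm⟩
        have hr' : v :: l = (m' ++ [u]) ++ w :: r := by rw [hr, ← hm']; simp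
        rw [hr'] at hc hn hall
        have hw : w ∉ m' ++ [u] := fun h =>
          (List.nodup_append.1 hn).2.2 w h w List.mem_cons_self rfl
        have : v :: (m ++ [w]) = m' ++ [u] ++ [w] := by rw [← hm']; rfl
        rw [this]
        rw [hm'] at h1
        refine .extend m' u w h1 ?_ hw (isTough_induce_of_isChain G _ w r hc hn hall hw)
        exact (List.isChain_append.1 hc).2.2 u (by simp) w (by simp)
    · rw [← List.toFinset_card_of_nodup hn, ← Finset.card_univ]
      congr 1
      exact Finset.eq_univ_iff_forall.2 fun x => List.mem_toFinset.2 (hall x)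
  · rintro ⟨hrun, hlen⟩
    obtain ⟨h1, hc, hn⟩ := hrun.exists_cons
    refine ⟨h1, hc, hn, fun x => ?_⟩
    rw [← List.toFinset_card_of_nodup hn] at hlen
    exact List.mem_toFinset.1 (Finset.eq_univ_iff_forall.1 (Finset.card_eq_iff_eq_univ _ |>.1 hlen) x)

end Paths

/-! ### Tables of lists of vertices -/

section Tables

variable {p q : ℕ} {T : Fin p → Fin q → ℕ}

/-- The number of vertices of the list in each box. -/
def boxTable : List (Vertex T) → Fin p → Fin q → ℕ
  | [] => fun _ _ => 0
  | v :: l => addOne (boxTable l) v.1.1 v.1.2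

theorem boxTable_eq_countP (l : List (Vertex T)) (i : Fin p) (j : Fin q) :
    boxTable l i j = l.countP fun v => v.1 = (i, j) := by
  induction l with
  | nil => rfl
  | cons v l ih =>
    simp only [boxTable, addOne, ih, List.countP_cons, decide_eq_true_eq]
    congr 1
    refine if_congr ?_ rfl rfl
    rw [Prod.ext_iff]
    constructor <;> rintro ⟨h1, h2⟩ <;> exact ⟨h1.symm, h2.symm⟩

theorem boxTable_append (l r : List (Vertex T)) (i : Fin p) (j : Fin q) :
    boxTable (l ++ r) i j = boxTable l i j + boxTable r i j := by
  simp [boxTable_eq_countP]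

theorem boxTable_of_complete (P : List (Vertex T)) (hn : P.Nodup) (hall : ∀ x, x ∈ P)
    (i : Fin p) (j : Fin q) : boxTable P i j = T i j := by
  rw [boxTable_eq_countP, List.countP_eq_length_filter,
    ← List.toFinset_card_of_nodup (hn.filter _)]
  have : (P.filter fun v => v.1 = (i, j)).toFinset =
      Finset.univ.map ⟨fun k : Fin (T i j) => (⟨(i, j), k⟩ : Vertex T), fun a b h => by
        simpa using h⟩ := by
    ext ⟨b, k⟩
    simp only [List.mem_toFinset, List.mem_filter, hall, true_and, decide_eq_true_eq,
      Finset.mem_map, Finset.mem_univ]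
    constructor
    · rintro rfl
      exact ⟨k, rfl⟩
    · rintro ⟨k', hk'⟩
      exact (Sigma.mk.inj_iff.1 hk').1.symm
  rw [this]
  simp

theorem total_boxTable (l : List (Vertex T)) : total (boxTable l) = l.length := by
  induction l with
  | nil => simp [boxTable, total, rowSum]
  | cons v l ih => simp [boxTable, total_addOne, ih]

/-- This is necessity for whole paths: starting from the last vertex, vertices are prepended one at
a time by `good_addOne`. -/
theorem good_boxTable (w : Vertex T) (l : List (Vertex T))
    (h : (w :: l).IsChain (skewGraph T).Adj) : Good (boxTable (w :: l)) w.1.1 w.1.2 := by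
  induction l generalizing w with
  | nil =>
    refine good_of_total_one ?_ ?_
    · exact total_boxTable [w]
    · simp [boxTable, addOne]
  | cons x l ih =>
    rw [List.isChain_cons_cons] at h
    exact good_addOne (ih x h.2) h.1.1.symm h.1.2.symm

end Tables

end SkewGen

namespace SkewGen

set_option linter.unusedSimpArgs false

/-! ### Running code fragments -/

/-- All registers and all memory cells hold numbers up to `B`. -/
def Bnd (B : ℕ) (c : Config) : Prop := ∀ k, c.reg k ≤ B ∧ c.mem k ≤ B

theorem Bnd.reg {B : ℕ} {c : Config} (h : Bnd B c) {d x pc : ℕ} (hx : x ≤ B) :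
    Bnd B { c with pc := pc, reg := Function.update c.reg d x } := by
  intro k
  refine ⟨?_, (h k).2⟩
  by_cases hk : k = d
  · subst hk; simpa using hx
  · simpa [hk] using (h k).1

theorem Bnd.mem {B : ℕ} {c : Config} (h : Bnd B c) {d x pc : ℕ} (hx : x ≤ B) :
    Bnd B { c with pc := pc, mem := Function.update c.mem d x } := by
  intro k
  refine ⟨(h k).1, ?_⟩
  by_cases hk : k = d
  · subst hk; simpa using hx
  · simpa [hk] using (h k).2

/-- The code `l` stands in the program at position `pc`. -/
def CodeAt (prog : Program) (pc : ℕ) (l : List Instr) : Prop :=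
  ∀ i < l.length, prog[pc + i]? = l[i]?

theorem CodeAt.left {prog : Program} {pc : ℕ} {l r : List Instr} (h : CodeAt prog pc (l ++ r)) :
    CodeAt prog pc l := by
  intro i hi
  rw [h i (by simp; omega), List.getElem?_append_left hi]

theorem CodeAt.right {prog : Program} {pc : ℕ} {l r : List Instr} (h : CodeAt prog pc (l ++ r)) :
    CodeAt prog (pc + l.length) r := by
  intro i hi
  rw [add_assoc, h _ (by simp; omega), List.getElem?_append_right (by omega)]
  congr 1
  omega

theorem CodeAt.get {prog : Program} {pc : ℕ} {l : List Instr} (h : CodeAt prog pc l) (i : ℕ)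
    {a : Instr} (ha : l[i]? = some a) : prog[pc + i]? = some a := by
  rw [h i (List.getElem?_eq_some_iff.1 ha).1, ha]

/-- `c'` is reached from `c` in `t` steps, and all numbers on the way are at most `B`. -/
def Steps (prog : Program) (B : ℕ) (c : Config) (t : ℕ) (c' : Config) : Prop :=
  run prog c t = c' ∧ ∀ u ≤ t, Bnd B (run prog c u)

theorem Steps.refl {prog : Program} {B : ℕ} {c : Config} (h : Bnd B c) : Steps prog B c 0 c :=
  ⟨rfl, fun u hu => by rw [Nat.le_zero.1 hu]; exact h⟩

theorem Steps.trans {prog : Program} {B : ℕ} {c c' c'' : Config} {t t' : ℕ}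
    (h : Steps prog B c t c') (h' : Steps prog B c' t' c'') : Steps prog B c (t + t') c'' := by
  have e : ∀ u, run prog c (t + u) = run prog c' u := fun u => by
    rw [← h.1]
    unfold run
    rw [add_comm, Function.iterate_add_apply]
  refine ⟨by rw [e, h'.1], fun u hu => ?_⟩
  by_cases hut : u ≤ t
  · exact h.2 u hut
  · obtain ⟨w, rfl⟩ := Nat.exists_eq_add_of_le (Nat.le_of_not_le hut)
    rw [e]
    exact h'.2 w (by omega)

theorem Steps.bnd {prog : Program} {B : ℕ} {c c' : Config} {t : ℕ}
    (h : Steps prog B c t c') : Bnd B c' := h.1 ▸ h.2 t le_rfl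

theorem Steps.next {prog : Program} {B : ℕ} {c c' : Config} {t : ℕ} {i : Instr}
    (h : Steps prog B c t c') (hi : prog[c'.pc]? = some i) (hb : Bnd B (i.exec c')) :
    Steps prog B c (t + 1) (i.exec c') := by
  refine h.trans ⟨?_, fun u hu => ?_⟩
  · simp [run, step, hi]
  · rcases Nat.le_one_iff_eq_zero_or_eq_one.1 hu with rfl | rfl
    · exact h.bnd
    · simpa [run, step, hi] using hb

theorem Steps.cast {prog : Program} {B : ℕ} {c c' : Config} {t t' : ℕ}
    (h : Steps prog B c t c') (e : t = t') : Steps prog B c t' c' := e ▸ h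

/-! ### A small structured language -/

/-- States: variables, arrays, the input array, and the output. -/
structure St where
  v : ℕ → ℕ
  a : ℕ → ℕ → ℕ
  inp : ℕ → ℕ
  out : List ℕ

/-- Assignment to a variable. -/
def St.setV (s : St) (x n : ℕ) : St := { s with v := Function.update s.v x n }

/-- Assignment to the cell `i` of the array `k`. -/
def St.setA (s : St) (k i n : ℕ) : St :=
  { s with a := Function.update s.a k (Function.update (s.a k) i n) }

/-- Expressions. -/
inductive Ex where
  | num (c : ℕ)
  | var (x : ℕ)
  | add (a b : Ex)
  | sub (a b : Ex)
  | mul (a b : Ex)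
  /-- the cell of the array `k` with the given index -/
  | arr (k : ℕ) (e : Ex)
  /-- the sum of `e` over all values of the variable `x` below `n` -/
  | sum (x : ℕ) (n e : Ex)

namespace Ex

def eval : Ex → St → ℕ
  | num c, _ => c
  | var x, s => s.v x
  | add a b, s => a.eval s + b.eval s
  | sub a b, s => a.eval s - b.eval s
  | mul a b, s => a.eval s * b.eval s
  | arr k e, s => s.a k (e.eval s)
  | sum x n e, s => ∑ i ∈ Finset.range (n.eval s), e.eval (s.setV x i)

/-- The number of steps of an evaluation. -/
def cost : Ex → St → ℕ
  | num _, _ => 1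
  | var _, _ => 1
  | add a b, s => a.cost s + b.cost s + 1
  | sub a b, s => a.cost s + b.cost s + 1
  | mul a b, s => a.cost s + b.cost s + 1
  | arr _ e, s => e.cost s + 6
  | sum x n e, s => n.cost s + ∑ i ∈ Finset.range (n.eval s), (e.cost (s.setV x i) + 6) + 7

/-- A bound on all numbers that occur in an evaluation. -/
def bd : Ex → ℕ → ℕ
  | num c, _ => c
  | var _, M => M
  | add a b, M => a.bd M + b.bd M
  | sub a b, M => a.bd M + b.bd M
  | mul a b, M => a.bd M + b.bd M + a.bd M * b.bd M
  | arr k e, M => e.bd M * 16 + 16 + k + M + e.bd M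
  | sum _ n e, M => n.bd M + e.bd (M + n.bd M) + n.bd M * e.bd (M + n.bd M) + M + 1

/-- The code length. -/
def size : Ex → ℕ
  | num _ => 1
  | var _ => 1
  | add a b => a.size + b.size + 1
  | sub a b => a.size + b.size + 1
  | mul a b => a.size + b.size + 1
  | arr _ e => e.size + 6
  | sum _ n e => n.size + e.size + 12

/-- Code for the evaluation of an expression, placed at `pc`. The result is put into register `d`;
only registers from `d` on are changed. -/
def comp : Ex → ℕ → ℕ → List Instr
  | num c, _, d => [.const d c]
  | var x, _, d => [.move d x]
  | add a b, pc, d => a.comp pc d ++ (b.comp (pc + a.size) (d + 1) ++ [.add d d (d + 1)])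
  | sub a b, pc, d => a.comp pc d ++ (b.comp (pc + a.size) (d + 1) ++ [.sub d d (d + 1)])
  | mul a b, pc, d => a.comp pc d ++ (b.comp (pc + a.size) (d + 1) ++ [.mul d d (d + 1)])
  | arr k e, pc, d => e.comp pc d ++
      [.const (d + 1) 16, .mul d d (d + 1), .const (d + 1) k, .add d d (d + 1), .add d d 5,
        .load d d]
  | sum x n e, pc, d => n.comp pc d ++ ([.const (d + 1) 0, .move (d + 2) x, .const (d + 3) 0,
        .jumpLT (d + 3) d (pc + n.size + 5), .jump (pc + n.size + e.size + 10), .move x (d + 3)] ++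
      (e.comp (pc + n.size + 6) (d + 4) ++ [.add (d + 1) (d + 1) (d + 4), .const (d + 4) 1,
        .add (d + 3) (d + 3) (d + 4), .jump (pc + n.size + 3), .move x (d + 2), .move d (d + 1)]))

/-- Variables and arrays are in the available range; variable `5` is never changed. -/
def wf : Ex → Prop
  | num _ => True
  | var x => x < 32
  | add a b => a.wf ∧ b.wf
  | sub a b => a.wf ∧ b.wf
  | mul a b => a.wf ∧ b.wf
  | arr k e => k < 16 ∧ e.wf
  | sum x n e => x < 32 ∧ x ≠ 5 ∧ n.wf ∧ e.wf

theorem length_comp (e : Ex) (pc d : ℕ) : (e.comp pc d).length = e.size := by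
  induction e generalizing pc d with
  | num c => rfl
  | var x => rfl
  | add a b iha ihb => simp [comp, size, iha, ihb]; omega
  | sub a b iha ihb => simp [comp, size, iha, ihb]; omega
  | mul a b iha ihb => simp [comp, size, iha, ihb]; omega
  | arr k e ih => simp [comp, size, ih]
  | sum x n e ihn ihe => simp [comp, size, ihn, ihe]; omega

end Ex

/-- All variables and array cells hold numbers up to `M`. -/
def St.Bd (M : ℕ) (s : St) : Prop := (∀ x < 32, s.v x ≤ M) ∧ ∀ k < 16, ∀ x, s.a k x ≤ M

theorem St.Bd.setV {M : ℕ} {s : St} (h : s.Bd M) {x n : ℕ} (hn : n ≤ M) : (s.setV x n).Bd M := by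
  refine ⟨fun y hy => ?_, h.2⟩
  by_cases hxy : y = x
  · subst hxy; simpa [St.setV] using hn
  · simpa [St.setV, hxy] using h.1 y hy

theorem St.Bd.setA {M : ℕ} {s : St} (h : s.Bd M) {k i n : ℕ} (hn : n ≤ M) :
    (s.setA k i n).Bd M := by
  refine ⟨h.1, fun l hl y => ?_⟩
  by_cases hlk : l = k
  · subst hlk
    by_cases hy : y = i
    · subst hy; simpa [St.setA] using hn
    · simpa [St.setA, hy] using h.2 l hl y
  · simpa [St.setA, hlk] using h.2 l hl y

theorem St.Bd.mono {M M' : ℕ} {s : St} (h : s.Bd M) (hM : M ≤ M') : s.Bd M' :=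
  ⟨fun x hx => (h.1 x hx).trans hM, fun k hk x => (h.2 k hk x).trans hM⟩

theorem Ex.eval_le_bd (e : Ex) {s : St} {M : ℕ} (hs : s.Bd M) (he : e.wf) :
    e.eval s ≤ e.bd M := by
  induction e generalizing s M with
  | num c => exact le_rfl
  | var x => exact hs.1 x he
  | add a b iha ihb => exact add_le_add (iha hs he.1) (ihb hs he.2)
  | sub a b iha ihb =>
    exact (Nat.sub_le _ _).trans ((iha hs he.1).trans (Nat.le_add_right _ _))
  | mul a b iha ihb =>
    exact (Nat.mul_le_mul (iha hs he.1) (ihb hs he.2)).trans (Nat.le_add_left _ _)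
  | arr k e ih =>
    have := hs.2 k he.1 (e.eval s)
    simp only [eval, bd]
    omega
  | sum x n e ihn ihe =>
    obtain ⟨hx, hx5, hn, he⟩ := he
    have h1 := ihn hs hn
    have h2 : ∑ i ∈ Finset.range (n.eval s), e.eval (s.setV x i) ≤
        (Finset.range (n.eval s)).card • e.bd (M + n.bd M) :=
      Finset.sum_le_card_nsmul _ _ _ fun i hi =>
        ihe ((hs.mono (Nat.le_add_right _ _)).setV (by have := Finset.mem_range.1 hi; omega)) he
    rw [Finset.card_range, smul_eq_mul] at h2
    have h3 := Nat.mul_le_mul_right (e.bd (M + n.bd M)) h1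
    simp only [eval, bd]
    omega

/-- The machine configuration `c` represents the state `s`. -/
structure Sim (s : St) (c : Config) : Prop where
  reg : ∀ x < 32, c.reg x = s.v x
  mem : ∀ k < 16, ∀ x, c.mem (s.v 5 + (x * 16 + k)) = s.a k x
  inp : ∀ x < s.v 5, c.mem x = s.inp x
  out : c.out = s.out

theorem Sim.setV {s : St} {c c' : Config} (h : Sim s c) {x n : ℕ} (hx5 : x ≠ 5)
    (h1 : ∀ y < 32, c'.reg y = if y = x then n else c.reg y) (h2 : c'.mem = c.mem)
    (h3 : c'.out = c.out) : Sim (s.setV x n) c' := by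
  have h5 : (s.setV x n).v 5 = s.v 5 := by simp [St.setV, Ne.symm hx5]
  refine ⟨fun y hy => ?_, fun k hk y => ?_, fun y hy => ?_, ?_⟩
  · rw [h1 y hy]
    by_cases hyx : y = x
    · subst hyx; simp [St.setV]
    · simp [St.setV, hyx, h.reg y hy]
  · rw [h5, h2]; exact h.mem k hk y
  · rw [h2]; exact h.inp y (h5 ▸ hy)
  · rw [h3]; exact h.out

/-- The outcome of the code of an expression. -/
structure ExPost (c c' : Config) (pc d n : ℕ) : Prop where
  pc : c'.pc = pc
  val : c'.reg d = n
  reg : ∀ r < d, c'.reg r = c.reg r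
  mem : c'.mem = c.mem
  out : c'.out = c.out

theorem Sim.of_reg {s : St} {c c' : Config} (h : Sim s c) (h1 : ∀ y < 32, c'.reg y = c.reg y)
    (h2 : c'.mem = c.mem) (h3 : c'.out = c.out) : Sim s c' :=
  ⟨fun y hy => (h1 y hy).trans (h.reg y hy), h2 ▸ h.mem, h2 ▸ h.inp, h3.trans h.out⟩

theorem ExPost.sim {s : St} {c c' : Config} {pc d n : ℕ} (h : ExPost c c' pc d n) (hs : Sim s c)
    (hd : 32 ≤ d) : Sim s c' :=
  hs.of_reg (fun y hy => h.reg y (by omega)) h.mem h.out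

/-- What is to be shown about the code of an expression. -/
def Ex.Correct (prog : Program) (B : ℕ) (e : Ex) : Prop :=
  ∀ (pc d M : ℕ) (s : St) (c : Config), 32 ≤ d → CodeAt prog pc (e.comp pc d) → c.pc = pc →
    Sim s c → s.Bd M → Bnd B c → e.bd M ≤ B →
    ∃ c', Steps prog B c (e.cost s) c' ∧ ExPost c c' (pc + e.size) d (e.eval s)

/-- The value of the left operand waits in register d, because the code of the right operand changes
only registers from d + 1 on. -/
theorem Ex.correct_binary {prog : Program} {B : ℕ} {a b e : Ex} {op : ℕ → ℕ → ℕ}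
    {ins : ℕ → ℕ → ℕ → Instr} (ha : a.Correct prog B) (hb : b.Correct prog B)
    (hins : ∀ (d x y : ℕ) (c : Config), (ins d x y).exec c =
      { c with pc := c.pc + 1, reg := Function.update c.reg d (op (c.reg x) (c.reg y)) })
    (hcomp : ∀ pc d, e.comp pc d =
      a.comp pc d ++ (b.comp (pc + a.size) (d + 1) ++ [ins d d (d + 1)]))
    (hsize : e.size = a.size + b.size + 1) (hcost : ∀ s, e.cost s = a.cost s + b.cost s + 1)
    (heval : ∀ s, e.eval s = op (a.eval s) (b.eval s))
    (hle : ∀ s M, s.Bd M → e.eval s ≤ e.bd M)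
    (hbda : ∀ M, a.bd M ≤ e.bd M) (hbdb : ∀ M, b.bd M ≤ e.bd M) : e.Correct prog B := by
  intro pc d M s c hd hcode hpc hsim hs hB hM
  rw [hcomp] at hcode
  obtain ⟨c1, hs1, hp1⟩ := ha pc d M s c hd hcode.left hpc hsim hs hB ((hbda M).trans hM)
  have hcode2 := hcode.right
  rw [Ex.length_comp] at hcode2
  obtain ⟨c2, hs2, hp2⟩ := hb (pc + a.size) (d + 1) M s c1 (by omega) hcode2.left hp1.pc
    (hp1.sim hsim hd) hs hs1.bnd ((hbdb M).trans hM)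
  have hi := hcode2.right.get 0 (a := ins d d (d + 1)) rfl
  rw [Ex.length_comp, add_zero, ← hp2.pc] at hi
  have hd2 : c2.reg d = a.eval s := by rw [hp2.reg d (by omega), hp1.val]
  have hv : op (c2.reg d) (c2.reg (d + 1)) = e.eval s := by rw [hd2, hp2.val, heval]
  have h12 := hs1.trans hs2
  refine ⟨_, (h12.next hi ?_).cast (hcost s).symm, ?_⟩
  · rw [hins, hv]
    exact h12.bnd.reg ((hle s M hs).trans hM)
  · rw [hins, hv]
    refine ⟨?_, by simp, fun r hr => ?_, ?_, ?_⟩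
    · simp only [hp2.pc, hsize]; omega
    · simp only
      rw [Function.update_of_ne (by omega), hp2.reg r (by omega), hp1.reg r hr]
    · exact hp2.mem.trans hp1.mem
    · exact hp2.out.trans hp1.out

/-- The sixteen arrays are interleaved above the input: the cell x of array k has address v₅ + 16x +
k. No array needs a length in advance, and different cells never collide. -/
theorem Ex.correct_arr {prog : Program} {B k : ℕ} {e : Ex} (hk : k < 16) (he : e.wf)
    (ih : e.Correct prog B) : (Ex.arr k e).Correct prog B := by
  intro pc d M s c hd hcode hpc hsim hs hB hM
  have hle := e.eval_le_bd hs he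
  have hle5 := hs.1 5 (by omega)
  have hlek := hs.2 k hk (e.eval s)
  simp only [bd] at hM
  obtain ⟨c1, hs1, hp1⟩ := ih pc d M s c hd hcode.left hpc hsim hs hB (by omega)
  have hsim1 := hp1.sim hsim hd
  have hcode2 := hcode.right
  rw [Ex.length_comp] at hcode2
  have hd1 : d ≠ d + 1 := by omega
  have g0 := hcode2.get 0 rfl
  have g1 := hcode2.get 1 rfl
  have g2 := hcode2.get 2 rfl
  have g3 := hcode2.get 3 rfl
  have g4 := hcode2.get 4 rfl
  have g5 := hcode2.get 5 rfl
  have hpc1 := hp1.pc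
  have hv1 := hp1.val
  have hr5 : c1.reg 5 = s.v 5 := hsim1.reg 5 (by omega)
  have h5d : (5 : ℕ) ≠ d := by omega
  have h5d1 : (5 : ℕ) ≠ d + 1 := by omega
  have n1 := hs1.next (by rw [hpc1]; exact g0) (hs1.bnd.reg (show 16 ≤ B by omega))
  have n2 := n1.next (by simp only [Instr.exec, hpc1]; exact g1)
    (by
      refine n1.bnd.reg ?_
      simp [Instr.exec, Function.update_of_ne hd1, hv1]
      omega)
  have n3 := n2.next (by simp only [Instr.exec, hpc1]; exact g2) (n2.bnd.reg (show k ≤ B by omega))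
  have n4 := n3.next (by simp only [Instr.exec, hpc1]; exact g3)
    (by
      refine n3.bnd.reg ?_
      simp [Instr.exec, Function.update_of_ne hd1, hv1]
      omega)
  have n5 := n4.next (by simp only [Instr.exec, hpc1]; exact g4)
    (by
      refine n4.bnd.reg ?_
      simp [Instr.exec, Function.update_of_ne hd1, Function.update_of_ne h5d,
        Function.update_of_ne h5d1, hv1, hr5]
      omega)
  have hm : c1.mem (s.v 5 + (e.eval s * 16 + k)) = s.a k (e.eval s) := hsim1.mem k hk _
  rw [add_comm (s.v 5)] at hm
  have n6 := n5.next (by simp only [Instr.exec, hpc1]; exact g5)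
    (by
      refine n5.bnd.reg ?_
      simp [Instr.exec, Function.update_of_ne hd1, Function.update_of_ne h5d,
        Function.update_of_ne h5d1, hv1, hr5, hm]
      omega)
  refine ⟨_, n6, ?_, ?_, fun r hr => ?_, ?_, ?_⟩
  · simp only [Instr.exec, hpc1, size]
    omega
  · simp [Instr.exec, Function.update_of_ne hd1, Function.update_of_ne h5d,
        Function.update_of_ne h5d1, hv1, hr5, hm, eval]
  · have h1 : r ≠ d := by omega
    have h2 : r ≠ d + 1 := by omega
    simp [Instr.exec, Function.update_of_ne h1, Function.update_of_ne h2, hp1.reg r hr]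
  · exact hp1.mem
  · exact hp1.out

/-- Register d keeps the number of terms, d + 1 the partial sum, d + 2 the old value of x and d + 3
the counter; terms are evaluated from d + 4 on. The variable x is restored at the end, so an
expression has no side effect on the state. -/
theorem Ex.correct_sum {prog : Program} {B x : ℕ} {n e : Ex} (hx : x < 32) (hx5 : x ≠ 5)
    (hn : n.wf) (he : e.wf) (ihn : n.Correct prog B) (ihe : e.Correct prog B) :
    (Ex.sum x n e).Correct prog B := by
  intro pc d M s c hd hcode hpc hsim hs hB hM
  have hnle := n.eval_le_bd hs hn
  have hxle := hs.1 x hx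
  have hsum : ∀ i ≤ n.eval s, ∑ j ∈ Finset.range i, e.eval (s.setV x j) ≤
      n.bd M * e.bd (M + n.bd M) := by
    intro i hi
    have h2 : ∑ j ∈ Finset.range i, e.eval (s.setV x j) ≤
        (Finset.range i).card • e.bd (M + n.bd M) :=
      Finset.sum_le_card_nsmul _ _ _ fun j hj =>
        e.eval_le_bd ((hs.mono (Nat.le_add_right _ _)).setV
          (by have := Finset.mem_range.1 hj; omega)) he
    rw [Finset.card_range, smul_eq_mul] at h2
    exact h2.trans (Nat.mul_le_mul_right _ (hi.trans hnle))
  simp only [bd] at hM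
  obtain ⟨c1, hs1, hp1⟩ := ihn pc d M s c hd hcode.left hpc hsim hs hB (by omega)
  have hsim1 := hp1.sim hsim hd
  have hcode2 := hcode.right
  rw [Ex.length_comp] at hcode2
  have hcode3 := hcode2.right.left
  have hcode4 := hcode2.right.right
  rw [Ex.length_comp] at hcode4
  simp only [List.length_cons, List.length_nil] at hcode3 hcode4
  have g0 := hcode2.left.get 0 rfl
  have g1 := hcode2.left.get 1 rfl
  have g2 := hcode2.left.get 2 rfl
  have g3 := hcode2.left.get 3 rfl
  have g4 := hcode2.left.get 4 rfl
  have g5 := hcode2.left.get 5 rfl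
  have k0 := hcode4.get 0 rfl
  have k1 := hcode4.get 1 rfl
  have k2 := hcode4.get 2 rfl
  have k3 := hcode4.get 3 rfl
  have k4 := hcode4.get 4 rfl
  have k5 := hcode4.get 5 rfl
  have hpc1 := hp1.pc
  have hv1 := hp1.val
  have hc1x : c1.reg x = s.v x := hsim1.reg x hx
  have n1 := hs1.next (by rw [hpc1]; exact g0) (hs1.bnd.reg (Nat.zero_le B))
  have n2 := n1.next (by simp only [Instr.exec, hpc1]; exact g1)
    (n1.bnd.reg (n1.bnd x).1)
  have n3 := n2.next (by simp only [Instr.exec, hpc1]; exact g2) (n2.bnd.reg (Nat.zero_le B))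
  have loop : ∀ i ≤ n.eval s, ∃ ci, Steps prog B c
      (n.cost s + 3 + ∑ j ∈ Finset.range i, (e.cost (s.setV x j) + 6)) ci ∧
      ci.pc = pc + n.size + 3 ∧ ci.reg d = n.eval s ∧
      ci.reg (d + 1) = ∑ j ∈ Finset.range i, e.eval (s.setV x j) ∧ ci.reg (d + 2) = s.v x ∧
      ci.reg (d + 3) = i ∧ (∀ r < d, r ≠ x → ci.reg r = c1.reg r) ∧ ci.mem = c1.mem ∧
      ci.out = c1.out := by
    intro i
    induction i with
    | zero =>
      intro _
      refine ⟨_, n3.cast (by simp), ?_, ?_, ?_, ?_, ?_, ?_, rfl, rfl⟩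
      · simp [Instr.exec, hpc1]
      · simp [Instr.exec, Function.update_of_ne (show d ≠ d + 1 by omega),
          Function.update_of_ne (show d ≠ d + 2 by omega),
          Function.update_of_ne (show d ≠ d + 3 by omega), hv1]
      · simp [Instr.exec]
      · simp [Instr.exec, Function.update_of_ne (show x ≠ d + 1 by omega), hc1x]
      · simp [Instr.exec]
      · intro r hr _
        simp [Instr.exec, Function.update_of_ne (show r ≠ d + 1 by omega),
          Function.update_of_ne (show r ≠ d + 2 by omega),
          Function.update_of_ne (show r ≠ d + 3 by omega)]
    | succ i ih =>
      intro hi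
      obtain ⟨ci, hsi, hpci, hd0, hd1, hd2, hd3, hr, hm, ho⟩ := ih (by omega)
      have hlt : ci.reg (d + 3) < ci.reg d := by rw [hd0, hd3]; omega
      have m1 := hsi.next (by rw [hpci]; exact g3) (by simpa [Bnd, Instr.exec] using hsi.bnd)
      simp only [Instr.exec, hlt, if_true] at m1
      have m2 := m1.next g5 (m1.bnd.reg (m1.bnd (d + 3)).1)
      have hsim2 : Sim (s.setV x i) (Instr.exec ({ ci with pc := pc + n.size + 5 })
          (Instr.move x (d + 3))) := by
        refine hsim1.setV hx5 (fun y hy => ?_) hm ho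
        by_cases hyx : y = x
        · subst hyx; simp [Instr.exec, hd3]
        · simp [Instr.exec, hyx, hr y (by omega) hyx]
      -- The summation variable may exceed M, but not the bound for the number of terms; this is why
      -- `bd` evaluates the summand at M + n.bd M.
      have hsi' : (s.setV x i).Bd (M + n.bd M) :=
        (hs.mono (Nat.le_add_right _ _)).setV (by omega)
      obtain ⟨c2, hs2, hp2⟩ := ihe (pc + n.size + 6) (d + 4) (M + n.bd M) (s.setV x i) _ (by omega)
        hcode3 rfl hsim2 hsi' m2.bnd (by omega)
      have m3 := m2.trans hs2
      have hpc2 := hp2.pc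
      have hv2 := hp2.val
      have e1 : c2.reg (d + 1) = ∑ j ∈ Finset.range i, e.eval (s.setV x j) := by
        rw [hp2.reg _ (by omega)]
        simp [Instr.exec, Function.update_of_ne (show d + 1 ≠ x by omega), hd1]
      have e3 : c2.reg (d + 3) = i := by
        rw [hp2.reg _ (by omega)]
        simp [Instr.exec, Function.update_of_ne (show d + 3 ≠ x by omega), hd3]
      have hsum' := hsum (i + 1) hi
      rw [Finset.sum_range_succ] at hsum'
      have hle1 := e.eval_le_bd hsi' he
      have m4 := m3.next (by rw [hpc2]; exact k0) (by
      refine m3.bnd.reg ?_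
      rw [e1, hv2]
      omega)
      have m5 := m4.next (by simp only [Instr.exec, hpc2]; exact k1)
        (m4.bnd.reg (show 1 ≤ B by omega))
      have m6 := m5.next (by simp only [Instr.exec, hpc2]; exact k2)
        (by
      refine m5.bnd.reg ?_
      simp [Instr.exec, e3]
      omega)
      have m7 := m6.next (by simp only [Instr.exec, hpc2]; exact k3)
        (by simpa [Bnd, Instr.exec] using m6.bnd)
      refine ⟨_, m7.cast ?_, ?_, ?_, ?_, ?_, ?_, ?_, ?_, ?_⟩
      · rw [Finset.sum_range_succ]; omega
      · simp [Instr.exec]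
      · simp [Instr.exec, Function.update_of_ne (show d ≠ d + 1 by omega),
          Function.update_of_ne (show d ≠ d + 4 by omega),
          Function.update_of_ne (show d ≠ d + 3 by omega),
          hp2.reg d (by omega), Function.update_of_ne (show d ≠ x by omega), hd0]
      · simp [Instr.exec, e1, hv2, Finset.sum_range_succ]
      · simp [Instr.exec, hp2.reg (d + 2) (by omega),
          Function.update_of_ne (show d + 2 ≠ x by omega), hd2]
      · simp [Instr.exec, e3]
      · intro r hrd hrx
        simp [Instr.exec, Function.update_of_ne (show r ≠ d + 1 by omega),
          Function.update_of_ne (show r ≠ d + 4 by omega),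
          Function.update_of_ne (show r ≠ d + 3 by omega),
          hp2.reg r (by omega), Function.update_of_ne hrx, hr r hrd hrx]
      · exact hp2.mem.trans hm
      · exact hp2.out.trans ho
  obtain ⟨ci, hsi, hpci, hd0, hd1, hd2, hd3, hr, hm, ho⟩ := loop _ le_rfl
  have hlt : ¬ ci.reg (d + 3) < ci.reg d := by rw [hd0, hd3]; omega
  have m1 := hsi.next (by rw [hpci]; exact g3) (by simpa [Bnd, Instr.exec] using hsi.bnd)
  simp only [Instr.exec, hlt, if_false, hpci] at m1
  have m2 := m1.next g4 (by simpa [Bnd, Instr.exec] using m1.bnd)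
  have m3 := m2.next (by
    simp only [Instr.exec]; rw [← k4]; congr 1; omega) (m2.bnd.reg (m2.bnd (d + 2)).1)
  have m4 := m3.next (by
    simp only [Instr.exec]; rw [← k5]; congr 1; omega) (m3.bnd.reg (m3.bnd (d + 1)).1)
  refine ⟨_, m4.cast ?_, ?_, ?_, fun r hrd => ?_, ?_, ?_⟩
  · simp only [cost]; omega
  · simp only [Instr.exec, size]; omega
  · simp [Instr.exec, Function.update_of_ne (show d + 1 ≠ x by omega), hd1, eval]
  · by_cases hrx : r = x
    · subst hrx
      simp [Instr.exec, Function.update_of_ne (show r ≠ d by omega), hd2]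
      rw [← hp1.reg r hrd, hc1x]
    · simp [Instr.exec, Function.update_of_ne (show r ≠ d by omega),
        Function.update_of_ne hrx, hr r hrd hrx, hp1.reg r hrd]
  · exact hm.trans hp1.mem
  · exact ho.trans hp1.out

theorem Ex.correct {prog : Program} {B : ℕ} (e : Ex) (he : e.wf) : e.Correct prog B := by
  induction e with
  | num n =>
    intro pc d M s c hd hcode hpc hsim hs hB hM
    have n1 := (Steps.refl (prog := prog) hB).next (by rw [hpc]; exact hcode.get 0 rfl)
      (hB.reg hM)
    exact ⟨_, n1, by simp [Instr.exec, hpc, size], by simp [Instr.exec, eval],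
      fun r hr => by simp [Instr.exec, Function.update_of_ne (show r ≠ d by omega)], rfl, rfl⟩
  | var x =>
    intro pc d M s c hd hcode hpc hsim hs hB hM
    have n1 := (Steps.refl (prog := prog) hB).next (by rw [hpc]; exact hcode.get 0 rfl)
      (hB.reg (hB x).1)
    exact ⟨_, n1, by simp [Instr.exec, hpc, size],
      by simpa [Instr.exec, eval] using hsim.reg x he,
      fun r hr => by simp [Instr.exec, Function.update_of_ne (show r ≠ d by omega)], rfl, rfl⟩
  | add a b iha ihb =>
    exact Ex.correct_binary (op := (· + ·)) (ins := .add) (iha he.1) (ihb he.2)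
      (fun _ _ _ _ => rfl) (fun _ _ => rfl) rfl (fun _ => rfl) (fun _ => rfl)
      (fun s M h => Ex.eval_le_bd (.add a b) h he) (fun M => by simp only [bd]; omega)
      (fun M => by simp only [bd]; omega)
  | sub a b iha ihb =>
    exact Ex.correct_binary (op := (· - ·)) (ins := .sub) (iha he.1) (ihb he.2)
      (fun _ _ _ _ => rfl) (fun _ _ => rfl) rfl (fun _ => rfl) (fun _ => rfl)
      (fun s M h => Ex.eval_le_bd (.sub a b) h he) (fun M => by simp only [bd]; omega)
      (fun M => by simp only [bd]; omega)
  | mul a b iha ihb =>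
    exact Ex.correct_binary (op := (· * ·)) (ins := .mul) (iha he.1) (ihb he.2)
      (fun _ _ _ _ => rfl) (fun _ _ => rfl) rfl (fun _ => rfl) (fun _ => rfl)
      (fun s M h => Ex.eval_le_bd (.mul a b) h he) (fun M => by simp only [bd]; omega)
      (fun M => by simp only [bd]; omega)
  | arr k e ih => exact Ex.correct_arr he.1 he.2 (ih he.2)
  | sum x n e ihn ihe =>
    exact Ex.correct_sum he.1 he.2.1 he.2.2.1 he.2.2.2 (ihn he.2.2.1) (ihe he.2.2.2)

end SkewGen

namespace SkewGen

set_option linter.unusedSimpArgs false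

/-! ### Commands, their cost, and the correctness of their compilation -/

/-- Commands. -/
inductive Cmd where
  | assign (x : ℕ) (e : Ex)
  | store (k : ℕ) (i e : Ex)
  /-- read a cell of the input -/
  | input (x : ℕ) (e : Ex)
  | print (e : Ex)
  | seq (a b : Cmd)
  /-- `a` if `e` is positive, else `b` -/
  | ite (e : Ex) (a b : Cmd)
  /-- `a` for all values of the variable `x` below `n` -/
  | loop (x : ℕ) (n : Ex) (a : Cmd)

/-- `f 0`, …, `f (n - 1)` one after the other. -/
def iter (f : ℕ → St → St) : ℕ → St → St
  | 0, s => s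
  | n + 1, s => f n (iter f n s)

namespace Cmd

def exec : Cmd → St → St
  | assign x e, s => s.setV x (e.eval s)
  | store k i e, s => s.setA k (i.eval s) (e.eval s)
  | input x e, s => s.setV x (s.inp (e.eval s))
  | print e, s => { s with out := s.out ++ [e.eval s] }
  | seq a b, s => b.exec (a.exec s)
  | ite e a b, s => if 0 < e.eval s then a.exec s else b.exec s
  | loop x n a, s => iter (fun i s => a.exec (s.setV x i)) (n.eval s) s

/-- The state before the `i`-th round of a loop. -/
abbrev before (x : ℕ) (a : Cmd) (s : St) (i : ℕ) : St :=
  (iter (fun i s => a.exec (s.setV x i)) i s).setV x i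

/-- The number of steps. -/
def cost : Cmd → St → ℕ
  | assign _ e, s => e.cost s + 1
  | store _ i e, s => i.cost s + e.cost s + 6
  | input _ e, s => e.cost s + 2
  | print e, s => e.cost s + 1
  | seq a b, s => a.cost s + b.cost (a.exec s)
  | ite e a b, s => e.cost s + 2 + if 0 < e.eval s then a.cost s else b.cost s + 1
  | loop x n a, s =>
    n.cost s + 3 + ∑ i ∈ Finset.range (n.eval s), (a.cost (before x a s i) + 5)

/-- All values that are assigned are at most `M`, and the input is read within its range. -/
def ok (M : ℕ) : Cmd → St → Prop
  | assign _ e, s => e.eval s ≤ M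
  | store _ _ e, s => e.eval s ≤ M
  | input _ e, s => e.eval s < s.v 5 ∧ s.inp (e.eval s) ≤ M
  | print _, _ => True
  | seq a b, s => a.ok M s ∧ b.ok M (a.exec s)
  | ite e a b, s => if 0 < e.eval s then a.ok M s else b.ok M s
  | loop x n a, s => n.eval s ≤ M ∧ ∀ i < n.eval s, a.ok M (before x a s i)

/-- A bound on all numbers that occur. -/
def bd : Cmd → ℕ → ℕ
  | assign _ e, M => e.bd M + M
  | store k i e, M => i.bd M * 17 + 16 + k + M + e.bd M
  | input _ e, M => e.bd M + M
  | print e, M => e.bd M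
  | seq a b, M => a.bd M + b.bd M
  | ite e a b, M => e.bd M + a.bd M + b.bd M
  | loop _ n a, M => n.bd M + a.bd M + M + 1

/-- The code length. -/
def size : Cmd → ℕ
  | assign _ e => e.size + 1
  | store _ i e => i.size + e.size + 6
  | input _ e => e.size + 2
  | print e => e.size + 1
  | seq a b => a.size + b.size
  | ite e a b => e.size + a.size + b.size + 3
  | loop _ n a => n.size + a.size + 7

/-- Code for a command, placed at `pc`, with scratch registers from `d` on. -/
def comp : Cmd → ℕ → ℕ → List Instr
  | assign x e, pc, d => e.comp pc d ++ [.move x d]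
  | store k i e, pc, d => i.comp pc d ++ (e.comp (pc + i.size) (d + 1) ++
      [.const (d + 2) 16, .mul d d (d + 2), .const (d + 2) k, .add d d (d + 2), .add d d 5,
        .store d (d + 1)])
  | input x e, pc, d => e.comp pc d ++ [.load d d, .move x d]
  | print e, pc, d => e.comp pc d ++ [.print d]
  | seq a b, pc, d => a.comp pc d ++ b.comp (pc + a.size) d
  | ite e a b, pc, d => e.comp pc d ++
      ([.const (d + 1) 0, .jumpLT (d + 1) d (pc + e.size + 2 + b.size + 1)] ++
        (b.comp (pc + e.size + 2) d ++ ([.jump (pc + e.size + 2 + b.size + 1 + a.size)] ++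
          a.comp (pc + e.size + 2 + b.size + 1) d)))
  | loop x n a, pc, d => n.comp pc d ++
      ([.const (d + 1) 0, .jumpLT (d + 1) d (pc + n.size + 3), .jump (pc + n.size + a.size + 7),
        .move x (d + 1)] ++ (a.comp (pc + n.size + 4) (d + 3) ++
          [.const (d + 2) 1, .add (d + 1) (d + 1) (d + 2), .jump (pc + n.size + 1)]))

/-- Variables and arrays are in the available range; variable `5` is never changed. -/
def wf : Cmd → Prop
  | assign x e => x < 32 ∧ x ≠ 5 ∧ e.wf
  | store k i e => k < 16 ∧ i.wf ∧ e.wf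
  | input x e => x < 32 ∧ x ≠ 5 ∧ e.wf
  | print e => e.wf
  | seq a b => a.wf ∧ b.wf
  | ite e a b => e.wf ∧ a.wf ∧ b.wf
  | loop x n a => x < 32 ∧ x ≠ 5 ∧ n.wf ∧ a.wf

theorem length_comp (a : Cmd) (pc d : ℕ) : (a.comp pc d).length = a.size := by
  induction a generalizing pc d with
  | assign x e => simp [comp, size, Ex.length_comp]
  | store k i e => simp [comp, size, Ex.length_comp]; omega
  | input x e => simp [comp, size, Ex.length_comp]
  | print e => simp [comp, size, Ex.length_comp]
  | seq a b iha ihb => simp [comp, size, iha, ihb]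
  | ite e a b iha ihb => simp [comp, size, Ex.length_comp, iha, ihb]; omega
  | loop x n a ih => simp [comp, size, Ex.length_comp, ih]; omega

end Cmd

theorem Sim.setA {s : St} {c c' : Config} (h : Sim s c) {k i n : ℕ} (hk : k < 16)
    (h1 : ∀ y < 32, c'.reg y = c.reg y)
    (h2 : c'.mem = Function.update c.mem (s.v 5 + (i * 16 + k)) n)
    (h3 : c'.out = c.out) : Sim (s.setA k i n) c' := by
  refine ⟨fun y hy => (h1 y hy).trans (h.reg y hy), fun l hl x => ?_, fun y hy => ?_, ?_⟩
  · change c'.mem (s.v 5 + (x * 16 + l)) = _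
    rw [h2]
    by_cases hlk : l = k
    · subst hlk
      by_cases hxi : x = i
      · subst hxi; simp [St.setA]
      · rw [Function.update_of_ne (by omega), h.mem l hl]
        simp [St.setA, hxi]
    · rw [Function.update_of_ne (by omega), h.mem l hl]
      simp [St.setA, hlk]
  · change y < s.v 5 at hy
    rw [h2, Function.update_of_ne (by omega)]
    exact h.inp y hy
  · rw [h3]; exact h.out

/-- What is to be shown about the code of a command. -/
def Cmd.Correct (prog : Program) (B : ℕ) (a : Cmd) : Prop :=
  ∀ (pc d M : ℕ) (s : St) (c : Config), 32 ≤ d → CodeAt prog pc (a.comp pc d) → c.pc = pc →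
    Sim s c → s.Bd M → Bnd B c → a.bd M ≤ B → a.ok M s →
    ∃ c', Steps prog B c (a.cost s) c' ∧ c'.pc = pc + a.size ∧ Sim (a.exec s) c' ∧
      (a.exec s).Bd M ∧ ∀ r, 32 ≤ r → r < d → c'.reg r = c.reg r

theorem Cmd.correct_store {prog : Program} {B k : ℕ} {i e : Ex} (hk : k < 16) (hi : i.wf)
    (he : e.wf) : (Cmd.store k i e).Correct prog B := by
  intro pc d M s c hd hcode hpc hsim hs hB hM hok
  have hile := i.eval_le_bd hs hi
  have hele := e.eval_le_bd hs he
  have hle5 := hs.1 5 (by omega)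
  simp only [bd] at hM
  obtain ⟨c0, hs0, hp0⟩ := i.correct hi pc d M s c hd hcode.left hpc hsim hs hB (by omega)
  have hcode1 := hcode.right
  rw [Ex.length_comp] at hcode1
  obtain ⟨c1, hs1', hp1⟩ := e.correct he (pc + i.size) (d + 1) M s c0 (by omega) hcode1.left hp0.pc
    (hp0.sim hsim hd) hs hs0.bnd (by omega)
  have hs1 := hs0.trans hs1'
  have hsim1 := hp1.sim (hp0.sim hsim hd) (by omega)
  have hcode2 := hcode1.right
  rw [Ex.length_comp] at hcode2
  have hd1 : d ≠ d + 2 := by omega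
  have hd2 : d + 1 ≠ d + 2 := by omega
  have g0 := hcode2.get 0 rfl
  have g1 := hcode2.get 1 rfl
  have g2 := hcode2.get 2 rfl
  have g3 := hcode2.get 3 rfl
  have g4 := hcode2.get 4 rfl
  have g5 := hcode2.get 5 rfl
  have hpc1 := hp1.pc
  have hv0 : c1.reg d = i.eval s := (hp1.reg d (by omega)).trans hp0.val
  have hv1 := hp1.val
  have hr5 : c1.reg 5 = s.v 5 := hsim1.reg 5 (by omega)
  have h5d : (5 : ℕ) ≠ d := by omega
  have h5d1 : (5 : ℕ) ≠ d + 2 := by omega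
  have n1 := hs1.next (by rw [hpc1]; exact g0) (hs1.bnd.reg (show 16 ≤ B by omega))
  have n2 := n1.next (by simp only [Instr.exec, hpc1]; exact g1)
    (by refine n1.bnd.reg ?_; simp [Instr.exec, Function.update_of_ne hd1, hv0]; omega)
  have n3 := n2.next (by simp only [Instr.exec, hpc1]; exact g2)
    (n2.bnd.reg (show k ≤ B by omega))
  have n4 := n3.next (by simp only [Instr.exec, hpc1]; exact g3)
    (by refine n3.bnd.reg ?_; simp [Instr.exec, Function.update_of_ne hd1, hv0]; omega)
  have n5 := n4.next (by simp only [Instr.exec, hpc1]; exact g4)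
    (by
      refine n4.bnd.reg ?_
      simp [Instr.exec, Function.update_of_ne hd1, Function.update_of_ne h5d,
        Function.update_of_ne h5d1, hv0, hr5]; omega)
  have n6 := n5.next (by simp only [Instr.exec, hpc1]; exact g5)
    (n5.bnd.mem (n5.bnd (d + 1)).1)
  refine ⟨_, n6.cast ?_, ?_, ?_, hs.setA hok, fun r hr32 hr => ?_⟩
  · simp only [cost]
  · simp only [Instr.exec, hpc1, size]
    omega
  · refine hsim1.setA hk (fun y hy => ?_) ?_ rfl
    · simp [Instr.exec, Function.update_of_ne (show y ≠ d by omega),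
        Function.update_of_ne (show y ≠ d + 2 by omega)]
    · simp [Instr.exec, Function.update_of_ne hd1, Function.update_of_ne h5d,
        Function.update_of_ne h5d1, hv0, hv1, hr5, add_comm]
  · simp [Instr.exec, Function.update_of_ne (show r ≠ d by omega),
      Function.update_of_ne (show r ≠ d + 2 by omega), hp1.reg r (by omega), hp0.reg r hr]

/-- The limit and the counter live in the registers d and d + 1, outside the variables, and the body
is compiled with scratch space from d + 3 on. So the body may change x or the variables in the limit
without disturbing the iteration. -/
theorem Cmd.correct_loop {prog : Program} {B x : ℕ} {n : Ex} {a : Cmd} (hx : x < 32)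
    (hx5 : x ≠ 5) (hn : n.wf) (ih : a.Correct prog B) : (Cmd.loop x n a).Correct prog B := by
  intro pc d M s c hd hcode hpc hsim hs hB hM hok
  obtain ⟨hokn, hok⟩ := hok
  have hnle := n.eval_le_bd hs hn
  simp only [bd] at hM
  obtain ⟨c1, hs1, hp1⟩ := n.correct hn pc d M s c hd hcode.left hpc hsim hs hB (by omega)
  have hsim1 := hp1.sim hsim hd
  have hcode2 := hcode.right
  rw [Ex.length_comp] at hcode2
  have hcode3 := hcode2.right.left
  have hcode4 := hcode2.right.right
  rw [Cmd.length_comp] at hcode4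
  simp only [List.length_cons, List.length_nil] at hcode3 hcode4
  have g0 := hcode2.left.get 0 rfl
  have g1 := hcode2.left.get 1 rfl
  have g2 := hcode2.left.get 2 rfl
  have g3 := hcode2.left.get 3 rfl
  have k0 := hcode4.get 0 rfl
  have k1 := hcode4.get 1 rfl
  have k2 := hcode4.get 2 rfl
  have hpc1 := hp1.pc
  have hv1 := hp1.val
  have n1 := hs1.next (by rw [hpc1]; exact g0) (hs1.bnd.reg (Nat.zero_le B))
  -- Each round adds five steps to the cost of the body: the comparison, the copy of the counter to
  -- x, the constant one, the increment and the jump back.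
  have loop : ∀ i ≤ n.eval s, ∃ ci, Steps prog B c
      (n.cost s + 1 + ∑ j ∈ Finset.range i, (a.cost (before x a s j) + 5)) ci ∧
      ci.pc = pc + n.size + 1 ∧ ci.reg d = n.eval s ∧ ci.reg (d + 1) = i ∧
      (∀ r, 32 ≤ r → r < d → ci.reg r = c1.reg r) ∧
      Sim (iter (fun i s => a.exec (s.setV x i)) i s) ci ∧
      (iter (fun i s => a.exec (s.setV x i)) i s).Bd M := by
    intro i
    induction i with
    | zero =>
      intro _
      refine ⟨_, n1.cast (by simp), ?_, ?_, ?_, ?_, ?_, hs⟩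
      · simp [Instr.exec, hpc1]
      · simp [Instr.exec, Function.update_of_ne (show d ≠ d + 1 by omega), hv1]
      · simp [Instr.exec]
      · intro r _ hr
        simp [Instr.exec, Function.update_of_ne (show r ≠ d + 1 by omega)]
      · exact hsim1.of_reg (fun y hy => by
          simp [Instr.exec, Function.update_of_ne (show y ≠ d + 1 by omega)]) rfl rfl
    | succ i ihi =>
      intro hi
      obtain ⟨ci, hsi, hpci, hd0, hd1, hr, hsimi, hbi⟩ := ihi (by omega)
      have hlt : ci.reg (d + 1) < ci.reg d := by rw [hd0, hd1]; omega
      have m1 := hsi.next (by rw [hpci]; exact g1) (by simpa [Bnd, Instr.exec] using hsi.bnd)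
      simp only [Instr.exec, hlt, if_true] at m1
      have m2 := m1.next g3 (m1.bnd.reg (m1.bnd (d + 1)).1)
      have hsim2 : Sim (before x a s i) (Instr.exec ({ ci with pc := pc + n.size + 3 })
          (Instr.move x (d + 1))) := by
        refine hsimi.setV hx5 (fun y hy => ?_) rfl rfl
        by_cases hyx : y = x
        · subst hyx; simp [Instr.exec, hd1]
        · simp [Instr.exec, hyx]
      obtain ⟨c2, hs2, hpc2, hsim3, hb3, hr3⟩ := ih (pc + n.size + 4) (d + 3) M (before x a s i) _
        (by omega) hcode3 rfl hsim2 (hbi.setV (by omega)) m2.bnd (by omega) (hok i (by omega))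
      have m3 := m2.trans hs2
      have e1 : c2.reg (d + 1) = i := by
        rw [hr3 _ (by omega) (by omega)]
        simp [Instr.exec, Function.update_of_ne (show d + 1 ≠ x by omega), hd1]
      have m4 := m3.next (by rw [hpc2]; exact k0) (m3.bnd.reg (show 1 ≤ B by omega))
      have m5 := m4.next (by simp only [Instr.exec, hpc2]; exact k1)
        (by refine m4.bnd.reg ?_; simp [Instr.exec, e1]; omega)
      have m6 := m5.next (by simp only [Instr.exec, hpc2]; exact k2)
        (by simpa [Bnd, Instr.exec] using m5.bnd)
      refine ⟨_, m6.cast ?_, ?_, ?_, ?_, ?_, ?_, hb3⟩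
      · rw [Finset.sum_range_succ]; omega
      · simp [Instr.exec]
      · simp [Instr.exec, Function.update_of_ne (show d ≠ d + 1 by omega),
          Function.update_of_ne (show d ≠ d + 2 by omega),
          hr3 d (by omega) (by omega), Function.update_of_ne (show d ≠ x by omega), hd0]
      · simp [Instr.exec, e1]
      · intro r h32 hrd
        simp [Instr.exec, Function.update_of_ne (show r ≠ d + 1 by omega),
          Function.update_of_ne (show r ≠ d + 2 by omega),
          hr3 r h32 (by omega), Function.update_of_ne (show r ≠ x by omega), hr r h32 hrd]
      · exact hsim3.of_reg (fun y hy => by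
          simp [Instr.exec, Function.update_of_ne (show y ≠ d + 1 by omega),
            Function.update_of_ne (show y ≠ d + 2 by omega)]) rfl rfl
  obtain ⟨ci, hsi, hpci, hd0, hd1, hr, hsimi, hbi⟩ := loop _ le_rfl
  have hlt : ¬ ci.reg (d + 1) < ci.reg d := by rw [hd0, hd1]; omega
  have m1 := hsi.next (by rw [hpci]; exact g1) (by simpa [Bnd, Instr.exec] using hsi.bnd)
  simp only [Instr.exec, hlt, if_false, hpci] at m1
  have m2 := m1.next g2 (by simpa [Bnd, Instr.exec] using m1.bnd)
  refine ⟨_, m2.cast ?_, ?_, ?_, hbi, fun r h32 hrd => ?_⟩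
  · simp only [cost]; omega
  · simp only [Instr.exec, size]; omega
  · exact hsimi.of_reg (fun _ _ => rfl) rfl rfl
  · exact (hr r h32 hrd).trans (hp1.reg r hrd)

theorem Cmd.correct_ite {prog : Program} {B : ℕ} {e : Ex} {a b : Cmd} (he : e.wf)
    (iha : a.Correct prog B) (ihb : b.Correct prog B) : (Cmd.ite e a b).Correct prog B := by
  intro pc d M s c hd hcode hpc hsim hs hB hM hok
  simp only [bd] at hM
  simp only [ok] at hok
  obtain ⟨c1, hs1, hp1⟩ := e.correct he pc d M s c hd hcode.left hpc hsim hs hB (by omega)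
  have hsim1 := hp1.sim hsim hd
  have hcode2 := hcode.right
  rw [Ex.length_comp] at hcode2
  have hcode3 := hcode2.right
  have g0 := hcode2.left.get 0 rfl
  have g1 := hcode2.left.get 1 rfl
  have hcode4 := hcode3.right
  rw [Cmd.length_comp] at hcode4
  simp only [List.length_cons, List.length_nil] at hcode3 hcode4
  have k0 := hcode4.left.get 0 rfl
  have hcode5 := hcode4.right
  simp only [List.length_cons, List.length_nil] at hcode5
  have n1 := hs1.next (by rw [hp1.pc]; exact g0) (hs1.bnd.reg (Nat.zero_le B))
  have n2 := n1.next (by simp only [Instr.exec, hp1.pc]; exact g1)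
    (by simpa [Bnd, Instr.exec] using n1.bnd)
  have hsim2 : ∀ pc', Sim s { (Instr.exec c1 (.const (d + 1) 0)) with pc := pc' } := fun pc' =>
    hsim1.of_reg (fun y hy => by
      simp [Instr.exec, Function.update_of_ne (show y ≠ d + 1 by omega)]) rfl rfl
  have e1 : (Instr.exec c1 (.const (d + 1) 0)).reg (d + 1) = 0 := by simp [Instr.exec]
  have e2 : (Instr.exec c1 (.const (d + 1) 0)).reg d = e.eval s := by
    simp [Instr.exec, Function.update_of_ne (show d ≠ d + 1 by omega), hp1.val]
  have e3 : ∀ r < d, (Instr.exec c1 (.const (d + 1) 0)).reg r = c.reg r := fun r hr => by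
    simp [Instr.exec, Function.update_of_ne (show r ≠ d + 1 by omega), hp1.reg r hr]
  have e4 : (Instr.exec c1 (.const (d + 1) 0)).pc = pc + e.size + 1 := by
    simp [Instr.exec, hp1.pc]
  rw [show ∀ c' : Config, Instr.exec c' (.jumpLT (d + 1) d (pc + e.size + 2 + b.size + 1)) =
    { c' with pc := if c'.reg (d + 1) < c'.reg d then pc + e.size + 2 + b.size + 1
      else c'.pc + 1 } from fun _ => rfl, e1, e2, e4] at n2
  by_cases h0 : 0 < e.eval s
  · rw [if_pos h0] at n2 hok
    obtain ⟨c3, hs3, hpc3, hsim3, hb3, hr3⟩ := iha (pc + e.size + 2 + b.size + 1) d M s _ hd hcode5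
      rfl (hsim2 _) hs n2.bnd (by omega) hok
    refine ⟨c3, (n2.trans hs3).cast ?_, ?_, ?_, ?_, fun r h32 hrd => ?_⟩
    · simp only [cost, if_pos h0]
    · rw [hpc3]; simp only [size]; omega
    · simpa only [exec, if_pos h0] using hsim3
    · simpa only [exec, if_pos h0] using hb3
    · exact (hr3 r h32 hrd).trans (e3 r hrd)
  · rw [if_neg h0] at n2 hok
    obtain ⟨c3, hs3, hpc3, hsim3, hb3, hr3⟩ := ihb (pc + e.size + 2) d M s _ hd hcode3.left
      rfl (hsim2 _) hs n2.bnd (by omega) hok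
    have n3 := n2.trans hs3
    have n4 := n3.next (by rw [hpc3]; exact k0) (by simpa [Bnd, Instr.exec] using n3.bnd)
    refine ⟨_, n4.cast ?_, ?_, ?_, ?_, fun r h32 hrd => ?_⟩
    · simp only [cost, if_neg h0]; omega
    · simp only [Instr.exec, size]; omega
    · simp only [exec, if_neg h0]
      exact hsim3.of_reg (fun _ _ => rfl) rfl rfl
    · simpa only [exec, if_neg h0] using hb3
    · exact (hr3 r h32 hrd).trans (e3 r hrd)

/-- The dynamic condition `ok` keeps the variables and arrays at most M in every reached state. One
static bound `bd M` therefore covers all intermediate values, however many rounds the loops make. -/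
theorem Cmd.correct {prog : Program} {B : ℕ} (a : Cmd) (ha : a.wf) : a.Correct prog B := by
  induction a with
  | assign x e =>
    intro pc d M s c hd hcode hpc hsim hs hB hM hok
    obtain ⟨hx, hx5, he⟩ := ha
    simp only [bd] at hM
    obtain ⟨c1, hs1, hp1⟩ := e.correct he pc d M s c hd hcode.left hpc hsim hs hB (by omega)
    have hcode2 := hcode.right
    rw [Ex.length_comp] at hcode2
    have n1 := hs1.next (by rw [hp1.pc]; exact hcode2.get 0 rfl) (hs1.bnd.reg (hs1.bnd d).1)
    refine ⟨_, n1, by simp [Instr.exec, hp1.pc, size, add_assoc], ?_, hs.setV hok,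
      fun r h32 hrd => ?_⟩
    · refine (hp1.sim hsim hd).setV hx5 (fun y hy => ?_) rfl rfl
      by_cases hyx : y = x
      · subst hyx; simp [Instr.exec, hp1.val]
      · simp [Instr.exec, hyx]
    · simp [Instr.exec, Function.update_of_ne (show r ≠ x by omega), hp1.reg r hrd]
  | store k i e => exact Cmd.correct_store ha.1 ha.2.1 ha.2.2
  | input x e =>
    intro pc d M s c hd hcode hpc hsim hs hB hM hok
    obtain ⟨hx, hx5, he⟩ := ha
    simp only [bd] at hM
    obtain ⟨c1, hs1, hp1⟩ := e.correct he pc d M s c hd hcode.left hpc hsim hs hB (by omega)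
    have hcode2 := hcode.right
    rw [Ex.length_comp] at hcode2
    have hpc1 := hp1.pc
    have n1 := hs1.next (by rw [hpc1]; exact hcode2.get 0 rfl) (hs1.bnd.reg (hs1.bnd _).2)
    have n2 := n1.next (by simp only [Instr.exec, hpc1]; exact hcode2.get 1 rfl)
      (n1.bnd.reg (n1.bnd d).1)
    have hv : c1.mem (e.eval s) = s.inp (e.eval s) := (hp1.sim hsim hd).inp _ hok.1
    refine ⟨_, n2, by simp [Instr.exec, hpc1, size, add_assoc], ?_, hs.setV hok.2,
      fun r h32 hrd => ?_⟩
    · refine (hp1.sim hsim hd).setV hx5 (fun y hy => ?_) rfl rfl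
      by_cases hyx : y = x
      · subst hyx; simp [Instr.exec, hp1.val, hv]
      · simp [Instr.exec, hyx, Function.update_of_ne (show y ≠ d by omega)]
    · simp [Instr.exec, Function.update_of_ne (show r ≠ x by omega),
        Function.update_of_ne (show r ≠ d by omega), hp1.reg r hrd]
  | print e =>
    intro pc d M s c hd hcode hpc hsim hs hB hM hok
    simp only [bd] at hM
    obtain ⟨c1, hs1, hp1⟩ := e.correct ha pc d M s c hd hcode.left hpc hsim hs hB (by omega)
    have hcode2 := hcode.right
    rw [Ex.length_comp] at hcode2
    have n1 := hs1.next (by rw [hp1.pc]; exact hcode2.get 0 rfl)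
      (by simpa [Bnd, Instr.exec] using hs1.bnd)
    have hsim1 := hp1.sim hsim hd
    refine ⟨_, n1, by simp [Instr.exec, hp1.pc, size, add_assoc], ?_, hs,
      fun r h32 hrd => hp1.reg r hrd⟩
    exact ⟨hsim1.reg, hsim1.mem, hsim1.inp, by simp [Instr.exec, exec, hp1.val, hsim1.out]⟩
  | seq a b iha ihb =>
    intro pc d M s c hd hcode hpc hsim hs hB hM hok
    simp only [bd] at hM
    obtain ⟨c1, hs1, hpc1, hsim1, hb1, hr1⟩ := iha ha.1 pc d M s c hd hcode.left hpc hsim hs hB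
      (by omega) hok.1
    have hcode2 := hcode.right
    rw [Cmd.length_comp] at hcode2
    obtain ⟨c2, hs2, hpc2, hsim2, hb2, hr2⟩ := ihb ha.2 (pc + a.size) d M (a.exec s) c1 hd hcode2
      hpc1 hsim1 hb1 hs1.bnd (by omega) hok.2
    exact ⟨c2, hs1.trans hs2, by rw [hpc2]; simp [size, add_assoc], hsim2, hb2,
      fun r h32 hrd => (hr2 r h32 hrd).trans (hr1 r h32 hrd)⟩
  | ite e a b iha ihb => exact Cmd.correct_ite ha.1 (iha ha.2.1) (ihb ha.2.2)
  | loop x n a ih => exact Cmd.correct_loop ha.1 ha.2.1 ha.2.2.1 (ih ha.2.2.2)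

/-! ### Polynomial bounds -/

/-- The function is bounded by a polynomial. -/
def PolyBdd (f : ℕ → ℕ) : Prop := ∃ C, ∀ M, f M ≤ C * (M + 1) ^ C

theorem PolyBdd.of_le {f : ℕ → ℕ} {C D : ℕ} (h : ∀ M, f M ≤ C * (M + 1) ^ D) : PolyBdd f := by
  refine ⟨C + D, fun M => (h M).trans (Nat.mul_le_mul (by omega) ?_)⟩
  exact Nat.pow_le_pow_right (by omega) (by omega)

theorem PolyBdd.const (c : ℕ) : PolyBdd fun _ => c :=
  PolyBdd.of_le (C := c) (D := 0) fun M => by simp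

theorem PolyBdd.id : PolyBdd fun M => M :=
  PolyBdd.of_le (C := 1) (D := 1) fun M => by simp

theorem PolyBdd.add {f g : ℕ → ℕ} (hf : PolyBdd f) (hg : PolyBdd g) :
    PolyBdd fun M => f M + g M := by
  obtain ⟨C, hC⟩ := hf
  obtain ⟨D, hD⟩ := hg
  refine PolyBdd.of_le (C := C + D) (D := C + D) fun M => ?_
  rw [add_mul]
  refine add_le_add ((hC M).trans ?_) ((hD M).trans ?_)
  all_goals exact Nat.mul_le_mul_left _ (Nat.pow_le_pow_right (by omega) (by omega))

theorem PolyBdd.mul {f g : ℕ → ℕ} (hf : PolyBdd f) (hg : PolyBdd g) :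
    PolyBdd fun M => f M * g M := by
  obtain ⟨C, hC⟩ := hf
  obtain ⟨D, hD⟩ := hg
  refine PolyBdd.of_le (C := C * D) (D := C + D) fun M => ?_
  refine (Nat.mul_le_mul (hC M) (hD M)).trans (le_of_eq ?_)
  rw [pow_add]; ring

theorem PolyBdd.comp {f g : ℕ → ℕ} (hf : PolyBdd f) (hg : PolyBdd g) :
    PolyBdd fun M => f (g M) := by
  obtain ⟨C, hC⟩ := hf
  obtain ⟨D, hD⟩ := hg
  refine PolyBdd.of_le (C := C * (D + 1) ^ C) (D := D * C) fun M => (hC _).trans ?_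
  have h1 : 1 ≤ (M + 1) ^ D := Nat.one_le_pow _ _ (by omega)
  have h2 : g M + 1 ≤ (D + 1) * (M + 1) ^ D := by
    have := hD M; rw [add_mul]; omega
  refine (Nat.mul_le_mul_left C (Nat.pow_le_pow_left h2 C)).trans (le_of_eq ?_)
  rw [mul_pow, ← pow_mul]; ring

theorem Ex.polyBdd_bd (e : Ex) : PolyBdd e.bd := by
  induction e with
  | num c => exact .const c
  | var x => exact .id
  | add a b iha ihb => exact iha.add ihb
  | sub a b iha ihb => exact iha.add ihb
  | mul a b iha ihb => exact (iha.add ihb).add (iha.mul ihb)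
  | arr k e ih =>
    exact ((((ih.mul (.const 16)).add (.const 16)).add (.const k)).add .id).add ih
  | sum x n e ihn ihe =>
    have h := ihe.comp (PolyBdd.id.add ihn)
    exact (((ihn.add h).add (ihn.mul h)).add .id).add (.const 1)

/-- The code is fixed, so a bound polynomial in M for its intermediate values becomes the bound on
machine words once M is linear in pqn. -/
theorem Cmd.polyBdd_bd (a : Cmd) : PolyBdd a.bd := by
  induction a with
  | assign x e => exact e.polyBdd_bd.add .id
  | store k i e =>
    exact ((((i.polyBdd_bd.mul (.const 17)).add (.const 16)).add (.const k)).add .id).add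
      e.polyBdd_bd
  | input x e => exact e.polyBdd_bd.add .id
  | print e => exact e.polyBdd_bd
  | seq a b iha ihb => exact iha.add ihb
  | ite e a b iha ihb => exact (e.polyBdd_bd.add iha).add ihb
  | loop x n a ih => exact ((n.polyBdd_bd.add ih).add .id).add (.const 1)

end SkewGen

namespace SkewGen

set_option linter.unusedSectionVars false

/-! ### A test for good boxes -/

section Test

variable {ι κ : Type*} [Fintype ι] [Fintype κ] [DecidableEq ι] [DecidableEq κ]

/-- The number of nonzero values. -/
def cnt (f : ι → ℕ) : ℕ := ∑ x, min 1 (f x)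

theorem sum_eq_triple {f : ι → ℕ} {i k k' : ι} (hk : k ≠ i) (hk' : k' ≠ i) (hkk : k ≠ k')
    (h0 : ∀ x, x ≠ i → x ≠ k → x ≠ k' → f x = 0) : ∑ x, f x = f i + f k + f k' := by
  rw [← Finset.sum_subset (Finset.subset_univ {i, k, k'}),
    Finset.sum_insert (by simp [hk.symm, hk'.symm]), Finset.sum_pair hkk, add_assoc]
  intro x _ hx
  simp only [Finset.mem_insert, Finset.mem_singleton, not_or] at hx
  exact h0 x hx.1 hx.2.1 hx.2.2

theorem cnt_eq_card (f : ι → ℕ) : cnt f = (Finset.univ.filter fun x => f x ≠ 0).card := by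
  rw [Finset.card_filter]
  refine Finset.sum_congr rfl fun x _ => ?_
  split_ifs <;> omega

theorem cnt_eq_three {f : ι → ℕ} {i : ι} (hi : f i ≠ 0) (h : cnt f = 3) :
    ∃ k k', k ≠ i ∧ k' ≠ i ∧ k ≠ k' ∧ f k ≠ 0 ∧ f k' ≠ 0 ∧
      ∀ x, x ≠ i → x ≠ k → x ≠ k' → f x = 0 := by
  rw [cnt_eq_card] at h
  have hmem : i ∈ Finset.univ.filter fun x => f x ≠ 0 := by simp [hi]
  have h2 := Finset.card_erase_of_mem hmem
  rw [h] at h2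
  obtain ⟨k, k', hkk, he⟩ := Finset.card_eq_two.1 h2
  have hk : ∀ x, (x ≠ i ∧ f x ≠ 0) ↔ (x = k ∨ x = k') := fun x => by
    have : x ∈ (Finset.univ.filter fun x => f x ≠ 0).erase i ↔ x ∈ ({k, k'} : Finset ι) := by
      rw [he]
    simpa using this
  have h3 := (hk k).2 (Or.inl rfl)
  have h4 := (hk k').2 (Or.inr rfl)
  refine ⟨k, k', h3.1, h4.1, hkk, h3.2, h4.2, fun x hx h5 h6 => ?_⟩
  by_contra hne
  rcases (hk x).1 ⟨hx, hne⟩ with h | h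
  · exact h5 h
  · exact h6 h

theorem cnt_of_three {f : ι → ℕ} {i k k' : ι} (hk : k ≠ i) (hk' : k' ≠ i) (hkk : k ≠ k')
    (hi : f i ≠ 0) (h1 : f k ≠ 0) (h2 : f k' ≠ 0)
    (h0 : ∀ x, x ≠ i → x ≠ k → x ≠ k' → f x = 0) : cnt f = 3 := by
  unfold cnt
  rw [sum_eq_triple hk hk' hkk fun x a b c => by rw [h0 x a b c]; rfl]
  omega

/-- The number of nonempty boxes. -/
def boxCount (t : ι → κ → ℕ) : ℕ := ∑ k, cnt (t k)

/-- Counts of nonempty rows and of nonempty boxes in the column replace the search for k and k', so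
the obstruction can be tested in constant time once the counts are known. -/
theorem columnStuck_iff {t : ι → κ → ℕ} {i : ι} {j : κ} (h : t i j ≠ 0) :
    ColumnStuck t i j ↔ rowSum t i = 1 ∧ 2 * colSum t j = total t + 1 ∧
      cnt (rowSum t) = 3 ∧ cnt (fun k => t k j) = 3 := by
  constructor
  · rintro ⟨h1, h2, k, k', hk, hk', hkk, n1, n2, hz⟩
    refine ⟨h1, h2, cnt_of_three hk hk' hkk (by omega) ?_ ?_ hz,
      cnt_of_three hk hk' hkk h n1 n2 fun x a b c => ?_⟩
    · have := entry_le_rowSum t k j; omega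
    · have := entry_le_rowSum t k' j; omega
    · have := entry_le_rowSum t x j; have := hz x a b c; omega
  · rintro ⟨h1, h2, h3, h4⟩
    obtain ⟨k, k', hk, hk', hkk, -, -, hz⟩ := cnt_eq_three (i := i) (by omega) h3
    have h5 : cnt (fun k => t k j) = min 1 (t i j) + min 1 (t k j) + min 1 (t k' j) :=
      sum_eq_triple hk hk' hkk fun x a b c => by
        change min 1 (t x j) = 0
        have := entry_le_rowSum t x j; have := hz x a b c; omega
    exact ⟨h1, h2, k, k', hk, hk', hkk, by omega, by omega, hz⟩

/-- With three nonempty rows and columns and the box (i, j) alone in its lines, all else lies in a 2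
× 2 table. Five nonempty boxes mean that its four boxes are all nonempty. -/
theorem fullSquare_iff {t : ι → κ → ℕ} {i : ι} {j : κ} (h : t i j ≠ 0) :
    FullSquare t i j ↔ rowSum t i = 1 ∧ colSum t j = 1 ∧
      cnt (rowSum t) = 3 ∧ cnt (colSum t) = 3 ∧ boxCount t = 5 := by
  have key : ∀ k k' l l', rowSum t i = 1 → colSum t j = 1 → k ≠ i → k' ≠ i → k ≠ k' → l ≠ j →
      l' ≠ j → l ≠ l' → (∀ x, x ≠ i → x ≠ k → x ≠ k' → rowSum t x = 0) →
      (∀ y, y ≠ j → y ≠ l → y ≠ l' → colSum t y = 0) → boxCount t =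
        1 + (min 1 (t k l) + min 1 (t k l')) + (min 1 (t k' l) + min 1 (t k' l')) := by
    intro k k' l l' h1 h2 hk hk' hkk hl hl' hll hr hc
    have e1 : boxCount t = cnt (t i) + cnt (t k) + cnt (t k') :=
      sum_eq_triple hk hk' hkk fun x a b c => by
        refine Finset.sum_eq_zero fun y _ => ?_
        have := entry_le_rowSum t x y; have := hr x a b c; omega
    have e2 : cnt (t i) = min 1 (t i j) := by
      refine Fintype.sum_eq_single j fun y hy => ?_
      have := pair_le_sum (t i) hy
      change _ ≤ rowSum t i at this
      omega
    have e3 : ∀ x, x ≠ i → cnt (t x) = min 1 (t x l) + min 1 (t x l') := fun x hx => by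
      have e4 : cnt (t x) = min 1 (t x j) + min 1 (t x l) + min 1 (t x l') :=
        sum_eq_triple hl hl' hll fun y a b c => by
          have := entry_le_colSum t x y; have := hc y a b c; omega
      have := pair_le_sum (fun x => t x j) hx
      change _ ≤ colSum t j at this
      omega
    rw [e1, e2, e3 k hk, e3 k' hk']
    omega
  constructor
  · rintro ⟨h1, h2, k, k', l, l', ⟨hk, hk', hkk⟩, ⟨hl, hl', hll⟩, ⟨n1, n2, n3, n4⟩, hr, hc⟩
    have := key k k' l l' h1 h2 hk hk' hkk hl hl' hll hr hc
    refine ⟨h1, h2, cnt_of_three hk hk' hkk (by omega) ?_ ?_ hr,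
      cnt_of_three hl hl' hll (by omega) ?_ ?_ hc, by omega⟩
    · have := entry_le_rowSum t k l; omega
    · have := entry_le_rowSum t k' l; omega
    · have := entry_le_colSum t k l; omega
    · have := entry_le_colSum t k l'; omega
  · rintro ⟨h1, h2, h3, h4, h5⟩
    obtain ⟨k, k', hk, hk', hkk, -, -, hr⟩ := cnt_eq_three (i := i) (by omega) h3
    obtain ⟨l, l', hl, hl', hll, -, -, hc⟩ := cnt_eq_three (i := j) (by omega) h4
    have := key k k' l l' h1 h2 hk hk' hkk hl hl' hll hr hc
    exact ⟨h1, h2, k, k', l, l', ⟨hk, hk', hkk⟩, ⟨hl, hl', hll⟩,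
      ⟨by omega, by omega, by omega, by omega⟩, hr, hc⟩

/-- The amount by which the pair of row `k` and column `l` violates the strict bound. -/
def excess (t : ι → κ → ℕ) (k : ι) (l : κ) : ℕ :=
  min 1 (rowSum t k + colSum t l - 2 * t k l) * (rowSum t k + colSum t l + 1 - total t)

/-- The sum of all violations. -/
def violations (t : ι → κ → ℕ) : ℕ :=
  ∑ k, (2 * rowSum t k - total t) + ∑ l, (2 * colSum t l - total t) + ∑ k, ∑ l, excess t k l

/-- The violations that are allowed when the path starts in row `i`. -/
def rowCredit (t : ι → κ → ℕ) (i : ι) : ℕ :=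
  min 1 (2 * rowSum t i - total t) + ∑ l, min 1 (excess t i l)

/-- The violations that are allowed when the path starts in column `j`. -/
def colCredit (t : ι → κ → ℕ) (j : κ) : ℕ :=
  min 1 (2 * colSum t j - total t) + ∑ k, min 1 (excess t k j)

/-- Inclusion and exclusion: row i and column j together count the box (i, j) twice. -/
theorem cross_sum (m : ι → κ → ℕ) (i : ι) (j : κ) :
    ∑ k, ∑ l, (if k = i ∨ l = j then m k l else 0) + m i j = ∑ l, m i l + ∑ k, m k j := by
  have h1 : ∑ k, ∑ l, (if k = i ∧ l = j then m k l else 0) = m i j := by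
    simp_rw [ite_and]
    simp
  have h2 : ∑ k, ∑ l, (if k = i then m k l else 0) = ∑ l, m i l := by
    rw [Fintype.sum_eq_single i fun k hk => by simp [hk]]
    simp
  have h3 : ∑ k, ∑ l, (if l = j then m k l else 0) = ∑ k, m k j := by simp
  rw [← h1, ← h2, ← h3]
  simp only [← Finset.sum_add_distrib]
  refine Finset.sum_congr rfl fun k _ => Finset.sum_congr rfl fun l _ => ?_
  by_cases hk : k = i <;> by_cases hl : l = j <;> simp [hk, hl]

theorem sum_eq_min_iff (f : ι → ℕ) (i : ι) :
    min 1 (f i) ≤ ∑ x, f x ∧ (∑ x, f x = min 1 (f i) ↔ f i ≤ 1 ∧ ∀ x, x ≠ i → f x = 0) := by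
  have h1 := single_le_sum' f i
  refine ⟨by omega, fun h => ⟨by omega, fun x hx => ?_⟩, fun ⟨h2, h3⟩ => ?_⟩
  · have := pair_le_sum f hx; omega
  · rw [Fintype.sum_eq_single i h3]; omega

/-- The allowed amount is at most the actual amount in every term, so equality of the sums means
equality everywhere: at most one on row i and column j, zero elsewhere. -/
theorem sum_eq_cross_iff (f : ι → κ → ℕ) (i : ι) (j : κ) :
    ∑ k, ∑ l, (if k = i ∨ l = j then min 1 (f k l) else 0) ≤ ∑ k, ∑ l, f k l ∧
      (∑ k, ∑ l, f k l = ∑ k, ∑ l, (if k = i ∨ l = j then min 1 (f k l) else 0) ↔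
        ∀ k l, f k l ≤ 1 ∧ (k ≠ i → l ≠ j → f k l = 0)) := by
  have hle : ∀ k l, (if k = i ∨ l = j then min 1 (f k l) else 0) ≤ f k l := fun k l => by
    split_ifs <;> omega
  refine ⟨Finset.sum_le_sum fun k _ => Finset.sum_le_sum fun l _ => hle k l, ?_⟩
  rw [eq_comm, Finset.sum_eq_sum_iff_of_le fun k _ => Finset.sum_le_sum fun l _ => hle k l]
  constructor
  · intro h k l
    have h1 := h k (Finset.mem_univ _)
    rw [Finset.sum_eq_sum_iff_of_le fun l _ => hle k l] at h1
    have h2 := h1 l (Finset.mem_univ _)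
    constructor
    · split_ifs at h2 <;> omega
    · intro hk hl
      simpa [hk, hl] using h2.symm
  · intro h k _
    refine Finset.sum_congr rfl fun l _ => ?_
    have := h k l
    split_ifs with h1
    · omega
    · push Not at h1
      exact (this.2 h1.1 h1.2).symm

theorem min_one_mul_le {a b c : ℕ} (h : a ≠ 0 → b ≤ c) : min 1 a * b ≤ c := by
  rcases Nat.eq_zero_or_pos a with rfl | ha
  · simp
  · rw [min_eq_left ha, one_mul]; exact h (by omega)

theorem le_of_min_one_mul_le {a b c : ℕ} (h : min 1 a * b ≤ c) (ha : a ≠ 0) : b ≤ c := by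
  rwa [min_eq_left (by omega), one_mul] at h

/-- All numerical conditions together say that the violations of the strict bounds are at most one
on lines and pairs that involve row i or column j, and zero elsewhere. As the violations dominate
the allowed ones term by term, this is a single equation of sums. The pair (i, j) occurs in both
credits, which is why its truncated excess is added on the left. After the sums have been tabulated,
each box is tested in constant time. -/
theorem good_iff_test {t : ι → κ → ℕ} {i : ι} {j : κ} :
    Good t i j ↔ t i j ≠ 0 ∧
      violations t + min 1 (excess t i j) = rowCredit t i + colCredit t j ∧
      ¬ (rowSum t i = 1 ∧ 2 * colSum t j = total t + 1 ∧ cnt (rowSum t) = 3 ∧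
        cnt (fun k => t k j) = 3) ∧
      ¬ (colSum t j = 1 ∧ 2 * rowSum t i = total t + 1 ∧ cnt (colSum t) = 3 ∧ cnt (t i) = 3) ∧
      ¬ (rowSum t i = 1 ∧ colSum t j = 1 ∧ cnt (rowSum t) = 3 ∧ cnt (colSum t) = 3 ∧
        boxCount t = 5) := by
  have hstuck : t i j ≠ 0 → (ColumnStuck (fun j i => t i j) j i ↔
      colSum t j = 1 ∧ 2 * rowSum t i = total t + 1 ∧ cnt (colSum t) = 3 ∧ cnt (t i) = 3) := by
    intro h
    rw [columnStuck_iff (t := fun j i => t i j) h, rowSum_flip, colSum_flip, total_flip]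
    rfl
  obtain ⟨a1, a2⟩ := sum_eq_min_iff (fun k => 2 * rowSum t k - total t) i
  obtain ⟨b1, b2⟩ := sum_eq_min_iff (fun l => 2 * colSum t l - total t) j
  obtain ⟨c1, c2⟩ := sum_eq_cross_iff (excess t) i j
  have c3 := cross_sum (fun k l => min 1 (excess t k l)) i j
  -- Three inequalities between actual and allowed violations are summed; the total is an equality
  -- exactly if each of them is.
  have key : violations t + min 1 (excess t i j) = rowCredit t i + colCredit t j ↔
      ((2 * rowSum t i - total t ≤ 1 ∧ ∀ x, x ≠ i → 2 * rowSum t x - total t = 0) ∧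
        (2 * colSum t j - total t ≤ 1 ∧ ∀ x, x ≠ j → 2 * colSum t x - total t = 0)) ∧
        ∀ k l, excess t k l ≤ 1 ∧ (k ≠ i → l ≠ j → excess t k l = 0) := by
    rw [← a2, ← b2, ← c2]
    unfold violations rowCredit colCredit
    constructor
    · intro h
      refine ⟨⟨?_, ?_⟩, ?_⟩ <;> omega
    · rintro ⟨⟨h1, h2⟩, h3⟩
      omega
  rw [key]
  constructor
  · intro h
    refine ⟨h.pos, ⟨⟨⟨?_, fun x hx => ?_⟩, ⟨?_, fun x hx => ?_⟩⟩, fun k l => ⟨?_, fun hk hl => ?_⟩⟩,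
      ?_, ?_, ?_⟩
    · have := h.row_self; omega
    · have := h.row x hx; omega
    · have := h.col_self; omega
    · have := h.col x hx; omega
    · refine min_one_mul_le fun h1 => ?_
      have := h.cross k l (by omega); omega
    · refine Nat.le_zero.1 (min_one_mul_le fun h1 => ?_)
      have := h.off_cross k l hk hl (by omega); omega
    · rw [← columnStuck_iff h.pos]; exact h.not_columnStuck
    · rw [← hstuck h.pos]; exact h.not_rowStuck
    · rw [← fullSquare_iff h.pos]; exact h.not_fullSquare
  · rintro ⟨hp, ⟨⟨⟨h1, h2⟩, h3, h4⟩, h5⟩, h6, h7, h8⟩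
    refine ⟨hp, by omega, fun x hx => ?_, by omega, fun x hx => ?_, fun k l hkl => ?_,
      fun k l hk hl hkl => ?_, ?_, ?_, ?_⟩
    · have := h2 x hx; omega
    · have := h4 x hx; omega
    · have := le_of_min_one_mul_le (h5 k l).1 (by omega); omega
    · have := le_of_min_one_mul_le (Nat.le_zero.2 ((h5 k l).2 hk hl)) (by omega); omega
    · rwa [columnStuck_iff hp]
    · rwa [hstuck hp]
    · rwa [fullSquare_iff hp]

end Test

end SkewGen

namespace SkewGen

/-! ### Reasoning about commands -/

namespace Cmd

/-- The variables that may change. -/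
def vars : Cmd → List ℕ
  | assign x _ => [x]
  | store _ _ _ => []
  | input x _ => [x]
  | print _ => []
  | seq a b => a.vars ++ b.vars
  | ite _ a b => a.vars ++ b.vars
  | loop x _ a => x :: a.vars

/-- The arrays that may change. -/
def arrs : Cmd → List ℕ
  | assign _ _ => []
  | store k _ _ => [k]
  | input _ _ => []
  | print _ => []
  | seq a b => a.arrs ++ b.arrs
  | ite _ a b => a.arrs ++ b.arrs
  | loop _ _ a => a.arrs

/-- The command prints nothing. -/
def silent : Cmd → Prop
  | assign _ _ => True
  | store _ _ _ => True
  | input _ _ => True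
  | print _ => False
  | seq a b => a.silent ∧ b.silent
  | ite _ a b => a.silent ∧ b.silent
  | loop _ _ a => a.silent

theorem exec_v (a : Cmd) (s : St) {x : ℕ} (h : x ∉ a.vars) : (a.exec s).v x = s.v x := by
  induction a generalizing s with
  | assign y e => simp only [vars, List.mem_singleton] at h; simp [exec, St.setV, h]
  | store k i e => rfl
  | input y e => simp only [vars, List.mem_singleton] at h; simp [exec, St.setV, h]
  | print e => rfl
  | seq a b iha ihb =>
    simp only [vars, List.mem_append, not_or] at h
    exact (ihb _ h.2).trans (iha _ h.1)
  | ite e a b iha ihb =>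
    simp only [vars, List.mem_append, not_or] at h
    simp only [exec]
    split_ifs
    · exact iha _ h.1
    · exact ihb _ h.2
  | loop y n a ih =>
    simp only [vars, List.mem_cons, not_or] at h
    simp only [exec]
    induction n.eval s with
    | zero => rfl
    | succ m ihm =>
      simp only [iter]
      rw [ih _ h.2]
      simpa [St.setV, h.1] using ihm

theorem exec_a (a : Cmd) (s : St) {k : ℕ} (h : k ∉ a.arrs) : (a.exec s).a k = s.a k := by
  induction a generalizing s with
  | assign y e => rfl
  | store l i e => simp only [arrs, List.mem_singleton] at h; simp [exec, St.setA, h]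
  | input y e => rfl
  | print e => rfl
  | seq a b iha ihb =>
    simp only [arrs, List.mem_append, not_or] at h
    exact (ihb _ h.2).trans (iha _ h.1)
  | ite e a b iha ihb =>
    simp only [arrs, List.mem_append, not_or] at h
    simp only [exec]
    split_ifs
    · exact iha _ h.1
    · exact ihb _ h.2
  | loop y n a ih =>
    simp only [exec]
    induction n.eval s with
    | zero => rfl
    | succ m ihm => exact (ih _ h).trans ihm

theorem exec_inp (a : Cmd) (s : St) : (a.exec s).inp = s.inp := by
  induction a generalizing s with
  | assign y e => rfl
  | store l i e => rfl
  | input y e => rfl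
  | print e => rfl
  | seq a b iha ihb => exact (ihb _).trans (iha _)
  | ite e a b iha ihb =>
    simp only [exec]
    split_ifs
    · exact iha _
    · exact ihb _
  | loop y n a ih =>
    simp only [exec]
    induction n.eval s with
    | zero => rfl
    | succ m ihm => exact (ih _).trans ihm

theorem exec_out (a : Cmd) (s : St) (h : a.silent) : (a.exec s).out = s.out := by
  induction a generalizing s with
  | assign y e => rfl
  | store l i e => rfl
  | input y e => rfl
  | print e => exact h.elim
  | seq a b iha ihb => exact (ihb _ h.2).trans (iha _ h.1)
  | ite e a b iha ihb =>
    simp only [exec]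
    split_ifs
    · exact iha _ h.1
    · exact ihb _ h.2
  | loop y n a ih =>
    simp only [exec]
    induction n.eval s with
    | zero => rfl
    | succ m ihm => exact (ih _ h).trans ihm

end Cmd

/-- From the state `s` the command runs safely, in at most `K` steps, and establishes `Q`. -/
def Tri (M : ℕ) (a : Cmd) (s : St) (K : ℕ) (Q : St → Prop) : Prop :=
  a.ok M s ∧ a.cost s ≤ K ∧ Q (a.exec s)

theorem Tri.mono {M : ℕ} {a : Cmd} {s : St} {K K' : ℕ} {Q Q' : St → Prop}
    (h : Tri M a s K Q) (hK : K ≤ K') (hQ : ∀ s', Q s' → Q' s') : Tri M a s K' Q' :=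
  ⟨h.1, h.2.1.trans hK, hQ _ h.2.2⟩

theorem Tri.seq {M : ℕ} {a b : Cmd} {s : St} {K K' : ℕ} {Q Q' : St → Prop}
    (h : Tri M a s K Q) (h' : ∀ s', Q s' → Tri M b s' K' Q') :
    Tri M (.seq a b) s (K + K') Q' := by
  have := h' _ h.2.2
  exact ⟨⟨h.1, this.1⟩, add_le_add h.2.1 this.2.1, this.2.2⟩

theorem Tri.loop {M x : ℕ} {n : Ex} {a : Cmd} {s : St} {K : ℕ} (I : ℕ → St → Prop)
    (hn : n.eval s ≤ M) (h0 : I 0 s)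
    (hI : ∀ i < n.eval s, ∀ s', I i s' → Tri M a (s'.setV x i) K (I (i + 1))) :
    Tri M (.loop x n a) s (n.cost s + 3 + n.eval s * (K + 5)) (I (n.eval s)) := by
  have key : ∀ i ≤ n.eval s, I i (iter (fun i s => a.exec (s.setV x i)) i s) := by
    intro i
    induction i with
    | zero => exact fun _ => h0
    | succ i ih => exact fun hi => (hI i (by omega) _ (ih (by omega))).2.2
  refine ⟨⟨hn, fun i hi => (hI i hi _ (key i hi.le)).1⟩, ?_, key _ le_rfl⟩
  refine Nat.add_le_add_left ?_ _
  refine (Finset.sum_le_card_nsmul _ _ (K + 5) fun i hi => ?_).trans (by simp)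
  have hi := Finset.mem_range.1 hi
  exact Nat.add_le_add_right (hI i hi _ (key i hi.le)).2.1 5

theorem Tri.assign {M x : ℕ} {e : Ex} {s : St} {K : ℕ} {Q : St → Prop} (h1 : e.eval s ≤ M)
    (h2 : e.cost s + 1 ≤ K) (h3 : Q (s.setV x (e.eval s))) : Tri M (.assign x e) s K Q :=
  ⟨h1, h2, h3⟩

theorem Tri.ite {M : ℕ} {e : Ex} {a b : Cmd} {s : St} {K K' : ℕ} {Q : St → Prop}
    (h1 : 0 < e.eval s → Tri M a s K Q) (h2 : ¬ 0 < e.eval s → Tri M b s K Q)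
    (hK : e.cost s + 3 + K ≤ K') : Tri M (.ite e a b) s K' Q := by
  by_cases h : 0 < e.eval s
  · obtain ⟨a1, a2, a3⟩ := h1 h
    refine ⟨?_, ?_, ?_⟩
    · simpa only [Cmd.ok, if_pos h] using a1
    · simp only [Cmd.cost, if_pos h]; omega
    · simpa only [Cmd.exec, if_pos h] using a3
  · obtain ⟨a1, a2, a3⟩ := h2 h
    refine ⟨?_, ?_, ?_⟩
    · simpa only [Cmd.ok, if_neg h] using a1
    · simp only [Cmd.cost, if_neg h]; omega
    · simpa only [Cmd.exec, if_neg h] using a3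

/-- The postcondition may be strengthened by everything that the command cannot change. -/
theorem Tri.frame {M : ℕ} {a : Cmd} {s : St} {K : ℕ} {Q Q' : St → Prop} (h : Tri M a s K Q)
    (hQ : ∀ s', Q s' → (∀ x, x ∉ a.vars → s'.v x = s.v x) → (∀ k, k ∉ a.arrs → s'.a k = s.a k) →
      s'.inp = s.inp → (a.silent → s'.out = s.out) → Q' s') : Tri M a s K Q' :=
  ⟨h.1, h.2.1, hQ _ h.2.2 (fun _ hx => a.exec_v s hx) (fun _ hk => a.exec_a s hk) (a.exec_inp s)
    (a.exec_out s)⟩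

/-- Fill the cells below `n` of the array `k` with the values of `e`. -/
def fillCmd (k x : ℕ) (n e : Ex) : Cmd := .loop x n (.store k (.var x) e)

/-- The value of `e` is required in all states that agree with `s` outside the variable x and the
array k, because these two change while the array is being filled. -/
theorem Tri.fill {M k x : ℕ} {n e : Ex} {s : St} {K : ℕ} (f : ℕ → ℕ) (hn : n.eval s ≤ M)
    (he : ∀ i < n.eval s, ∀ s' : St, (∀ y, y ≠ x → s'.v y = s.v y) → s'.v x = i →
      (∀ l, l ≠ k → s'.a l = s.a l) → e.eval s' = f i ∧ e.cost s' ≤ K)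
    (hf : ∀ i < n.eval s, f i ≤ M) :
    Tri M (fillCmd k x n e) s (n.cost s + 3 + n.eval s * (K + 12)) fun s' =>
      ∀ i < n.eval s, s'.a k i = f i := by
  have h := Tri.loop (M := M) (x := x) (n := n) (a := .store k (.var x) e) (s := s) (K := K + 7)
    (fun i s' => (∀ y, y ≠ x → s'.v y = s.v y) ∧ (∀ l, l ≠ k → s'.a l = s.a l) ∧
      ∀ j < i, s'.a k j = f j) hn ⟨fun _ _ => rfl, fun _ _ => rfl, fun _ h => by omega⟩ ?_
  · exact h.mono le_rfl fun s' h' => h'.2.2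
  · rintro i hi s' ⟨h1, h2, h3⟩
    have h4 : ∀ y, y ≠ x → (s'.setV x i).v y = s.v y := fun y hy => by
      simpa [St.setV, hy] using h1 y hy
    obtain ⟨e1, e2⟩ := he i hi (s'.setV x i) h4 (by simp [St.setV]) h2
    refine ⟨?_, ?_, ?_, ?_, ?_⟩
    · simp only [Cmd.ok, e1]; exact hf i hi
    · simp only [Cmd.cost, Ex.cost]; omega
    · exact h4
    · intro l hl
      simpa [Cmd.exec, St.setA, St.setV, hl] using h2 l hl
    · intro j hj
      simp only [Cmd.exec, e1, Ex.eval, St.setA, Function.update_self]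
      by_cases hji : j = i
      · subst hji; simp [St.setV]
      · simpa [St.setV, hji] using h3 j (by omega)

/-! ### Derived expressions -/

namespace Ex

/-- `1` if `e` is positive, else `0`. -/
def pos (e : Ex) : Ex := .sub (.num 1) (.sub (.num 1) e)

/-- `1` if `a` and `b` are equal, else `0`. -/
def eq (a b : Ex) : Ex := .sub (.num 1) (.add (.sub a b) (.sub b a))

/-- `1` if `e` is zero, else `0`. -/
def not (e : Ex) : Ex := .sub (.num 1) e

@[simp] theorem eval_num (c : ℕ) (s : St) : (num c).eval s = c := rfl
@[simp] theorem eval_var (x : ℕ) (s : St) : (var x).eval s = s.v x := rfl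
@[simp] theorem eval_add (a b : Ex) (s : St) : (add a b).eval s = a.eval s + b.eval s := rfl
@[simp] theorem eval_sub (a b : Ex) (s : St) : (sub a b).eval s = a.eval s - b.eval s := rfl
@[simp] theorem eval_mul (a b : Ex) (s : St) : (mul a b).eval s = a.eval s * b.eval s := rfl
@[simp] theorem eval_arr (k : ℕ) (e : Ex) (s : St) : (arr k e).eval s = s.a k (e.eval s) := rfl
@[simp] theorem eval_sum (x : ℕ) (n e : Ex) (s : St) :
    (sum x n e).eval s = ∑ i ∈ Finset.range (n.eval s), e.eval (s.setV x i) := rfl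

@[simp] theorem eval_pos (e : Ex) (s : St) : (pos e).eval s = min 1 (e.eval s) := by
  simp only [pos, eval_sub, eval_num]; omega

@[simp] theorem eval_eq (a b : Ex) (s : St) :
    (eq a b).eval s = if a.eval s = b.eval s then 1 else 0 := by
  simp only [eq, eval_sub, eval_num, eval_add]
  split_ifs <;> omega

@[simp] theorem eval_not (e : Ex) (s : St) : (not e).eval s = 1 - e.eval s := rfl

@[simp] theorem cost_num (c : ℕ) (s : St) : (num c).cost s = 1 := rfl
@[simp] theorem cost_var (x : ℕ) (s : St) : (var x).cost s = 1 := rfl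
@[simp] theorem cost_add (a b : Ex) (s : St) : (add a b).cost s = a.cost s + b.cost s + 1 := rfl
@[simp] theorem cost_sub (a b : Ex) (s : St) : (sub a b).cost s = a.cost s + b.cost s + 1 := rfl
@[simp] theorem cost_mul (a b : Ex) (s : St) : (mul a b).cost s = a.cost s + b.cost s + 1 := rfl
@[simp] theorem cost_arr (k : ℕ) (e : Ex) (s : St) : (arr k e).cost s = e.cost s + 6 := rfl
@[simp] theorem cost_sum (x : ℕ) (n e : Ex) (s : St) : (sum x n e).cost s =
    n.cost s + ∑ i ∈ Finset.range (n.eval s), (e.cost (s.setV x i) + 6) + 7 := rfl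
@[simp] theorem cost_pos (e : Ex) (s : St) : (pos e).cost s = e.cost s + 4 := by
  simp only [pos, cost_sub, cost_num]; omega
@[simp] theorem cost_eq (a b : Ex) (s : St) :
    (eq a b).cost s = 2 * (a.cost s + b.cost s) + 5 := by
  simp only [eq, cost_sub, cost_num, cost_add]; omega
@[simp] theorem cost_not (e : Ex) (s : St) : (not e).cost s = e.cost s + 2 := by
  simp only [not, cost_sub, cost_num]; omega

end Ex

@[simp] theorem St.setV_self (s : St) (x n : ℕ) : (s.setV x n).v x = n := by simp [St.setV]

@[simp] theorem St.setV_of_ne (s : St) {x y : ℕ} (n : ℕ) (h : y ≠ x) :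
    (s.setV x n).v y = s.v y := by simp [St.setV, h]

@[simp] theorem St.setV_a (s : St) (x n : ℕ) : (s.setV x n).a = s.a := rfl

@[simp] theorem St.setV_inp (s : St) (x n : ℕ) : (s.setV x n).inp = s.inp := rfl

@[simp] theorem St.setV_out (s : St) (x n : ℕ) : (s.setV x n).out = s.out := rfl

@[simp] theorem St.setA_self (s : St) (k i n : ℕ) :
    (s.setA k i n).a k = Function.update (s.a k) i n := by
  simp [St.setA]

@[simp] theorem St.setA_of_ne (s : St) {k l : ℕ} (i n : ℕ) (h : l ≠ k) :
    (s.setA k i n).a l = s.a l := by simp [St.setA, h]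

@[simp] theorem St.setA_v (s : St) (k i n : ℕ) : (s.setA k i n).v = s.v := rfl

@[simp] theorem St.setA_inp (s : St) (k i n : ℕ) : (s.setA k i n).inp = s.inp := rfl

@[simp] theorem St.setA_out (s : St) (k i n : ℕ) : (s.setA k i n).out = s.out := rfl

end SkewGen

namespace SkewGen

/-! ### The program: testing all boxes -/

theorem sum_range_eq_sum_fin {n : ℕ} {g : ℕ → ℕ} {f : Fin n → ℕ} (h : ∀ i : Fin n, g i = f i) :
    ∑ i ∈ Finset.range n, g i = ∑ i, f i := by
  rw [Finset.sum_range]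
  exact Finset.sum_congr rfl fun i _ => h i

/-- The array `k` of the state holds the values of `f`. -/
def Holds {n : ℕ} (k : ℕ) (f : Fin n → ℕ) (s : St) : Prop := ∀ i : Fin n, s.a k i = f i

theorem Tri.fillFin {M k x : ℕ} {e : Ex} {y : ℕ} {s : St} {K n : ℕ} (f : Fin n → ℕ)
    (hn : s.v y = n) (hnM : n ≤ M)
    (he : ∀ i : Fin n, ∀ s' : St, (∀ y, y ≠ x → s'.v y = s.v y) → s'.v x = i →
      (∀ l, l ≠ k → s'.a l = s.a l) → e.eval s' = f i ∧ e.cost s' ≤ K)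
    (hf : ∀ i, f i ≤ M) :
    Tri M (fillCmd k x (.var y) e) s (4 + n * (K + 12)) (Holds k f) := by
  have h := Tri.fill (M := M) (k := k) (x := x) (n := .var y) (e := e) (s := s) (K := K)
    (fun i => if h : i < n then f ⟨i, h⟩ else 0) (by simpa [hn] using hnM) ?_ ?_
  · refine h.mono ?_ fun s' h' i => ?_
    · simp [hn]
    · rw [h' i (by simp [hn])]; simp
  · intro i hi s' h1 h2 h3
    have hi' : i < n := by simpa [hn] using hi
    simpa [hi'] using he ⟨i, hi'⟩ s' h1 h2 h3
  · intro i hi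
    have hi' : i < n := by simpa [hn] using hi
    simpa [hi'] using hf ⟨i, hi'⟩

/-! ### Code for sums, counts, credits and the box test -/

section Expressions

/-- The index of the box in row `a` and column `b`. -/
def boxE (a b : Ex) : Ex := .add (.mul a (.var 1)) b

/-- Array 0 holds the numbers of unused vertices. Arrays 6 and 7 are for its row and column sums, 8
and 9 for the credits, 10 and 11 for the numbers of nonempty boxes per row and column, and 12 for
the marks of good boxes. Variable 12 is the total, 13, 14 and 15 count nonempty rows, columns and
boxes, and 16 is the sum of the violations. -/
def entryE (a b : Ex) : Ex := .arr 0 (boxE a b)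

def excessE (a b : Ex) : Ex :=
  .mul (.pos (.sub (.add (.arr 6 a) (.arr 7 b)) (.mul (.num 2) (entryE a b))))
    (.sub (.add (.add (.arr 6 a) (.arr 7 b)) (.num 1)) (.var 12))

/-- Row sums, column sums, and the total. -/
def sumsCmd : Cmd :=
  .seq (fillCmd 6 18 (.var 0) (.sum 21 (.var 1) (entryE (.var 18) (.var 21))))
  (.seq (fillCmd 7 19 (.var 1) (.sum 20 (.var 0) (entryE (.var 20) (.var 19))))
  (.assign 12 (.sum 20 (.var 0) (.arr 6 (.var 20)))))

/-- Numbers of nonempty boxes, rows and columns. -/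
def countsCmd : Cmd :=
  .seq (fillCmd 10 18 (.var 0) (.sum 21 (.var 1) (.pos (entryE (.var 18) (.var 21)))))
  (.seq (fillCmd 11 19 (.var 1) (.sum 20 (.var 0) (.pos (entryE (.var 20) (.var 19)))))
  (.seq (.assign 13 (.sum 20 (.var 0) (.pos (.arr 6 (.var 20)))))
  (.seq (.assign 14 (.sum 21 (.var 1) (.pos (.arr 7 (.var 21)))))
  (.assign 15 (.sum 20 (.var 0) (.arr 10 (.var 20)))))))

/-- Violations and credits. -/
def creditsCmd : Cmd :=
  .seq (.assign 16 (.add (.add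
      (.sum 20 (.var 0) (.sub (.mul (.num 2) (.arr 6 (.var 20))) (.var 12)))
      (.sum 21 (.var 1) (.sub (.mul (.num 2) (.arr 7 (.var 21))) (.var 12))))
      (.sum 20 (.var 0) (.sum 21 (.var 1) (excessE (.var 20) (.var 21))))))
  (.seq (fillCmd 8 18 (.var 0) (.add (.pos (.sub (.mul (.num 2) (.arr 6 (.var 18))) (.var 12)))
      (.sum 21 (.var 1) (.pos (excessE (.var 18) (.var 21))))))
  (fillCmd 9 19 (.var 1) (.add (.pos (.sub (.mul (.num 2) (.arr 7 (.var 19))) (.var 12)))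
      (.sum 20 (.var 0) (.pos (excessE (.var 20) (.var 19)))))))

/-- The test for the box in row `18` and column `19`; it has to be in another row and in another
column than the variables `10` and `11` tell. -/
def testE : Ex :=
  .mul (.mul (.mul (.mul (.mul (.mul
    (.not (.eq (.var 18) (.var 10)))
    (.not (.eq (.var 19) (.var 11))))
    (.pos (entryE (.var 18) (.var 19))))
    (.eq (.add (.var 16) (.pos (excessE (.var 18) (.var 19))))
      (.add (.arr 8 (.var 18)) (.arr 9 (.var 19)))))
    (.not (.mul (.mul (.mul (.eq (.arr 6 (.var 18)) (.num 1))
      (.eq (.mul (.num 2) (.arr 7 (.var 19))) (.add (.var 12) (.num 1))))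
      (.eq (.var 13) (.num 3))) (.eq (.arr 11 (.var 19)) (.num 3)))))
    (.not (.mul (.mul (.mul (.eq (.arr 7 (.var 19)) (.num 1))
      (.eq (.mul (.num 2) (.arr 6 (.var 18))) (.add (.var 12) (.num 1))))
      (.eq (.var 14) (.num 3))) (.eq (.arr 10 (.var 18)) (.num 3)))))
    (.not (.mul (.mul (.mul (.mul (.eq (.arr 6 (.var 18)) (.num 1)) (.eq (.arr 7 (.var 19)) (.num 1)))
      (.eq (.var 13) (.num 3))) (.eq (.var 14) (.num 3))) (.eq (.var 15) (.num 5))))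

/-- Mark the good boxes in the array `12`. -/
def goodCmd : Cmd :=
  .seq sumsCmd (.seq countsCmd (.seq creditsCmd
    (.loop 18 (.var 0) (.loop 19 (.var 1) (.store 12 (boxE (.var 18) (.var 19)) testE)))))

end Expressions

/-! ### The marks of good boxes are correct and take O(pq) steps -/

section Correctness

variable {p q : ℕ} {t : Fin p → Fin q → ℕ}

/-- The state holds the table `t`. -/
structure Env (t : Fin p → Fin q → ℕ) (s : St) : Prop where
  hp : s.v 0 = p
  hq : s.v 1 = q
  entry : ∀ (i : Fin p) (j : Fin q), s.a 0 (i * q + j) = t i j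

theorem Env.congr {s s' : St} (h : Env t s) (h0 : s'.v 0 = s.v 0) (h1 : s'.v 1 = s.v 1)
    (ha : s'.a 0 = s.a 0) : Env t s' :=
  ⟨h0.trans h.hp, h1.trans h.hq, ha ▸ h.entry⟩

structure HasSums (t : Fin p → Fin q → ℕ) (s : St) : Prop extends Env t s where
  row : Holds 6 (rowSum t) s
  col : Holds 7 (colSum t) s
  tot : s.v 12 = total t

structure HasCounts (t : Fin p → Fin q → ℕ) (s : St) : Prop extends HasSums t s where
  rowBoxes : Holds 10 (fun i => cnt (t i)) s
  colBoxes : Holds 11 (fun j => cnt fun i => t i j) s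
  rows : s.v 13 = cnt (rowSum t)
  cols : s.v 14 = cnt (colSum t)
  boxes : s.v 15 = boxCount t

structure HasCredits (t : Fin p → Fin q → ℕ) (s : St) : Prop extends HasCounts t s where
  viol : s.v 16 = violations t
  rowCr : Holds 8 (rowCredit t) s
  colCr : Holds 9 (colCredit t) s

theorem excess_le (t : Fin p → Fin q → ℕ) (k : Fin p) (l : Fin q) :
    excess t k l ≤ total t + 1 := by
  have := rowSum_le_total t k
  have := colSum_le_total t l
  exact min_one_mul_le fun _ => by omega

theorem sum_fin_le {n : ℕ} {f : Fin n → ℕ} {K : ℕ} (h : ∀ i, f i ≤ K) : ∑ i, f i ≤ n * K :=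
  (Finset.sum_le_card_nsmul _ _ K fun i _ => h i).trans (by simp)

theorem violations_le (t : Fin p → Fin q → ℕ) :
    violations t ≤ p * total t + q * total t + p * (q * (total t + 1)) := by
  unfold violations
  refine add_le_add (add_le_add (sum_fin_le fun k => ?_) (sum_fin_le fun l => ?_))
    (sum_fin_le fun k => sum_fin_le fun l => excess_le t k l)
  · have := rowSum_le_total t k; omega
  · have := colSum_le_total t l; omega

theorem tri_sumsCmd {M : ℕ} {s : St} (h : Env t s) (hp : p ≤ M) (hq : q ≤ M)
    (hM : total t ≤ M) : Tri M sumsCmd s (50 * (p * q) + 50 * p + 50 * q + 50) (HasSums t) := by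
  have h1 := Tri.fillFin (M := M) (k := 6) (x := 18) (y := 0) (s := s)
    (e := .sum 21 (.var 1) (entryE (.var 18) (.var 21))) (K := 8 + q * 17) (rowSum t) h.hp hp ?_
    (fun i => (rowSum_le_total t i).trans hM)
  swap
  · intro i s' hv hx ha
    have e0 : s'.a 0 = s.a 0 := ha 0 (by decide)
    have e1 : s'.v 1 = q := (hv 1 (by decide)).trans h.hq
    refine ⟨?_, ?_⟩
    · simp only [Ex.eval_sum, Ex.eval_var, e1]
      exact sum_range_eq_sum_fin fun l => by simp [entryE, boxE, e0, e1, hx, h.entry]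
    · simp [entryE, boxE, e1]
      omega
  refine (Tri.seq (h1.frame fun s1 r hv ha _ _ => (⟨h.congr (hv 0 (by decide)) (hv 1 (by decide))
    (ha 0 (by decide)), r⟩ : Env t s1 ∧ Holds 6 (rowSum t) s1)) fun s1 ⟨h, r⟩ => ?_).mono
    (K' := 50 * (p * q) + 50 * p + 50 * q + 50) (K := _ + (4 + q * (8 + p * 17 + 12) + (9 + p * 13)))
    (by linarith [Nat.zero_le (p * q)]) fun _ h => h
  have h2 := Tri.fillFin (M := M) (k := 7) (x := 19) (y := 1) (s := s1)
    (e := .sum 20 (.var 0) (entryE (.var 20) (.var 19))) (K := 8 + p * 17) (colSum t) h.hq hq ?_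
    (fun i => (colSum_le_total t i).trans hM)
  swap
  · intro i s' hv hx ha
    have e0 : s'.a 0 = s1.a 0 := ha 0 (by decide)
    have e1 : s'.v 1 = q := (hv 1 (by decide)).trans h.hq
    have e2 : s'.v 0 = p := (hv 0 (by decide)).trans h.hp
    refine ⟨?_, ?_⟩
    · simp only [Ex.eval_sum, Ex.eval_var, e2]
      exact sum_range_eq_sum_fin fun l => by simp [entryE, boxE, e0, e1, hx, h.entry]
    · simp [entryE, boxE, e2]
      omega
  refine Tri.seq (h2.frame fun s2 c hv ha _ _ => (⟨h.congr (hv 0 (by decide)) (hv 1 (by decide))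
    (ha 0 (by decide)), fun i => (congrFun (ha 6 (by decide)) _).trans (r i), c⟩ :
      Env t s2 ∧ Holds 6 (rowSum t) s2 ∧ Holds 7 (colSum t) s2)) fun s2 ⟨h, r, c⟩ => ?_
  have e : (Ex.sum 20 (.var 0) (.arr 6 (.var 20))).eval s2 = total t := by
    simp only [Ex.eval_sum, Ex.eval_var, h.hp]
    exact sum_range_eq_sum_fin fun l => by simp [r l]
  refine Tri.assign (by rw [e]; exact hM) (by simp [h.hp]; omega) ⟨⟨h.hp, h.hq, h.entry⟩, r, c, ?_⟩
  rw [e]; simp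

theorem HasSums.congr {s s' : St} (h : HasSums t s) (h0 : s'.v 0 = s.v 0) (h1 : s'.v 1 = s.v 1)
    (h12 : s'.v 12 = s.v 12) (ha : s'.a 0 = s.a 0) (h6 : s'.a 6 = s.a 6) (h7 : s'.a 7 = s.a 7) :
    HasSums t s' :=
  ⟨h.toEnv.congr h0 h1 ha, fun i => (congrFun h6 _).trans (h.row i),
    fun i => (congrFun h7 _).trans (h.col i), h12.trans h.tot⟩

theorem cnt_le {n : ℕ} (f : Fin n → ℕ) : cnt f ≤ n := by
  have := sum_fin_le (f := fun i => min 1 (f i)) (K := 1) fun i => by omega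
  unfold cnt
  omega

theorem tri_countsCmd {M : ℕ} {s : St} (h : HasSums t s) (hp : p ≤ M) (hq : q ≤ M)
    (hM : p * q ≤ M) :
    Tri M countsCmd s (50 * (p * q) + 100 * p + 100 * q + 100) (HasCounts t) := by
  have h1 := Tri.fillFin (M := M) (k := 10) (x := 18) (y := 0) (s := s)
    (e := .sum 21 (.var 1) (.pos (entryE (.var 18) (.var 21)))) (K := 8 + q * 21)
    (fun i => cnt (t i)) h.hp hp ?_ (fun i => (cnt_le _).trans hq)
  swap
  · intro i s' hv hx ha
    have e0 : s'.a 0 = s.a 0 := ha 0 (by decide)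
    have e1 : s'.v 1 = q := (hv 1 (by decide)).trans h.hq
    refine ⟨?_, ?_⟩
    · simp only [Ex.eval_sum, Ex.eval_var, e1]
      exact sum_range_eq_sum_fin fun l => by simp [entryE, boxE, e0, e1, hx, h.entry]
    · simp [entryE, boxE, e1]
      omega
  refine (Tri.seq (h1.frame fun s1 r hv ha _ _ => (⟨h.congr (hv 0 (by decide)) (hv 1 (by decide))
    (hv 12 (by decide)) (ha 0 (by decide)) (ha 6 (by decide)) (ha 7 (by decide)), r⟩ :
      HasSums t s1 ∧ Holds 10 (fun i => cnt (t i)) s1)) fun s1 ⟨h, r⟩ => ?_).mono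
    (K' := 50 * (p * q) + 100 * p + 100 * q + 100)
    (K := _ + (4 + q * (8 + p * 21 + 12) + ((9 + p * 17) + ((9 + q * 17) + (9 + p * 13)))))
    (by linarith [Nat.zero_le (p * q)]) fun _ h => h
  have h2 := Tri.fillFin (M := M) (k := 11) (x := 19) (y := 1) (s := s1)
    (e := .sum 20 (.var 0) (.pos (entryE (.var 20) (.var 19)))) (K := 8 + p * 21)
    (fun j => cnt fun i => t i j) h.hq hq ?_ (fun i => (cnt_le _).trans hp)
  swap
  · intro i s' hv hx ha
    have e0 : s'.a 0 = s1.a 0 := ha 0 (by decide)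
    have e1 : s'.v 1 = q := (hv 1 (by decide)).trans h.hq
    have e2 : s'.v 0 = p := (hv 0 (by decide)).trans h.hp
    refine ⟨?_, ?_⟩
    · simp only [Ex.eval_sum, Ex.eval_var, e2]
      exact sum_range_eq_sum_fin fun l => by simp [entryE, boxE, e0, e1, hx, h.entry]
    · simp [entryE, boxE, e2]
      omega
  refine Tri.seq (h2.frame fun s2 c hv ha _ _ => (⟨h.congr (hv 0 (by decide)) (hv 1 (by decide))
    (hv 12 (by decide)) (ha 0 (by decide)) (ha 6 (by decide)) (ha 7 (by decide)),
    fun i => (congrFun (ha 10 (by decide)) _).trans (r i), c⟩ :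
      HasSums t s2 ∧ Holds 10 (fun i => cnt (t i)) s2 ∧ Holds 11 (fun j => cnt fun i => t i j) s2))
    fun s2 ⟨h, r, c⟩ => ?_
  have e3 : (Ex.sum 20 (.var 0) (.pos (.arr 6 (.var 20)))).eval s2 = cnt (rowSum t) := by
    simp only [Ex.eval_sum, Ex.eval_var, h.hp]
    exact sum_range_eq_sum_fin fun l => by simp [h.row l]
  refine Tri.seq (Q := fun s3 => HasSums t s3 ∧ Holds 10 (fun i => cnt (t i)) s3 ∧
    Holds 11 (fun j => cnt fun i => t i j) s3 ∧ s3.v 13 = cnt (rowSum t))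
    (Tri.assign (by rw [e3]; exact (cnt_le _).trans hp) (by simp [h.hp]; omega)
      ⟨h.congr (by simp) (by simp) (by simp) rfl rfl rfl, r, c, by rw [e3]; simp⟩) ?_
  rintro s3 ⟨h, r, c, h13⟩
  have e4 : (Ex.sum 21 (.var 1) (.pos (.arr 7 (.var 21)))).eval s3 = cnt (colSum t) := by
    simp only [Ex.eval_sum, Ex.eval_var, h.hq]
    exact sum_range_eq_sum_fin fun l => by simp [h.col l]
  refine Tri.seq (Q := fun s3 => HasSums t s3 ∧ Holds 10 (fun i => cnt (t i)) s3 ∧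
    Holds 11 (fun j => cnt fun i => t i j) s3 ∧ s3.v 13 = cnt (rowSum t) ∧
    s3.v 14 = cnt (colSum t))
    (Tri.assign (by rw [e4]; exact (cnt_le _).trans hq) (by simp [h.hq]; omega)
      ⟨h.congr (by simp) (by simp) (by simp) rfl rfl rfl, r, c, by simpa using h13,
        by rw [e4]; simp⟩) ?_
  rintro s4 ⟨h, r, c, h13, h14⟩
  have e5 : (Ex.sum 20 (.var 0) (.arr 10 (.var 20))).eval s4 = boxCount t := by
    simp only [Ex.eval_sum, Ex.eval_var, h.hp]
    exact sum_range_eq_sum_fin fun l => by simp [r l]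
  exact Tri.assign (by rw [e5]; exact (sum_fin_le fun i => cnt_le (t i)).trans hM)
    (by simp [h.hp]; omega) ⟨h.congr (by simp) (by simp) (by simp) rfl rfl rfl, r, c,
      by simpa using h13, by simpa using h14, by rw [e5]; simp⟩

theorem HasSums.eval_excessE {s : St} (h : HasSums t s) {a b : Ex} {i : Fin p} {j : Fin q}
    (ha : a.eval s = i) (hb : b.eval s = j) : (excessE a b).eval s = excess t i j := by
  simp [excessE, excess, entryE, boxE, ha, hb, h.row i, h.col j, h.tot, h.hq, h.entry]

theorem HasCounts.congr {s s' : St} (h : HasCounts t s) (hs : HasSums t s')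
    (h10 : s'.a 10 = s.a 10) (h11 : s'.a 11 = s.a 11) (h13 : s'.v 13 = s.v 13)
    (h14 : s'.v 14 = s.v 14) (h15 : s'.v 15 = s.v 15) : HasCounts t s' :=
  ⟨hs, fun i => (congrFun h10 _).trans (h.rowBoxes i), fun i => (congrFun h11 _).trans (h.colBoxes i),
    h13.trans h.rows, h14.trans h.cols, h15.trans h.boxes⟩

theorem cost_excessE {x y : ℕ} (s : St) : (excessE (.var x) (.var y)).cost s = 53 := by
  simp [excessE, entryE, boxE]

theorem tri_creditsCmd {M : ℕ} {s : St} (h : HasCounts t s) (hp : p + 1 ≤ M) (hq : q + 1 ≤ M)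
    (hM : violations t ≤ M) :
    Tri M creditsCmd s (300 * (p * q) + 200 * p + 200 * q + 200) (HasCredits t) := by
  have e1 : (Ex.add (.add
      (.sum 20 (.var 0) (.sub (.mul (.num 2) (.arr 6 (.var 20))) (.var 12)))
      (.sum 21 (.var 1) (.sub (.mul (.num 2) (.arr 7 (.var 21))) (.var 12))))
      (.sum 20 (.var 0) (.sum 21 (.var 1) (excessE (.var 20) (.var 21))))).eval s =
      violations t := by
    simp only [Ex.eval_add, Ex.eval_sum, Ex.eval_var, h.hp, h.hq, violations]
    congr 1
    · congr 1
      · exact sum_range_eq_sum_fin fun l => by simp [h.row l, h.tot]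
      · exact sum_range_eq_sum_fin fun l => by simp [h.col l, h.tot]
    · refine sum_range_eq_sum_fin fun k => ?_
      rw [St.setV_of_ne _ _ (by decide), h.hq]
      refine sum_range_eq_sum_fin fun l => ?_
      have hs : HasSums t ((s.setV 20 k).setV 21 l) :=
        h.toHasSums.congr (by simp) (by simp) (by simp) rfl rfl rfl
      exact hs.eval_excessE (a := .var 20) (b := .var 21) (by simp) (by simp)
  refine (Tri.seq (Q := fun s => HasCounts t s ∧ s.v 16 = violations t) (Tri.assign
    (K := p * (q * 64 + 30) + p * 20 + q * 20 + 100) (by rw [e1]; exact hM)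
    (by simp [h.hp, h.hq, cost_excessE]; linarith [Nat.zero_le (p * q)])
    ⟨h.congr (h.toHasSums.congr (by simp) (by simp)
      (by simp) rfl rfl rfl) rfl rfl (by simp) (by simp) (by simp), by rw [e1]; simp⟩)
    fun s1 ⟨h, h16⟩ => ?_).mono (K' := 300 * (p * q) + 200 * p + 200 * q + 200)
    (K := _ + ((4 + p * (40 + q * 68 + 12)) + (4 + q * (40 + p * 68 + 12))))
    (by linarith [Nat.zero_le (p * q)]) fun _ h => h
  have h1 := Tri.fillFin (M := M) (k := 8) (x := 18) (y := 0) (s := s1)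
    (e := .add (.pos (.sub (.mul (.num 2) (.arr 6 (.var 18))) (.var 12)))
      (.sum 21 (.var 1) (.pos (excessE (.var 18) (.var 21))))) (K := 40 + q * 68)
    (rowCredit t) h.hp (by omega) ?_ (fun i => ?_)
  rotate_left
  · intro i s' hv hx ha
    have h' : HasSums t s' := h.toHasSums.congr (hv 0 (by decide)) (hv 1 (by decide))
      (hv 12 (by decide)) (ha 0 (by decide)) (ha 6 (by decide)) (ha 7 (by decide))
    refine ⟨?_, ?_⟩
    · simp only [Ex.eval_add, Ex.eval_sum, Ex.eval_var, h'.hq, rowCredit]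
      congr 1
      · simp [hx, h'.row i, h'.tot]
      · refine sum_range_eq_sum_fin fun l => ?_
        have hs : HasSums t (s'.setV 21 l) := h'.congr (by simp) (by simp) (by simp) rfl rfl rfl
        rw [Ex.eval_pos, hs.eval_excessE (a := .var 18) (b := .var 21) (i := i) (j := l)
          (by simpa using hx) (by simp)]
    · simp [cost_excessE, h'.hq]
      omega
  · have := sum_fin_le (f := fun l => min 1 (excess t i l)) (K := 1) fun l => by omega
    unfold rowCredit
    omega
  refine Tri.seq (h1.frame fun s2 r hv ha _ _ => (⟨h.congr (h.toHasSums.congr (hv 0 (by decide))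
    (hv 1 (by decide)) (hv 12 (by decide)) (ha 0 (by decide)) (ha 6 (by decide)) (ha 7 (by decide)))
    (ha 10 (by decide)) (ha 11 (by decide)) (hv 13 (by decide)) (hv 14 (by decide))
    (hv 15 (by decide)), (hv 16 (by decide)).trans h16, r⟩ : HasCounts t s2 ∧
      s2.v 16 = violations t ∧ Holds 8 (rowCredit t) s2)) fun s2 ⟨h, h16, r⟩ => ?_
  have h2 := Tri.fillFin (M := M) (k := 9) (x := 19) (y := 1) (s := s2)
    (e := .add (.pos (.sub (.mul (.num 2) (.arr 7 (.var 19))) (.var 12)))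
      (.sum 20 (.var 0) (.pos (excessE (.var 20) (.var 19))))) (K := 40 + p * 68)
    (colCredit t) h.hq (by omega) ?_ (fun i => ?_)
  rotate_left
  · intro i s' hv hx ha
    have h' : HasSums t s' := h.toHasSums.congr (hv 0 (by decide)) (hv 1 (by decide))
      (hv 12 (by decide)) (ha 0 (by decide)) (ha 6 (by decide)) (ha 7 (by decide))
    refine ⟨?_, ?_⟩
    · simp only [Ex.eval_add, Ex.eval_sum, Ex.eval_var, h'.hp, colCredit]
      congr 1
      · simp [hx, h'.col i, h'.tot]
      · refine sum_range_eq_sum_fin fun l => ?_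
        have hs : HasSums t (s'.setV 20 l) := h'.congr (by simp) (by simp) (by simp) rfl rfl rfl
        rw [Ex.eval_pos, hs.eval_excessE (a := .var 20) (b := .var 19) (i := l) (j := i)
          (by simp) (by simpa using hx)]
    · simp [cost_excessE, h'.hp]
      omega
  · have := sum_fin_le (f := fun l => min 1 (excess t l i)) (K := 1) fun l => by omega
    unfold colCredit
    omega
  refine h2.frame fun s3 c hv ha _ _ => ⟨h.congr (h.toHasSums.congr (hv 0 (by decide))
    (hv 1 (by decide)) (hv 12 (by decide)) (ha 0 (by decide)) (ha 6 (by decide)) (ha 7 (by decide)))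
    (ha 10 (by decide)) (ha 11 (by decide)) (hv 13 (by decide)) (hv 14 (by decide))
    (hv 15 (by decide)), (hv 16 (by decide)).trans h16,
    fun i => (congrFun (ha 8 (by decide)) _).trans (r i), c⟩

theorem ite_mul_ite {a b : Prop} [Decidable a] [Decidable b] :
    (if a then 1 else 0) * (if b then 1 else 0) = if a ∧ b then 1 else 0 := by
  split_ifs <;> simp_all

theorem one_sub_ite {a : Prop} [Decidable a] :
    1 - (if a then 1 else 0) = if ¬ a then 1 else 0 := by
  split_ifs <;> simp_all

theorem min_one_eq_ite (n : ℕ) : min 1 n = if n ≠ 0 then 1 else 0 := by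
  split_ifs <;> omega

open Classical in
-- Every factor of the test is 0 or 1, so the product is the indicator of the conjunction in
-- `good_iff_test`, together with the requirement to leave the row and the column of the last
-- vertex.
theorem HasCredits.eval_testE {s : St} (h : HasCredits t s) {i : Fin p} {j : Fin q}
    (hi : s.v 18 = i) (hj : s.v 19 = j) :
    testE.eval s = if Good t i j ∧ (i : ℕ) ≠ s.v 10 ∧ (j : ℕ) ≠ s.v 11 then 1 else 0 := by
  have he : (entryE (.var 18) (.var 19)).eval s = t i j := by
    simp [entryE, boxE, hi, hj, h.hq, h.entry]
  have hx := h.eval_excessE (a := .var 18) (b := .var 19) hi hj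
  simp only [testE, Ex.eval_mul, Ex.eval_not, Ex.eval_eq, Ex.eval_var, Ex.eval_pos, Ex.eval_add,
    Ex.eval_arr, Ex.eval_num, he, hx, hi, hj, h.row i, h.col j, h.rowCr i, h.colCr j, h.viol, h.tot,
    h.rows, h.cols, h.boxes, h.rowBoxes i, h.colBoxes j]
  rw [min_one_eq_ite (t i j)]
  simp only [ite_mul_ite, one_sub_ite]
  refine if_congr ?_ rfl rfl
  rw [good_iff_test]
  simp only [and_assoc]
  exact ⟨fun ⟨a, b, c, d, e, f, g⟩ => ⟨c, d, e, f, g, a, b⟩,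
    fun ⟨c, d, e, f, g, a, b⟩ => ⟨a, b, c, d, e, f, g⟩⟩

theorem HasCredits.congr {s s' : St} (h : HasCredits t s)
    (hv : ∀ x, x ≠ 18 → x ≠ 19 → s'.v x = s.v x) (ha : ∀ k, k ≠ 12 → s'.a k = s.a k) :
    HasCredits t s' :=
  ⟨h.toHasCounts.congr (h.toHasSums.congr (hv _ (by decide) (by decide))
    (hv _ (by decide) (by decide)) (hv _ (by decide) (by decide)) (ha _ (by decide))
    (ha _ (by decide)) (ha _ (by decide))) (ha _ (by decide)) (ha _ (by decide))
    (hv _ (by decide) (by decide)) (hv _ (by decide) (by decide)) (hv _ (by decide) (by decide)),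
    (hv _ (by decide) (by decide)).trans h.viol,
    fun i => (congrFun (ha _ (by decide)) _).trans (h.rowCr i),
    fun i => (congrFun (ha _ (by decide)) _).trans (h.colCr i)⟩

open Classical in
/-- The mark of a box. -/
noncomputable def mark (t : Fin p → Fin q → ℕ) (x y : ℕ) (i : Fin p) (j : Fin q) : ℕ :=
  if Good t i j ∧ (i : ℕ) ≠ x ∧ (j : ℕ) ≠ y then 1 else 0

theorem mark_le (x y : ℕ) (i : Fin p) (j : Fin q) : mark t x y i j ≤ 1 := by
  unfold mark; split_ifs <;> omega

theorem mark_pos {x y : ℕ} {i : Fin p} {j : Fin q} :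
    0 < mark t x y i j ↔ Good t i j ∧ (i : ℕ) ≠ x ∧ (j : ℕ) ≠ y := by
  unfold mark; split_ifs with h <;> simp [h]

theorem mul_add_inj {q i i' j j' : ℕ} (hj : j < q) (hj' : j' < q) (h : i * q + j = i' * q + j') :
    i = i' ∧ j = j' := by
  have hq : 0 < q := by omega
  have h1 := congrArg (· / q) h
  have h2 := congrArg (· % q) h
  simp only [Nat.add_div_of_dvd_right (dvd_mul_left q _),
    Nat.mul_div_cancel _ hq, Nat.div_eq_of_lt hj, Nat.div_eq_of_lt hj', add_zero] at h1
  exact ⟨h1, by subst h1; omega⟩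

/-- The loop that marks the good boxes. -/
theorem tri_marks {M : ℕ} {s : St} (h : HasCredits t s) (hp : p + 1 ≤ M) (hq : q + 1 ≤ M) :
    Tri M (.loop 18 (.var 0) (.loop 19 (.var 1) (.store 12 (boxE (.var 18) (.var 19)) testE))) s
      (4 + p * (4 + q * 600 + 5)) fun s' =>
        ∀ (i : Fin p) (j : Fin q), s'.a 12 (i * q + j) = mark t (s.v 10) (s.v 11) i j := by
  have h1 := Tri.loop (M := M) (x := 18) (n := .var 0) (s := s) (K := 4 + q * 600)
    (a := .loop 19 (.var 1) (.store 12 (boxE (.var 18) (.var 19)) testE))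
    (fun k s' => HasCredits t s' ∧ s'.v 10 = s.v 10 ∧ s'.v 11 = s.v 11 ∧
      ∀ (i : Fin p) (j : Fin q), (i : ℕ) < k →
        s'.a 12 (i * q + j) = mark t (s.v 10) (s.v 11) i j)
    (by simp [h.hp]; omega) ⟨h, rfl, rfl, fun i j hi => by omega⟩ ?_
  · refine h1.mono (by simp [h.hp]) fun s' ⟨_, _, _, h4⟩ i j => h4 i j (by simp [h.hp])
  rintro k hk s' ⟨h', e10, e11, hm⟩
  have hk' : k < p := by simpa [h.hp] using hk
  have h2 := Tri.loop (M := M) (x := 19) (n := .var 1) (s := s'.setV 18 k) (K := 595)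
    (a := .store 12 (boxE (.var 18) (.var 19)) testE)
    (fun l s'' => HasCredits t s'' ∧ s''.v 10 = s.v 10 ∧ s''.v 11 = s.v 11 ∧ s''.v 18 = k ∧
      ∀ (i : Fin p) (j : Fin q), (i : ℕ) < k ∨ (i : ℕ) = k ∧ (j : ℕ) < l →
        s''.a 12 (i * q + j) = mark t (s.v 10) (s.v 11) i j)
    (by simp [h'.hq]; omega)
    ⟨h'.congr (fun x h _ => by simp [h]) fun _ _ => rfl, by simpa using e10, by simpa using e11,
      by simp, fun i j hi => hm i j (by omega)⟩ ?_
  · refine h2.mono (by simp [h'.hq]) fun s'' ⟨a1, a2, a3, a4, a5⟩ => ⟨a1, a2, a3, fun i j hi =>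
      a5 i j ?_⟩
    simp only [Ex.eval_var]
    rw [St.setV_of_ne _ _ (by decide), h'.hq]
    omega
  rintro l hl s'' ⟨h'', e10', e11', e18, hm'⟩
  have hl' : l < q := by simpa [h'.hq] using hl
  have h3 : HasCredits t (s''.setV 19 l) := h''.congr (fun x _ h => by simp [h]) fun _ _ => rfl
  have hev := h3.eval_testE (i := ⟨k, hk'⟩) (j := ⟨l, hl'⟩) (by simpa using e18) (by simp)
  have hev' : testE.eval (s''.setV 19 l) = mark t (s.v 10) (s.v 11) ⟨k, hk'⟩ ⟨l, hl'⟩ := by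
    rw [hev, mark, ← e10', ← e11', St.setV_of_ne _ _ (by decide), St.setV_of_ne _ _ (by decide)]
  refine ⟨?_, ?_, ?_, ?_, ?_, ?_, ?_⟩
  · simp only [Cmd.ok, hev']
    exact (mark_le _ _ _ _).trans (by omega)
  · simp [Cmd.cost, testE, boxE, entryE, cost_excessE]
  · exact h3.congr (fun _ _ _ => rfl) fun x hx => by simp [Cmd.exec, hx]
  · simpa [Cmd.exec] using e10'
  · simpa [Cmd.exec] using e11'
  · simpa [Cmd.exec] using e18
  · intro i j hij
    simp only [Cmd.exec, hev', St.setA_self]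
    have hb : (boxE (.var 18) (.var 19)).eval (s''.setV 19 l) = k * q + l := by
      simp [boxE, e18, h''.hq]
    rw [hb]
    by_cases he : (i : ℕ) = k ∧ (j : ℕ) = l
    · obtain ⟨rfl, rfl⟩ := he; simp
    · rw [Function.update_of_ne fun h => he (mul_add_inj j.2 hl' h)]
      exact hm' i j (by omega)

theorem tri_goodCmd {M : ℕ} {s : St} (h : Env t s) (hp : p + 1 ≤ M) (hq : q + 1 ≤ M)
    (hpq : p * q ≤ M) (ht : total t ≤ M) (hv : violations t ≤ M) :
    Tri M goodCmd s (1000 * (p * q) + 400 * p + 400 * q + 400) fun s' =>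
      ∀ (i : Fin p) (j : Fin q), s'.a 12 (i * q + j) = mark t (s.v 10) (s.v 11) i j := by
  refine (Tri.seq ((tri_sumsCmd h (by omega) (by omega) ht).frame fun s1 h hv _ _ _ =>
    (⟨h, hv 10 (by decide), hv 11 (by decide)⟩ : HasSums t s1 ∧ s1.v 10 = s.v 10 ∧
      s1.v 11 = s.v 11)) fun s1 ⟨h, a, b⟩ => ?_).mono
    (K := _ + ((50 * (p * q) + 100 * p + 100 * q + 100) +
      ((300 * (p * q) + 200 * p + 200 * q + 200) + (4 + p * (4 + q * 600 + 5))))) (by linarith)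
    fun _ h => h
  refine Tri.seq ((tri_countsCmd h (by omega) (by omega) hpq).frame fun s2 h hv _ _ _ =>
    (⟨h, (hv 10 (by decide)).trans a, (hv 11 (by decide)).trans b⟩ : HasCounts t s2 ∧
      s2.v 10 = s.v 10 ∧ s2.v 11 = s.v 11)) fun s2 ⟨h, a, b⟩ => ?_
  refine Tri.seq ((tri_creditsCmd h (by omega) (by omega) hv).frame fun s3 h hv _ _ _ =>
    (⟨h, (hv 10 (by decide)).trans a, (hv 11 (by decide)).trans b⟩ : HasCredits t s3 ∧
      s3.v 10 = s.v 10 ∧ s3.v 11 = s.v 11)) fun s3 ⟨h, a, b⟩ => ?_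
  rw [← a, ← b]
  exact tri_marks h hp hq

end Correctness

end SkewGen

namespace SkewGen

/-! ### The program: depth-first search -/

/-- Two nested loops over rows and columns visit the boxes in the order of their indices, so one
invariant indexed by i * q + j serves both. -/
theorem Tri.loop₂ {M x y a b : ℕ} {c : Cmd} {s : St} {K p q : ℕ} (I : ℕ → St → Prop)
    (hxy : x ≠ y) (hb : b ≠ x) (hp : s.v a = p) (hpM : p ≤ M) (hqM : q ≤ M)
    (hIv : ∀ i s', I i s' → s'.v a = p ∧ s'.v b = q) (hIset : ∀ i s', I i s' → ∀ k,
      I i (s'.setV x k) ∧ I i (s'.setV y k)) (h0 : I 0 s) (hxc : x ∉ c.vars)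
    (hI : ∀ i < p, ∀ j < q, ∀ s', I (i * q + j) s' → s'.v x = i → s'.v y = j →
      Tri M c s' K (I (i * q + j + 1))) :
    Tri M (.loop x (.var a) (.loop y (.var b) c)) s (4 + p * (4 + q * (K + 5) + 5))
      (I (p * q)) := by
  have h1 := Tri.loop (M := M) (x := x) (n := .var a) (s := s) (K := 4 + q * (K + 5))
    (a := .loop y (.var b) c) (fun i s' => I (i * q) s') (by simpa [hp]) (by simpa) ?_
  · refine h1.mono (by simp [hp]) fun s' h => by simpa [hp] using h
  intro i hi s' h
  have hi' : i < p := by simpa [hp] using hi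
  have hq' : (s'.setV x i).v b = q := by rw [St.setV_of_ne _ _ hb]; exact (hIv _ _ h).2
  have h2 := Tri.loop (M := M) (x := y) (n := .var b) (s := s'.setV x i) (K := K) (a := c)
    (fun j s'' => I (i * q + j) s'' ∧ s''.v x = i) (by simpa [hq'])
    ⟨(hIset _ _ h i).1, by simp⟩ ?_
  · refine h2.mono (by simp [hq']) fun s'' h'' => ?_
    simp only [Ex.eval_var, hq'] at h''
    rw [add_mul, one_mul]
    exact h''.1
  rintro j hj s'' ⟨h'', hx⟩
  have hj' : j < q := by simpa [hq'] using hj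
  have hx' : (s''.setV y j).v x = i := by rw [St.setV_of_ne _ _ hxy]; exact hx
  exact (hI i hi' j hj' _ (hIset _ _ h'' j).2 hx' (by simp)).frame fun s3 h3 hv _ _ _ =>
    ⟨h3, (hv x hxc).trans hx'⟩

/-- The number in place `k` of the list of the vertices in the box `b`; unused places have not been
permuted. -/
def St.num (s : St) (k b : ℕ) : ℕ :=
  if s.a 1 (k * s.v 5 + b) = 0 then k else s.a 1 (k * s.v 5 + b) - 1

/-- Places are stored with stride pq: place k of box b is the cell k · pq + b of array 1. Boxes of
any size fit without offsets to be computed. A stored entry is the vertex number plus one, so an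
untouched zero means the identity. -/
def placeE (k : Ex) : Ex := .add (.mul k (.var 5)) (.var 23)

/-- The number in the place `k` of the box with index `23`. -/
def numE (k : Ex) : Ex :=
  .add (.mul (.not (.pos (.arr 1 (placeE k)))) k) (.sub (.arr 1 (placeE k)) (.num 1))

theorem eval_numE (k : Ex) (s : St) : (numE k).eval s = s.num (k.eval s) (s.v 23) := by
  simp only [numE, placeE, St.num, Ex.eval_add, Ex.eval_mul, Ex.eval_not, Ex.eval_pos, Ex.eval_arr,
    Ex.eval_sub, Ex.eval_num, Ex.eval_var]
  split_ifs with h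
  · simp [h]
  · have : min 1 (s.a 1 (k.eval s * s.v 5 + s.v 23)) = 1 := by omega
    simp [this]

/-- Exchange the places `22` and `24` of the box with index `23`. -/
def swapCmd : Cmd :=
  .seq (.assign 28 (numE (.var 22))) (.seq (.assign 25 (numE (.var 24)))
    (.seq (.store 1 (placeE (.var 22)) (.add (.var 25) (.num 1)))
      (.store 1 (placeE (.var 24)) (.add (.var 28) (.num 1)))))

theorem tri_swapCmd {M : ℕ} {s : St} (hb : s.v 23 < s.v 5)
    (h1 : s.num (s.v 22) (s.v 23) + 1 ≤ M) (h2 : s.num (s.v 24) (s.v 23) + 1 ≤ M) :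
    Tri M swapCmd s 100 fun s' => s'.v 28 = s.num (s.v 22) (s.v 23) ∧
      ∀ k b, b < s.v 5 →
        s'.num k b = s.num (if b = s.v 23 then Equiv.swap (s.v 22) (s.v 24) k else k) b := by
  have e1 := eval_numE (.var 22) s
  have e2 := eval_numE (.var 24) (s.setV 28 (s.num (s.v 22) (s.v 23)))
  have hn : ∀ k, (s.setV 28 (s.num (s.v 22) (s.v 23))).num k (s.v 23) = s.num k (s.v 23) :=
    fun k => by simp [St.num]
  simp only [Ex.eval_var] at e1 e2
  rw [St.setV_of_ne _ _ (by decide), St.setV_of_ne _ _ (by decide), hn] at e2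
  refine ⟨⟨?_, ?_, ?_, ?_⟩, ?_, ?_, ?_⟩
  · simp only [Cmd.ok, e1]; omega
  · simp only [Cmd.ok, Cmd.exec, e1, e2]; omega
  · simp only [Cmd.ok, Cmd.exec, e1, e2]
    simpa using h2
  · simp only [Cmd.ok, Cmd.exec, e1, e2]
    simpa using h1
  · simp [swapCmd, Cmd.cost, numE, placeE]
  · simp [swapCmd, Cmd.exec, e1]
  · intro k b hb'
    -- Box indices are below the stride, so different places of different boxes are different cells
    -- and the exchange affects one box only.
    have hinj : ∀ k', k * s.v 5 + b = k' * s.v 5 + s.v 23 ↔ k = k' ∧ b = s.v 23 := fun k' =>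
      ⟨mul_add_inj hb' hb, by rintro ⟨rfl, rfl⟩; rfl⟩
    simp only [swapCmd, Cmd.exec, e1, e2]
    simp only [placeE, St.num, St.setA_self, St.setA_v, St.setV_a, Ex.eval_add, Ex.eval_mul,
      Ex.eval_var, Ex.eval_num, Function.update_apply, ne_eq,
      Nat.reduceEqDiff, not_false_eq_true, St.setV_of_ne, St.setV_self, hinj]
    by_cases hbb : b = s.v 23
    · subst hbb
      by_cases h22 : k = s.v 22
      · by_cases h24 : k = s.v 24
        · simp [← h24, ← h22]
        · simp [← h22, h24]
      · by_cases h24 : k = s.v 24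
        · simp [← h24]
        · simp [h22, h24, Equiv.swap_apply_of_ne_of_ne]
    · simp [hbb]

/-- Extend the path by the vertex in place `22` of the box in row `26` and column `27`, which has
the index `23`. -/
def pushCmd : Cmd :=
  .seq (.assign 24 (.sub (.arr 0 (.var 23)) (.num 1)))
  (.seq (.store 0 (.var 23) (.var 24))
  (.seq swapCmd
  (.seq (.store 2 (.var 6) (.var 26))
  (.seq (.store 3 (.var 6) (.var 27))
  (.seq (.store 4 (.var 6) (.var 22))
  (.seq (.store 5 (.var 6) (.var 28))
  (.seq (.assign 6 (.add (.var 6) (.num 1)))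
  (.seq (.assign 8 (.num 0)) (.assign 9 (.num 0))))))))))

/-- Remove the last vertex of the path and continue the search behind its place. -/
def popCmd : Cmd :=
  .seq (.assign 6 (.sub (.var 6) (.num 1)))
  (.seq (.assign 22 (.arr 4 (.var 6)))
  (.seq (.assign 23 (boxE (.arr 2 (.var 6)) (.arr 3 (.var 6))))
  (.seq (.assign 24 (.arr 0 (.var 23)))
  (.seq swapCmd
  (.seq (.store 0 (.var 23) (.add (.var 24) (.num 1)))
  (.seq (.assign 8 (.var 23)) (.assign 9 (.add (.var 22) (.num 1)))))))))

/-- The state `s'` arises from `s` when the vertex in the place `k` of the box in row `i` and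
column `j` is pushed. -/
structure Pushed (i j k : ℕ) (s s' : St) : Prop where
  fix : ∀ x < 8, x ≠ 6 → s'.v x = s.v x
  depth : s'.v 6 = s.v 6 + 1
  box : s'.v 8 = 0
  place : s'.v 9 = 0
  count : s'.a 0 = Function.update (s.a 0) (i * s.v 1 + j) (s.a 0 (i * s.v 1 + j) - 1)
  num : ∀ k' b, b < s.v 5 → s'.num k' b =
    s.num (if b = i * s.v 1 + j then Equiv.swap k (s.a 0 (i * s.v 1 + j) - 1) k' else k') b
  row : s'.a 2 (s.v 6) = i
  col : s'.a 3 (s.v 6) = j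
  index : s'.a 4 (s.v 6) = k
  number : s'.a 5 (s.v 6) = s.num k (i * s.v 1 + j)
  stack : ∀ l, 2 ≤ l → l ≤ 5 → ∀ x < s.v 6, s'.a l x = s.a l x

/-- The state `s'` arises from `s` when the last vertex is removed. -/
structure Popped (s s' : St) : Prop where
  fix : ∀ x < 8, x ≠ 6 → s'.v x = s.v x
  depth : s'.v 6 = s.v 6 - 1
  box : s'.v 8 = s.a 2 (s.v 6 - 1) * s.v 1 + s.a 3 (s.v 6 - 1)
  place : s'.v 9 = s.a 4 (s.v 6 - 1) + 1
  count : s'.a 0 = Function.update (s.a 0) (s'.v 8) (s.a 0 (s'.v 8) + 1)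
  num : ∀ k' b, b < s.v 5 → s'.num k' b =
    s.num (if b = s'.v 8 then Equiv.swap (s.a 4 (s.v 6 - 1)) (s.a 0 (s'.v 8)) k' else k') b
  stack : ∀ l, 2 ≤ l → l ≤ 5 → ∀ x < s.v 6 - 1, s'.a l x = s.a l x

/-- Both states represent the same path. -/
structure Same (s s' : St) : Prop where
  fix : ∀ x < 8, s'.v x = s.v x
  count : s'.a 0 = s.a 0
  num : ∀ k b, b < s.v 5 → s'.num k b = s.num k b
  stack : ∀ l, 2 ≤ l → l ≤ 5 → ∀ x < s.v 6, s'.a l x = s.a l x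

theorem Same.popped {s s' s'' : St} (h : Same s s') (h' : Popped s' s'') (hd : 0 < s.v 6) :
    Popped s s'' := by
  have h6 := h.fix 6 (by decide)
  have h2 := h.stack 2 (by decide) (by decide) (s.v 6 - 1) (by omega)
  have h3 := h.stack 3 (by decide) (by decide) (s.v 6 - 1) (by omega)
  have h4 := h.stack 4 (by decide) (by decide) (s.v 6 - 1) (by omega)
  have h5 := h.fix 5 (by decide)
  refine ⟨fun x hx hx6 => (h'.fix x hx hx6).trans (h.fix x hx), ?_, ?_, ?_, ?_, ?_, ?_⟩
  · rw [h'.depth, h6]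
  · rw [h'.box, h6, h2, h3, h.fix 1 (by decide)]
  · rw [h'.place, h6, h4]
  · rw [h'.count, h.count]
  · intro k b hb
    rw [h'.num k b (by rwa [h5]), h.num _ b hb, h6, h4, h.count]
  · intro l hl hl' x hx
    rw [h'.stack l hl hl' x (by omega), h.stack l hl hl' x (by omega)]

/-- The pop exchanges the same two places as the push, and an exchange is its own inverse. Only the
represented numbers are restored: cells of array 1 that were untouched may now hold their numbers
explicitly, which is why `Same` speaks of `num`. -/
theorem Pushed.popped {i j k : ℕ} {s s' s'' : St} (h : Pushed i j k s s') (h' : Popped s' s'')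
    (hb : 0 < s.a 0 (i * s.v 1 + j)) :
    Same s s'' ∧ s''.v 8 = i * s.v 1 + j ∧ s''.v 9 = k + 1 := by
  have hd : s'.v 6 - 1 = s.v 6 := by rw [h.depth]; rfl
  have h8 : s''.v 8 = i * s.v 1 + j := by
    rw [h'.box, hd, h.row, h.col, h.fix 1 (by decide) (by decide)]
  have h4 : s'.a 4 (s'.v 6 - 1) = k := by rw [hd, h.index]
  refine ⟨⟨fun x hx => ?_, ?_, ?_, ?_⟩, h8, ?_⟩
  · by_cases hx6 : x = 6
    · rw [hx6, h'.depth, hd]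
    · rw [h'.fix x hx hx6, h.fix x hx hx6]
  · rw [h'.count, h8, h.count]
    funext x
    by_cases hx : x = i * s.v 1 + j
    · subst hx; simp; omega
    · simp [hx]
  · intro k' b hb'
    have h5 := h.fix 5 (by decide) (by decide)
    rw [h'.num k' b (by rwa [h5]), h.num _ b hb', h4, h8, h.count]
    by_cases hbb : b = i * s.v 1 + j
    · simp [hbb]
    · simp [hbb]
  · intro l hl hl' x hx
    rw [h'.stack l hl hl' x (by omega)]
    exact h.stack l hl hl' x hx
  · rw [h'.place, h4]

theorem tri_pushCmd {M i j k : ℕ} {s : St} (h22 : s.v 22 = k) (h26 : s.v 26 = i)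
    (h27 : s.v 27 = j) (h23 : s.v 23 = i * s.v 1 + j) (hb : s.v 23 < s.v 5)
    (h1 : s.num k (s.v 23) + 1 ≤ M) (h2 : s.num (s.a 0 (s.v 23) - 1) (s.v 23) + 1 ≤ M)
    (hc : s.a 0 (s.v 23) ≤ M) (hi : i ≤ M) (hj : j ≤ M) (hk : k ≤ M) (hd : s.v 6 + 1 ≤ M) :
    Tri M pushCmd s 300 (Pushed i j k s) := by
  refine (Tri.seq (K := 50) (K' := 250) (Q := fun s1 =>
    s1 = s.setV 24 (s.a 0 (s.v 23) - 1)) (Tri.assign ?_ ?_ ?_) ?_)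
  · simp; omega
  · simp
  · simp
  rintro s1 rfl
  refine (Tri.seq (K := 50) (K' := 200) (Q := fun s1 =>
    s1 = (s.setV 24 (s.a 0 (s.v 23) - 1)).setA 0 (s.v 23) (s.a 0 (s.v 23) - 1)) ?_ ?_)
  · refine ⟨?_, ?_, ?_⟩
    · simp [Cmd.ok]; omega
    · simp [Cmd.cost]
    · simp [Cmd.exec]
  rintro s1 hs1
  have e6 : s1.v 6 = s.v 6 := by simp [hs1]
  have hnum : ∀ k b, s1.num k b = s.num k b := fun k b => by simp [hs1, St.num]
  have e22 : s1.v 22 = k := by simp [hs1, h22]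
  have e23 : s1.v 23 = i * s.v 1 + j := by simp [hs1, h23]
  have e24 : s1.v 24 = s.a 0 (i * s.v 1 + j) - 1 := by simp [hs1, ← h23]
  have e5 : s1.v 5 = s.v 5 := by simp [hs1]
  refine Tri.seq (K := 100) (K' := 100) ((tri_swapCmd (M := M) (s := s1) ?_ ?_ ?_).frame
    (Q' := fun s2 => (∀ x < 9, s2.v x = s.v x) ∧ s2.v 22 = k ∧ s2.v 26 = i ∧ s2.v 27 = j ∧
      s2.v 28 = s.num k (i * s.v 1 + j) ∧
      (s2.a 0 = Function.update (s.a 0) (i * s.v 1 + j) (s.a 0 (i * s.v 1 + j) - 1)) ∧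
      (∀ l, 2 ≤ l → s2.a l = s.a l) ∧ ∀ k' b, b < s.v 5 → s2.num k' b =
        s.num (if b = i * s.v 1 + j then Equiv.swap k (s.a 0 (i * s.v 1 + j) - 1) k' else k') b)
    ?_) ?_
  · rw [e23, e5]; omega
  · rw [e23, hnum, e22, ← h23]; exact h1
  · rw [e23, hnum, e24, ← h23]; exact h2
  · rintro s2 ⟨g1, g2⟩ hv ha _ _
    refine ⟨fun x hx => ?_, ?_, ?_, ?_, ?_, ?_, ?_, ?_⟩
    · rw [hv x (by simp only [swapCmd, Cmd.vars, List.mem_append, List.mem_singleton]; simp; omega)]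
      rw [hs1, St.setA_v, St.setV_of_ne _ _ (by omega)]
    · rw [hv 22 (by decide), e22]
    · rw [hv 26 (by decide)]; simp [hs1, h26]
    · rw [hv 27 (by decide)]; simp [hs1, h27]
    · rw [g1, e22, e23, hnum]
    · rw [ha 0 (by decide)]; simp [hs1, h23]
    · intro l hl
      rw [ha l (by simp [swapCmd, Cmd.arrs]; omega), hs1, St.setA_of_ne _ _ _ (by omega)]
      rfl
    · intro k' b hb'
      rw [g2 k' b (by rwa [e5]), hnum, e22, e23, e24]
  rintro s2 ⟨g0, g22, g26, g27, g28, ga0, ga, gn⟩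
  have g6 := g0 6 (by decide)
  have hnk : s.num k (i * s.v 1 + j) ≤ M := by rw [← h23]; omega
  refine ⟨?_, ?_, ?_, ?_, ?_, ?_, ?_, ?_, ?_, ?_, ?_, ?_, ?_⟩
  · simp [Cmd.ok, Cmd.exec, g26, g27, g22, g28, g6, hi, hj, hk, hd, hnk]
  · simp [Cmd.cost]
  · intro x hx hx6
    have hx8 : x ≠ 8 := by omega
    have hx9 : x ≠ 9 := by omega
    simp [Cmd.exec, hx6, hx8, hx9, g0 x (by omega)]
  · simp [Cmd.exec, g6]
  · simp [Cmd.exec]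
  · simp [Cmd.exec]
  · simp [Cmd.exec, ga0]
  · intro k' b hb'
    rw [← gn k' b hb']
    simp [Cmd.exec, St.num]
  · simp [Cmd.exec, g6, g26]
  · simp [Cmd.exec, g6, g27]
  · simp [Cmd.exec, g6, g22]
  · simp [Cmd.exec, g6, g28]
  · intro l hl hl' x hx
    have hx' : x ≠ s.v 6 := by omega
    interval_cases l <;> simp [Cmd.exec, g6, ga, hx']

theorem tri_popCmd {M b : ℕ} {s : St} (hb : s.a 2 (s.v 6 - 1) * s.v 1 + s.a 3 (s.v 6 - 1) = b)
    (hb5 : b < s.v 5) (h5 : s.v 5 ≤ M)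
    (h1 : s.num (s.a 4 (s.v 6 - 1)) b + 1 ≤ M) (h2 : s.num (s.a 0 b) b + 1 ≤ M)
    (hc : s.a 0 b + 1 ≤ M) (hk : s.a 4 (s.v 6 - 1) + 1 ≤ M) (hd : s.v 6 ≤ M) :
    Tri M popCmd s 300 (Popped s) := by
  refine (Tri.seq (K := 10) (K' := 290) (Q := fun s1 =>
    s1 = s.setV 6 (s.v 6 - 1)) (Tri.assign ?_ ?_ ?_) ?_)
  · simp; omega
  · simp
  · simp
  rintro s1 hs1
  have e6 : s1.v 6 = s.v 6 - 1 := by simp [hs1]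
  have ea : s1.a = s.a := by simp [hs1]
  have e1 : s1.v 1 = s.v 1 := by simp [hs1]
  refine (Tri.seq (K := 20) (K' := 270) (Q := fun s2 =>
    s2 = s1.setV 22 (s.a 4 (s.v 6 - 1))) (Tri.assign ?_ ?_ ?_) ?_)
  · simp [e6, ea]; omega
  · simp
  · simp [e6, ea]
  rintro s2 hs2
  have hbox : (boxE (.arr 2 (.var 6)) (.arr 3 (.var 6))).eval s2 = b := by
    simp [boxE, hs2, e6, ea, e1, hb]
  refine (Tri.seq (K := 20) (K' := 250) (Q := fun s3 => s3 = s2.setV 23 b) (Tri.assign ?_ ?_ ?_) ?_)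
  · rw [hbox]; omega
  · simp [boxE]
  · rw [hbox]
  rintro s3 hs3
  -- The count is read before it is raised again, so it is the place to which the push had moved the
  -- vertex.
  refine (Tri.seq (K := 20) (K' := 230) (Q := fun s4 => s4 = s3.setV 24 (s.a 0 b))
    (Tri.assign ?_ ?_ ?_) ?_)
  · simp [hs3, hs2, ea]; omega
  · simp
  · simp [hs3, hs2, ea]
  rintro s4 hs4
  have f5 : s4.v 5 = s.v 5 := by simp [hs4, hs3, hs2, hs1]
  have f22 : s4.v 22 = s.a 4 (s.v 6 - 1) := by simp [hs4, hs3, hs2]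
  have f23 : s4.v 23 = b := by simp [hs4, hs3]
  have f24 : s4.v 24 = s.a 0 b := by simp [hs4]
  have fnum : ∀ k b, s4.num k b = s.num k b := fun k b => by simp [hs4, hs3, hs2, hs1, St.num]
  have fa : s4.a = s.a := by simp [hs4, hs3, hs2, ea]
  refine Tri.seq (K := 100) (K' := 130) ((tri_swapCmd (M := M) (s := s4) ?_ ?_ ?_).frame
    (Q' := fun s5 => (∀ x < 9, x ≠ 6 → s5.v x = s.v x) ∧ s5.v 6 = s.v 6 - 1 ∧
      s5.v 22 = s.a 4 (s.v 6 - 1) ∧ s5.v 23 = b ∧ s5.v 24 = s.a 0 b ∧ s5.a 0 = s.a 0 ∧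
      (∀ l, 2 ≤ l → s5.a l = s.a l) ∧ ∀ k' c, c < s.v 5 → s5.num k' c =
        s.num (if c = b then Equiv.swap (s.a 4 (s.v 6 - 1)) (s.a 0 b) k' else k') c)
    ?_) ?_
  · rw [f23, f5]; omega
  · rw [f23, fnum, f22]; exact h1
  · rw [f23, fnum, f24]; exact h2
  · rintro s5 ⟨g1, g2⟩ hv ha _ _
    refine ⟨fun x hx hx6 => ?_, ?_, ?_, ?_, ?_, ?_, ?_, ?_⟩
    · rw [hv x (by simp only [swapCmd, Cmd.vars, List.mem_append, List.mem_singleton]; simp; omega)]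
      rw [hs4, hs3, hs2, hs1, St.setV_of_ne _ _ (by omega), St.setV_of_ne _ _ (by omega),
        St.setV_of_ne _ _ (by omega), St.setV_of_ne _ _ (by omega)]
    · rw [hv 6 (by decide)]; simp [hs4, hs3, hs2, hs1]
    · rw [hv 22 (by decide), f22]
    · rw [hv 23 (by decide), f23]
    · rw [hv 24 (by decide), f24]
    · rw [ha 0 (by decide), fa]
    · intro l hl
      rw [ha l (by simp [swapCmd, Cmd.arrs]; omega), fa]
    · intro k' c hc'
      rw [g2 k' c (by rwa [f5]), fnum, f22, f23, f24]
  rintro s5 ⟨g0, g6, g22, g23, g24, ga0, ga, gn⟩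
  have h8 : ((Cmd.seq (.store 0 (.var 23) (.add (.var 24) (.num 1)))
      (.seq (.assign 8 (.var 23)) (.assign 9 (.add (.var 22) (.num 1))))).exec s5).v 8 = b := by
    simp [Cmd.exec, g23]
  refine ⟨?_, ?_, ?_, ?_, ?_, ?_, ?_, ?_, ?_⟩
  · simp [Cmd.ok, Cmd.exec, g22, g23, g24, hc, hk]; omega
  · simp [Cmd.cost]
  · intro x hx hx6
    have hx8 : x ≠ 8 := by omega
    have hx9 : x ≠ 9 := by omega
    simp [Cmd.exec, hx8, hx9, g0 x (by omega) hx6]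
  · simp [Cmd.exec, g6]
  · rw [h8, hb]
  · simp [Cmd.exec, g22]
  · rw [h8]; simp [Cmd.exec, g23, g24, ga0]
  · intro k' c hc'
    rw [h8, ← gn k' c hc']
    simp [Cmd.exec, St.num]
  · intro l hl hl' x _
    have : l ≠ 0 := by omega
    simp [Cmd.exec, this, ga l hl]

end SkewGen

/-! ### Code for finding the next extension and for one round -/

namespace SkewGen

/-- The value is positive if the box in row `18` and column `19` allows an extension behind the
current position. -/
def candE : Ex :=
  .mul (.arr 12 (boxE (.var 18) (.var 19)))
    (.add (.pos (.sub (boxE (.var 18) (.var 19)) (.var 8)))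
      (.mul (.eq (boxE (.var 18) (.var 19)) (.var 8))
        (.pos (.sub (.arr 0 (boxE (.var 18) (.var 19))) (.var 9)))))

/-- In the current box the search resumes at the current place; in every later box it starts at
place 0. -/
def recordCmd : Cmd :=
  .seq (.assign 26 (.var 18)) (.seq (.assign 27 (.var 19)) (.seq (.assign 23 (boxE (.var 18) (.var 19)))
    (.seq (.assign 22 (.mul (.eq (.var 23) (.var 8)) (.var 9))) (.assign 17 (.num 1)))))

/-- Look for the first position that allows an extension. -/
def scanCmd : Cmd :=
  .seq (.assign 17 (.num 0)) (.loop 18 (.var 0) (.loop 19 (.var 1)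
    (.ite (.mul (.not (.var 17)) candE) recordCmd (.assign 17 (.var 17)))))

/-- Print the path. -/
def printCmd : Cmd :=
  .loop 20 (.var 7) (.seq (.print (.arr 2 (.var 20))) (.seq (.print (.arr 3 (.var 20)))
    (.print (.arr 5 (.var 20)))))

/-- The arrays 2, 3, 4 and 5 are the stack of the path: row, column, place at the time of the push,
and number within the box. Its top tells which row and column the next vertex has to avoid. -/
def searchCmd : Cmd :=
  .seq (.assign 10 (.arr 2 (.sub (.var 6) (.num 1)))) (.seq (.assign 11 (.arr 3 (.sub (.var 6) (.num 1))))
    (.seq goodCmd scanCmd))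

/-- One round of the search. -/
def bodyCmd : Cmd :=
  .ite (.sub (.var 7) (.var 6)) (.seq searchCmd (.ite (.var 17) pushCmd popCmd))
    (.seq printCmd popCmd)

/-- The box with index `y` allows an extension behind the current position. -/
def Cand (s : St) (y : ℕ) : Prop := 0 < s.a 12 y ∧ (s.v 8 < y ∨ s.v 8 = y ∧ s.v 9 < s.a 0 y)

/-- The result of the scan in the state `s`, when the boxes below `x` have been seen. -/
def Scanned (p q : ℕ) (s : St) (x : ℕ) (s' : St) : Prop :=
  (s'.v 17 = 0 ∧ ∀ y < x, ¬ Cand s y) ∨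
  (s'.v 17 = 1 ∧ ∃ i < p, ∃ j < q, Cand s (i * q + j) ∧ (∀ y < i * q + j, ¬ Cand s y) ∧
    s'.v 26 = i ∧ s'.v 27 = j ∧ s'.v 23 = i * q + j ∧
    s'.v 22 = if i * q + j = s.v 8 then s.v 9 else 0)

theorem Scanned.congr {p q x : ℕ} {s s1 s2 : St} (h : Scanned p q s x s1)
    (hv : ∀ y, y ≠ 18 → y ≠ 19 → s2.v y = s1.v y) : Scanned p q s x s2 := by
  unfold Scanned
  rwa [hv 17 (by decide) (by decide), hv 26 (by decide) (by decide), hv 27 (by decide) (by decide),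
    hv 23 (by decide) (by decide), hv 22 (by decide) (by decide)]

/-- The scan always runs through all boxes; once variable 17 is set, later candidates are ignored,
so the first one is kept. -/
theorem tri_scanCmd {M p q : ℕ} {s : St} (hp : s.v 0 = p) (hq : s.v 1 = q) (hpM : p + 1 ≤ M)
    (hqM : q + 1 ≤ M) (hpq : p * q ≤ M) (h9 : s.v 9 ≤ M) :
    Tri M scanCmd s (20 + p * (4 + q * (150 + 5) + 5)) (Scanned p q s (p * q)) := by
  refine (Tri.seq (K := 2) (K' := 4 + p * (4 + q * (150 + 5) + 5)) (Q := fun s1 =>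
    s1 = s.setV 17 0) (Tri.assign (by simp) (by simp) (by simp)) ?_).mono (by omega) fun _ h => h
  rintro s1 hs1
  refine (Tri.loop₂ (x := 18) (y := 19) (a := 0) (b := 1) (p := p) (q := q) (fun x s' =>
    Scanned p q s x s' ∧ (∀ x < 10, s'.v x = s.v x) ∧ s'.a = s.a) (by decide) (by decide)
    (by simp [hs1, hp]) (by omega) (by omega) ?_ ?_ ?_ (by decide) ?_).mono le_rfl fun _ h => h.1
  · rintro i s' ⟨-, h, -⟩
    exact ⟨(h 0 (by decide)).trans hp, (h 1 (by decide)).trans hq⟩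
  · rintro i s' ⟨h1, h2, h3⟩ k
    refine ⟨⟨h1.congr fun y hy _ => by simp [hy], fun x hx => ?_, h3⟩,
      ⟨h1.congr fun y _ hy => by simp [hy], fun x hx => ?_, h3⟩⟩
    all_goals rw [St.setV_of_ne _ _ (by omega), h2 x hx]
  · refine ⟨Or.inl ⟨by simp [hs1], fun y hy => by omega⟩, fun x hx => ?_, by simp [hs1]⟩
    rw [hs1, St.setV_of_ne _ _ (by omega)]
  rintro i hi j hj s' ⟨h1, h2, h3⟩ h18 h19
  have hbox : (boxE (.var 18) (.var 19)).eval s' = i * q + j := by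
    simp [boxE, h18, h19, h2, hq]
  have hboxlt : i * q + j < p * q := by
    calc i * q + j < i * q + q := by omega
      _ = (i + 1) * q := by ring
      _ ≤ p * q := Nat.mul_le_mul_right _ hi
  have hcand : 0 < candE.eval s' ↔ Cand s (i * q + j) := by
    simp only [candE, Ex.eval_mul, Ex.eval_arr, Ex.eval_add, Ex.eval_pos, Ex.eval_sub, Ex.eval_eq,
      hbox, Ex.eval_var, h3, h2 8 (by decide), h2 9 (by decide), Cand,
      Nat.pos_iff_ne_zero, mul_ne_zero_iff]
    -- A later box needs no comparison of places: it is taken up at place 0, and its mark implies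
    -- that it is nonempty.
    split_ifs with hb <;> omega
  refine Tri.ite (K := 60) (fun hpos => ?_) (fun hpos => ?_) ?_
  · have h17 : s'.v 17 = 0 := by
      by_contra hc
      have : (Ex.not (.var 17)).eval s' = 0 := by simp; omega
      rw [Ex.eval_mul, this, zero_mul] at hpos
      exact lt_irrefl _ hpos
    have hc : Cand s (i * q + j) := by
      rw [← hcand]
      rw [Ex.eval_mul] at hpos
      exact Nat.pos_of_ne_zero fun h => by simp [h] at hpos
    have hno : ∀ y < i * q + j, ¬ Cand s y := by
      rcases h1 with h1 | h1
      · exact h1.2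
      · omega
    have hw : (if i * q + j = s.v 8 then s.v 9 else 0) ≤ M := by split_ifs <;> omega
    have hb' : ((boxE (Ex.var 18) (Ex.var 19)).eval ((s'.setV 26 i).setV 27 j)) = i * q + j := by
      simp [boxE, h18, h19, h2, hq]
    have e8 := h2 8 (by decide)
    have e9 := h2 9 (by decide)
    refine ⟨?_, ?_, ?_, ?_, ?_⟩
    · simp [recordCmd, Cmd.ok, Cmd.exec, h18, h19, hb', e8, e9]
      omega
    · simp [recordCmd, Cmd.cost, boxE]
    · refine Or.inr ⟨by simp [recordCmd, Cmd.exec], i, hi, j, hj, hc, hno, ?_, ?_, ?_, ?_⟩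
      · simp [recordCmd, Cmd.exec, h18]
      · simp [recordCmd, Cmd.exec, h19]
      · simp [recordCmd, Cmd.exec, h18, h19, hb']
      · simp [recordCmd, Cmd.exec, h18, h19, hb', e8, e9]
    · intro x hx
      rw [Cmd.exec_v _ _ (by simp [recordCmd, Cmd.vars]; omega), h2 x hx]
    · simp [recordCmd, Cmd.exec, h3]
  · have hle : s'.v 17 ≤ 1 := by rcases h1 with h1 | h1 <;> omega
    refine ⟨by simp [Cmd.ok]; omega, by simp [Cmd.cost], ?_, ?_, ?_⟩
    · simp only [Cmd.exec, Ex.eval_var]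
      rcases h1 with h1 | h1
      · refine Or.inl ⟨by simp [h1.1], fun y hy => ?_⟩
        rcases Nat.lt_succ_iff_lt_or_eq.1 hy with hy | rfl
        · exact h1.2 y hy
        · rw [← hcand]
          intro h
          apply hpos
          simpa [h1.1] using h
      · refine Or.inr ⟨by simp [h1.1], ?_⟩
        simpa using h1.2
    · intro x hx
      simp only [Cmd.exec]
      rw [St.setV_of_ne _ _ (by omega), h2 x hx]
    · simp [Cmd.exec, h3]
  · simp [candE, boxE]

theorem tri_printCmd {p q M : ℕ} {T : Fin p → Fin q → ℕ} {l : List (Vertex T)} {s : St}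
    (h7 : s.v 7 = l.length) (hM : l.length ≤ M)
    (hst : ∀ x (h : x < l.length), s.a 2 x = l[x].1.1 ∧ s.a 3 x = l[x].1.2 ∧ s.a 5 x = l[x].2) :
    Tri M printCmd s (4 + l.length * 40) fun s' => s'.out = s.out ++ encodePath l := by
  refine (Tri.loop (M := M) (K := 35) (fun x s' => s'.a = s.a ∧
    s'.out = s.out ++ encodePath (l.take x)) (by simpa [h7]) ⟨rfl, by simp [encodePath]⟩ ?_).mono
    (by simp [h7]) fun s' h => ?_
  · rintro x hx s' ⟨h1, h2⟩
    have hx' : x < l.length := by simpa [h7] using hx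
    obtain ⟨g2, g3, g5⟩ := hst x hx'
    refine ⟨by simp [Cmd.ok], by simp [Cmd.cost], by simp [Cmd.exec, h1], ?_⟩
    rw [← List.take_append_getElem hx', encodePath, List.flatMap_append, ← encodePath,
      ← List.append_assoc, ← h2]
    simp [Cmd.exec, h1, g2, g3, g5]
  · simpa [h7] using h.2

end SkewGen

namespace SkewGen

/-! ### The invariant that relates program states to partial paths -/

section Invariant

variable {p q : ℕ} {T : Fin p → Fin q → ℕ}

theorem Vertex.ext_val {w w' : Vertex T} (h : w.1 = w'.1) (h' : (w.2 : ℕ) = w'.2) : w = w' := by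
  obtain ⟨b, x⟩ := w
  obtain ⟨b', x'⟩ := w'
  obtain rfl : b = b' := h
  rw [Fin.ext (show (x : ℕ) = x' from h')]

theorem box_lt (i : Fin p) (j : Fin q) : (i : ℕ) * q + j < p * q :=
  calc (i : ℕ) * q + j < i * q + q := by omega
    _ = (i + 1) * q := by ring
    _ ≤ p * q := Nat.mul_le_mul_right _ i.2

theorem box_inj {i i' : Fin p} {j j' : Fin q} :
    (i : ℕ) * q + j = i' * q + j' ↔ i = i' ∧ j = j' := by
  refine ⟨fun h => ?_, by rintro ⟨rfl, rfl⟩; rfl⟩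
  have := mul_add_inj j.2 j'.2 h
  exact ⟨Fin.ext this.1, Fin.ext this.2⟩

/-- What a list of vertices leaves of the table. -/
def rest (l : List (Vertex T)) : Fin p → Fin q → ℕ := fun i j => T i j - boxTable l i j

/-- Any repetition-free list can be completed by the unused vertices in some order. This identifies
the table of what is left with the table of an actual list. -/
theorem exists_completion (l : List (Vertex T)) (h : l.Nodup) :
    ∃ r, (l ++ r).Nodup ∧ ∀ x, x ∈ l ++ r := by
  refine ⟨(Finset.univ \ l.toFinset).toList, ?_, fun x => ?_⟩
  · rw [List.nodup_append']
    refine ⟨h, Finset.nodup_toList _, fun x hx hx' => ?_⟩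
    simp at hx'
    exact hx' hx
  · by_cases hx : x ∈ l <;> simp [hx]

theorem rest_eq_boxTable {l r : List (Vertex T)} (h : (l ++ r).Nodup) (h' : ∀ x, x ∈ l ++ r) :
    rest l = boxTable r := by
  funext i j
  have := boxTable_of_complete _ h h' i j
  rw [boxTable_append] at this
  unfold rest
  omega

theorem length_eq_card {l : List (Vertex T)} (h : l.Nodup) (h' : ∀ x, x ∈ l) :
    l.length = Fintype.card (Vertex T) := by
  rw [← List.toFinset_card_of_nodup h, ← Finset.card_univ]
  congr 1
  ext x; simp [h']

theorem mem_of_length_eq_card {l : List (Vertex T)} (h : l.Nodup)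
    (h' : l.length = Fintype.card (Vertex T)) (x : Vertex T) : x ∈ l := by
  have := Finset.eq_univ_of_card l.toFinset ((List.toFinset_card_of_nodup h).trans h')
  rw [← List.mem_toFinset, this]
  exact Finset.mem_univ x

theorem boxTable_le {l : List (Vertex T)} (h : l.Nodup) (i : Fin p) (j : Fin q) :
    boxTable l i j ≤ T i j := by
  obtain ⟨r, hr, hr'⟩ := exists_completion l h
  have := boxTable_of_complete _ hr hr' i j
  rw [boxTable_append] at this
  omega

theorem total_rest {l : List (Vertex T)} (h : l.Nodup) :
    total (rest l) + l.length = Fintype.card (Vertex T) := by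
  obtain ⟨r, hr, hr'⟩ := exists_completion l h
  rw [rest_eq_boxTable hr hr', total_boxTable, ← length_eq_card hr hr', List.length_append]
  omega

theorem boxTable_concat (l : List (Vertex T)) (w : Vertex T) (i : Fin p) (j : Fin q) :
    boxTable (l ++ [w]) i j = boxTable l i j + if i = w.1.1 ∧ j = w.1.2 then 1 else 0 := by
  rw [boxTable_append]
  simp [boxTable, addOne]

theorem rest_eq_addOne {l : List (Vertex T)} {w : Vertex T} (h : (l ++ [w]).Nodup) :
    rest l = addOne (rest (l ++ [w])) w.1.1 w.1.2 := by
  funext i j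
  have := boxTable_le h i j
  have e := boxTable_concat l w i j
  simp only [rest, addOne]
  omega

/-- The state `s` represents the path `l`. -/
structure Inv (l : List (Vertex T)) (s : St) : Prop where
  hp : s.v 0 = p
  hq : s.v 1 = q
  base : s.v 5 = p * q
  card : s.v 7 = Fintype.card (Vertex T)
  depth : s.v 6 = l.length
  chain : l.IsChain (skewGraph T).Adj
  nodup : l.Nodup
  count : ∀ (i : Fin p) (j : Fin q), s.a 0 (i * q + j) = rest l i j
  stack : ∀ x (h : x < l.length), s.a 2 x = l[x].1.1 ∧ s.a 3 x = l[x].1.2 ∧ s.a 5 x = l[x].2 ∧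
    s.a 4 x < T l[x].1.1 l[x].1.2
  num_lt : ∀ (i : Fin p) (j : Fin q) k, k < T i j → s.num k (i * q + j) < T i j
  num_inj : ∀ (i : Fin p) (j : Fin q) k k', k < T i j → k' < T i j →
    s.num k (i * q + j) = s.num k' (i * q + j) → k = k'
  used : ∀ (i : Fin p) (j : Fin q) k, k < T i j →
    ((∃ w ∈ l, w.1 = (i, j) ∧ (w.2 : ℕ) = s.num k (i * q + j)) ↔ rest l i j ≤ k)

theorem Inv.env {l : List (Vertex T)} {s : St} (h : Inv l s) : Env (rest l) s :=
  ⟨h.hp, h.hq, h.count⟩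

theorem Inv.same {l : List (Vertex T)} {s s' : St} (h : Inv l s) (h' : Same s s') : Inv l s' := by
  have hn : ∀ (i : Fin p) (j : Fin q) k, s'.num k (i * q + j) = s.num k (i * q + j) :=
    fun i j k => h'.num k _ (by rw [h.base]; exact box_lt i j)
  refine ⟨(h'.fix 0 (by decide)).trans h.hp, (h'.fix 1 (by decide)).trans h.hq,
    (h'.fix 5 (by decide)).trans h.base, (h'.fix 7 (by decide)).trans h.card,
    (h'.fix 6 (by decide)).trans h.depth, h.chain, h.nodup, ?_, ?_, ?_, ?_, ?_⟩
  · rw [h'.count]; exact h.count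
  · intro x hx
    have hx' : x < s.v 6 := by rw [h.depth]; exact hx
    rw [h'.stack 2 (by decide) (by decide) x hx', h'.stack 3 (by decide) (by decide) x hx',
      h'.stack 5 (by decide) (by decide) x hx', h'.stack 4 (by decide) (by decide) x hx']
    exact h.stack x hx
  · simp only [hn]; exact h.num_lt
  · simp only [hn]; exact h.num_inj
  · simp only [hn]; exact h.used

/-- In each box the unused vertices occupy the places below the remaining count, the used ones the
places from there on. A push moves the chosen vertex to the last unused place and lowers the count,
so exactly this place changes sides. -/
theorem Inv.push {l : List (Vertex T)} {s s' : St} (h : Inv l s) {w : Vertex T} {k : ℕ}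
    (hk : k < rest l w.1.1 w.1.2) (hw : (w.2 : ℕ) = s.num k (w.1.1 * q + w.1.2))
    (hch : (l ++ [w]).IsChain (skewGraph T).Adj) (h' : Pushed w.1.1 w.1.2 k s s') :
    Inv (l ++ [w]) s' := by
  have hle : rest l w.1.1 w.1.2 ≤ T w.1.1 w.1.2 := Nat.sub_le _ _
  -- The chosen place is below the remaining count, so its vertex has not been used.
  have hwl : w ∉ l := fun hm =>
    absurd ((h.used w.1.1 w.1.2 k (by omega)).1 ⟨w, hm, rfl, hw⟩) (by omega)
  have hnd : (l ++ [w]).Nodup := by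
    rw [List.nodup_append']
    refine ⟨h.nodup, by simp, fun x hx hx' => ?_⟩
    rw [List.mem_singleton] at hx'
    exact hwl (hx' ▸ hx)
  have hrest : ∀ i j, rest l i j = rest (l ++ [w]) i j + if i = w.1.1 ∧ j = w.1.2 then 1 else 0 :=
    fun i j => congrFun (congrFun (rest_eq_addOne hnd) i) j
  have hn : ∀ (i : Fin p) (j : Fin q) k', s'.num k' (i * q + j) =
      s.num (if i = w.1.1 ∧ j = w.1.2 then Equiv.swap k (rest l w.1.1 w.1.2 - 1) k' else k')
        (i * q + j) := fun i j k' => by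
    rw [h'.num k' _ (by rw [h.base]; exact box_lt i j), h.hq, h.count]
    simp only [box_inj]
  have hsw : ∀ (i : Fin p) (j : Fin q) k', k' < T i j →
      (if i = w.1.1 ∧ j = w.1.2 then Equiv.swap k (rest l w.1.1 w.1.2 - 1) k' else k') < T i j := by
    intro i j k' hk'
    split_ifs with hij
    · obtain ⟨rfl, rfl⟩ := hij
      rw [Equiv.swap_apply_def]
      split_ifs <;> omega
    · exact hk'
  refine ⟨(h'.fix 0 (by decide) (by decide)).trans h.hp, (h'.fix 1 (by decide) (by decide)).trans h.hq,
    (h'.fix 5 (by decide) (by decide)).trans h.base, (h'.fix 7 (by decide) (by decide)).trans h.card,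
    ?_, hch, hnd, ?_, ?_, ?_, ?_, ?_⟩
  · rw [h'.depth, h.depth]; simp
  · intro i j
    have := hrest i j
    rw [h'.count, h.hq, Function.update_apply]
    simp only [box_inj, h.count]
    split_ifs with hij
    · rw [if_pos hij] at this
      obtain ⟨rfl, rfl⟩ := hij
      omega
    · rw [if_neg hij] at this
      omega
  · intro x hx
    by_cases hxl : x = l.length
    · subst hxl
      have e : (l ++ [w])[l.length]'hx = w := by simp
      rw [e, ← h.depth, h'.row, h'.col, h'.index, h'.number, h.hq]
      exact ⟨rfl, rfl, hw.symm, by omega⟩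
    · have hx' : x < l.length := by simp at hx; omega
      have hx6 : x < s.v 6 := by rw [h.depth]; exact hx'
      rw [List.getElem_append_left hx', h'.stack 2 (by decide) (by decide) x hx6,
        h'.stack 3 (by decide) (by decide) x hx6, h'.stack 4 (by decide) (by decide) x hx6,
        h'.stack 5 (by decide) (by decide) x hx6]
      exact h.stack x hx'
  · intro i j k' hk'
    rw [hn]
    exact h.num_lt i j _ (hsw i j k' hk')
  · intro i j k1 k2 h1 h2 he
    rw [hn, hn] at he
    have := h.num_inj i j _ _ (hsw i j k1 h1) (hsw i j k2 h2) he
    split_ifs at this with hij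
    · exact (Equiv.swap k _).injective this
    · exact this
  · intro i j k' hk'
    have hu := h.used i j _ (hsw i j k' hk')
    have hr := hrest i j
    rw [hn]
    have hex : (∃ w' ∈ l ++ [w], w'.1 = (i, j) ∧ (w'.2 : ℕ) = s.num
        (if i = w.1.1 ∧ j = w.1.2 then Equiv.swap k (rest l w.1.1 w.1.2 - 1) k' else k')
          (i * q + j)) ↔ (∃ w' ∈ l, w'.1 = (i, j) ∧ (w'.2 : ℕ) = s.num
        (if i = w.1.1 ∧ j = w.1.2 then Equiv.swap k (rest l w.1.1 w.1.2 - 1) k' else k')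
          (i * q + j)) ∨ (w.1 = (i, j) ∧ (w.2 : ℕ) = s.num
        (if i = w.1.1 ∧ j = w.1.2 then Equiv.swap k (rest l w.1.1 w.1.2 - 1) k' else k')
          (i * q + j)) := by
      simp only [List.mem_append, List.mem_singleton, or_and_right, exists_or, exists_eq_left]
    rw [hex, hu]
    by_cases hij : i = w.1.1 ∧ j = w.1.2
    · rw [if_pos hij] at hr ⊢
      obtain ⟨rfl, rfl⟩ := hij
      have : (w.1 = (w.1.1, w.1.2) ∧ (w.2 : ℕ) = s.num
          (Equiv.swap k (rest l w.1.1 w.1.2 - 1) k') (w.1.1 * q + w.1.2)) ↔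
          -- After the exchange the new vertex sits exactly at the last formerly unused place;
          -- injectivity of the numbering excludes all other places.
          k' = rest l w.1.1 w.1.2 - 1 := by
        refine ⟨fun hx => ?_, fun hx => ⟨rfl, ?_⟩⟩
        · have hy := h.num_inj _ _ k _ (by omega) (by simpa using hsw w.1.1 w.1.2 k' hk')
            (hw.symm.trans hx.2)
          have hz := congrArg (Equiv.swap k (rest l w.1.1 w.1.2 - 1)) hy
          rw [Equiv.swap_apply_self, Equiv.swap_apply_left] at hz
          exact hz.symm
        · rw [hx, Equiv.swap_apply_right]; exact hw
      rw [this, Equiv.swap_apply_def]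
      split_ifs <;> omega
    · rw [if_neg hij] at hr ⊢
      have : ¬ (w.1 = (i, j) ∧ (w.2 : ℕ) = s.num k' (i * q + j)) := fun hx =>
        hij (by rw [hx.1]; exact ⟨rfl, rfl⟩)
      rw [or_iff_left this]
      omega

end Invariant

end SkewGen

namespace SkewGen

/-! ### The effect and the cost of one round -/

section Body

variable {p q : ℕ} {T : Fin p → Fin q → ℕ}

/-- `M` is large compared with the table. -/
structure Big (T : Fin p → Fin q → ℕ) (M : ℕ) : Prop where
  rows : p + 1 ≤ M
  cols : q + 1 ≤ M
  boxes : p * q ≤ M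
  verts : Fintype.card (Vertex T) + 1 ≤ M
  viol : p * Fintype.card (Vertex T) + q * Fintype.card (Vertex T) +
    p * (q * (Fintype.card (Vertex T) + 1)) ≤ M

theorem total_eq_card : total T = Fintype.card (Vertex T) := by
  have := total_rest (T := T) (l := []) List.nodup_nil
  have e : rest ([] : List (Vertex T)) = T := by funext i j; simp [rest, boxTable]
  rw [e] at this
  exact this

theorem entry_le_card (i : Fin p) (j : Fin q) : T i j ≤ Fintype.card (Vertex T) := by
  rw [← total_eq_card]
  exact (entry_le_rowSum T i j).trans (rowSum_le_total T i)

theorem Inv.length_le {l : List (Vertex T)} {s : St} (h : Inv l s) :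
    l.length ≤ Fintype.card (Vertex T) := h.nodup.length_le_card

theorem same_of_eq {s s' : St} (hv : ∀ x < 8, s'.v x = s.v x) (ha : ∀ k < 6, s'.a k = s.a k) :
    Same s s' :=
  ⟨hv, ha 0 (by decide), fun k b _ => by
    unfold St.num; rw [hv 5 (by decide), ha 1 (by decide)],
    fun l _ hl x _ => by rw [ha l (by omega)]⟩

theorem Inv.top {l : List (Vertex T)} {u : Vertex T} {s : St} (h : Inv (l ++ [u]) s) :
    s.a 2 (s.v 6 - 1) = u.1.1 ∧ s.a 3 (s.v 6 - 1) = u.1.2 ∧ s.a 4 (s.v 6 - 1) < T u.1.1 u.1.2 := by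
  have hd : s.v 6 - 1 = l.length := by rw [h.depth]; simp
  obtain ⟨h2, h3, -, h4⟩ := h.stack l.length (by simp)
  have e : (l ++ [u])[l.length]'(by simp) = u := by simp
  rw [e] at h2 h3 h4
  rw [hd]
  exact ⟨h2, h3, h4⟩

theorem Inv.tri_popCmd {M : ℕ} {l : List (Vertex T)} {u : Vertex T} {s : St}
    (h : Inv (l ++ [u]) s) (hM : Big T M) : Tri M popCmd s 300 (Popped s) := by
  obtain ⟨h2, h3, h4⟩ := h.top
  have hc := entry_le_card (T := T) u.1.1 u.1.2
  -- The last vertex is used, so its box has at least one used place; hence the place the pop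
  -- exchanges with is within range.
  have hr : rest (l ++ [u]) u.1.1 u.1.2 < T u.1.1 u.1.2 := by
    have h1 := boxTable_le h.nodup u.1.1 u.1.2
    have h2 := boxTable_concat l u u.1.1 u.1.2
    rw [if_pos ⟨rfl, rfl⟩] at h2
    unfold rest; omega
  have hv := hM.verts
  have hd := h.length_le
  refine SkewGen.tri_popCmd (b := u.1.1 * q + u.1.2) (by rw [h2, h3, h.hq])
    (by rw [h.base]; exact box_lt _ _) (by rw [h.base]; exact hM.boxes) ?_ ?_ ?_ (by omega)
    (by rw [h.depth]; omega)
  · have := h.num_lt _ _ _ h4; omega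
  · rw [h.count]
    have := h.num_lt _ _ _ hr; omega
  · rw [h.count]; omega

theorem Inv.tri_print {M : ℕ} {l : List (Vertex T)} {u : Vertex T} {s : St}
    (h : Inv (l ++ [u]) s) (hM : Big T M) (hl : (l ++ [u]).length = Fintype.card (Vertex T)) :
    Tri M bodyCmd s (400 + 40 * Fintype.card (Vertex T))
      fun s' => Popped s s' ∧ s'.out = s.out ++ encodePath (l ++ [u]) := by
  have h7 := h.card
  have h6 := h.depth
  have hv := hM.verts
  refine Tri.ite (K := 4 + (l ++ [u]).length * 40 + 300) (fun hpos => ?_) (fun _ => ?_) ?_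
  · exfalso
    simp only [Ex.eval_sub, Ex.eval_var] at hpos
    omega
  · refine Tri.seq ((tri_printCmd (h7.trans hl.symm) (by omega) fun x hx => ?_).frame
      fun s1 h1 hv ha _ _ => (⟨h1, same_of_eq (fun x hx => hv x ?_) fun k _ => ha k (by simp
        [printCmd, Cmd.arrs])⟩ : s1.out = s.out ++ encodePath (l ++ [u]) ∧ Same s s1)) ?_
    · obtain ⟨h2, h3, h5, -⟩ := h.stack x hx
      exact ⟨h2, h3, h5⟩
    · simp [printCmd, Cmd.vars]; omega
    · rintro s1 ⟨ho, hs⟩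
      refine ((h.same hs).tri_popCmd hM).frame fun s2 h2 _ _ _ hs2 => ⟨hs.popped h2 (by
        rw [h6]; simp), (hs2 ?_).trans ho⟩
      simp [popCmd, swapCmd, Cmd.silent]
  · rw [hl]; simp only [Ex.cost_sub, Ex.cost_var]; omega

theorem Same.pushed {i j k : ℕ} {s s' s'' : St} (h : Same s s') (h' : Pushed i j k s' s'')
    (hb : i * s.v 1 + j < s.v 5) : Pushed i j k s s'' := by
  have h1 := h.fix 1 (by decide)
  have h5 := h.fix 5 (by decide)
  have h6 := h.fix 6 (by decide)
  refine ⟨fun x hx hx6 => (h'.fix x hx hx6).trans (h.fix x hx), ?_, h'.box, h'.place, ?_, ?_, ?_, ?_,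
    ?_, ?_, ?_⟩
  · rw [h'.depth, h6]
  · rw [h'.count, h1, h.count]
  · intro k' b hb
    rw [h'.num k' b (by rwa [h5]), h.num _ b hb, h1, h.count]
  · rw [← h6]; exact h'.row
  · rw [← h6]; exact h'.col
  · rw [← h6]; exact h'.index
  · rw [← h6, h'.number, h1, h.num _ _ hb]
  · intro l hl hl' x hx
    rw [h'.stack l hl hl' x (by omega), h.stack l hl hl' x hx]

/-- The box in row `i` and column `j` contains a good extension of a path that ends in `u`, at a
position not before the place `m` of the box with index `β`. -/
def Ext (t : Fin p → Fin q → ℕ) (u : Fin p × Fin q) (β m : ℕ) (i : Fin p) (j : Fin q) : Prop :=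
  Good t i j ∧ i ≠ u.1 ∧ j ≠ u.2 ∧ (β < i * q + j ∨ β = i * q + j ∧ m < t i j)

/-- The result of the search for an extension. -/
def Searched (t : Fin p → Fin q → ℕ) (u : Fin p × Fin q) (β m : ℕ) (s' : St) : Prop :=
  (s'.v 17 = 0 ∧ ∀ i j, ¬ Ext t u β m i j) ∨
  (s'.v 17 = 1 ∧ ∃ (i : Fin p) (j : Fin q), Ext t u β m i j ∧
    (∀ i' j', Ext t u β m i' j' → (i : ℕ) * q + j ≤ i' * q + j') ∧
    s'.v 26 = i ∧ s'.v 27 = j ∧ s'.v 23 = i * q + j ∧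
    s'.v 22 = if i * q + j = β then m else 0)

theorem Inv.tri_searchCmd {M : ℕ} {l : List (Vertex T)} {u : Vertex T} {s : St}
    (h : Inv (l ++ [u]) s) (hM : Big T M) (h9 : s.v 9 ≤ M) :
    Tri M searchCmd s (1200 * (p * q) + 500 * p + 500 * q + 500) fun s' =>
      Searched (rest (l ++ [u])) u.1 (s.v 8) (s.v 9) s' ∧ Same s s' := by
  obtain ⟨h2, h3, -⟩ := h.top
  have hp := hM.rows
  have hq := hM.cols
  have hu1 := u.1.1.2
  have hu2 := u.1.2.2
  have htot : total (rest (l ++ [u])) ≤ Fintype.card (Vertex T) := by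
    have := total_rest h.nodup; omega
  have hviol : violations (rest (l ++ [u])) ≤ M := by
    refine (violations_le _).trans (le_trans ?_ hM.viol)
    gcongr
  refine (Tri.seq (K := 20) (K' := 20 + ((1000 * (p * q) + 400 * p + 400 * q + 400) +
    (20 + p * (4 + q * (150 + 5) + 5)))) (Q := fun s1 => s1 = s.setV 10 u.1.1)
    (Tri.assign ?_ ?_ ?_) ?_).mono (by linarith [Nat.zero_le (p * q)]) fun _ h => h
  · simp [h2]; omega
  · simp
  · simp [h2]
  rintro s1 hs1
  refine Tri.seq (K := 20) (Q := fun s2 => s2 = s1.setV 11 u.1.2) (Tri.assign ?_ ?_ ?_) ?_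
  · simp [hs1, h3]; omega
  · simp
  · simp [hs1, h3]
  rintro s2 hs2
  have hv2 : ∀ x < 10, s2.v x = s.v x := fun x hx => by
    rw [hs2, hs1, St.setV_of_ne _ _ (by omega), St.setV_of_ne _ _ (by omega)]
  have ha2 : s2.a = s.a := by simp [hs2, hs1]
  have e10 : s2.v 10 = u.1.1 := by simp [hs2, hs1]
  have e11 : s2.v 11 = u.1.2 := by simp [hs2]
  have henv : Env (rest (l ++ [u])) s2 :=
    h.env.congr (hv2 0 (by decide)) (hv2 1 (by decide)) (by rw [ha2])
  refine Tri.seq ((tri_goodCmd henv hp hq hM.boxes (by have := hM.verts; omega) hviol).frame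
    fun s3 h3 hv ha _ _ => (⟨h3, fun x hx => (hv x ?_).trans (hv2 x hx), fun k hk => (ha k ?_).trans
      (by rw [ha2])⟩ : (∀ (i : Fin p) (j : Fin q), s3.a 12 (i * q + j) =
        mark (rest (l ++ [u])) (s2.v 10) (s2.v 11) i j) ∧ (∀ x < 10, s3.v x = s.v x) ∧
        ∀ k < 6, s3.a k = s.a k)) ?_
  · simp [goodCmd, sumsCmd, countsCmd, creditsCmd, fillCmd, Cmd.vars]; omega
  · simp [goodCmd, sumsCmd, countsCmd, creditsCmd, fillCmd, Cmd.arrs]; omega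
  rintro s3 ⟨hm, hv3, ha3⟩
  refine (tri_scanCmd ((hv3 0 (by decide)).trans h.hp) ((hv3 1 (by decide)).trans h.hq) hp hq
    hM.boxes (by rw [hv3 9 (by decide)]; exact h9)).frame fun s4 h4 hv ha _ _ => ⟨?_, ?_⟩
  -- On the marked state a candidate box is exactly an extension behind the current position, so the
  -- first hit of the scan is the first extension.
  · have hcand : ∀ (i : Fin p) (j : Fin q), Cand s3 (i * q + j) ↔
        Ext (rest (l ++ [u])) u.1 (s.v 8) (s.v 9) i j := fun i j => by
      unfold Cand Ext
      rw [hm, mark_pos, e10, e11, hv3 8 (by decide), hv3 9 (by decide), ha3 0 (by decide), h.count]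
      simp only [ne_eq, Fin.val_inj, and_assoc]
    rcases h4 with ⟨h17, hno⟩ | ⟨h17, i, hi, j, hj, hc, hmin, h26, h27, h23, h22⟩
    · exact Or.inl ⟨h17, fun i j hc => hno _ (box_lt i j) ((hcand i j).2 hc)⟩
    · refine Or.inr ⟨h17, ⟨i, hi⟩, ⟨j, hj⟩, (hcand ⟨i, hi⟩ ⟨j, hj⟩).1 hc, fun i' j' hc' => ?_, h26, h27,
        h23, ?_⟩
      · by_contra hlt
        exact hmin _ (not_le.1 hlt) ((hcand i' j').2 hc')
      · rw [h22, hv3 8 (by decide), hv3 9 (by decide)]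
  · refine same_of_eq (fun x hx => (hv x ?_).trans (hv3 x (by omega))) fun k hk =>
      (ha k ?_).trans (ha3 k hk)
    · simp [scanCmd, recordCmd, Cmd.vars]; omega
    · simp [scanCmd, recordCmd, Cmd.arrs]

/-- The bound for the number of steps of a round that prints nothing. -/
theorem Inv.tri_search {M : ℕ} {l : List (Vertex T)} {u : Vertex T} {s : St}
    (h : Inv (l ++ [u]) s) (hM : Big T M) (h9 : s.v 9 ≤ M)
    (hl : (l ++ [u]).length < Fintype.card (Vertex T)) :
    Tri M bodyCmd s (1200 * (p * q) + 500 * p + 500 * q + 900) fun s' => s'.out = s.out ∧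
      (((∀ i j, ¬ Ext (rest (l ++ [u])) u.1 (s.v 8) (s.v 9) i j) ∧ Popped s s') ∨
      ∃ (i : Fin p) (j : Fin q), Ext (rest (l ++ [u])) u.1 (s.v 8) (s.v 9) i j ∧
        (∀ i' j', Ext (rest (l ++ [u])) u.1 (s.v 8) (s.v 9) i' j' → (i : ℕ) * q + j ≤ i' * q + j') ∧
        Pushed i j (if i * q + j = s.v 8 then s.v 9 else 0) s s') := by
  have h7 := h.card
  have h6 := h.depth
  have hv := hM.verts
  refine Tri.ite (K := (1200 * (p * q) + 500 * p + 500 * q + 500) + 320) (fun _ => ?_)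
    (fun hpos => ?_) ?_
  swap
  · exfalso
    simp only [Ex.eval_sub, Ex.eval_var] at hpos
    omega
  swap
  · simp; omega
  have hfr : (Cmd.seq searchCmd (.ite (.var 17) pushCmd popCmd)).silent := by
    simp [searchCmd, goodCmd, sumsCmd, countsCmd, creditsCmd, fillCmd, scanCmd, recordCmd, pushCmd,
      popCmd, swapCmd, Cmd.silent]
  refine (Tri.seq (h.tri_searchCmd hM h9) (Q' := fun s' =>
      (((∀ i j, ¬ Ext (rest (l ++ [u])) u.1 (s.v 8) (s.v 9) i j) ∧ Popped s s') ∨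
      ∃ (i : Fin p) (j : Fin q), Ext (rest (l ++ [u])) u.1 (s.v 8) (s.v 9) i j ∧
        (∀ i' j', Ext (rest (l ++ [u])) u.1 (s.v 8) (s.v 9) i' j' → (i : ℕ) * q + j ≤ i' * q + j') ∧
        Pushed i j (if i * q + j = s.v 8 then s.v 9 else 0) s s')) ?_).frame
      fun s' h' _ _ _ ho => ⟨ho hfr, h'⟩
  rintro s1 ⟨h1, hs⟩
  have h' := h.same hs
  refine Tri.ite (K := 300) (fun hpos => ?_) (fun hneg => ?_) (by simp)
  · rcases h1 with h1 | ⟨h17, i, j, hext, hmin, h26, h27, h23, h22⟩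
    · simp [h1.1] at hpos
    have hc := entry_le_card (T := T) i j
    have hr : rest (l ++ [u]) i j ≤ T i j := Nat.sub_le _ _
    have hpos : rest (l ++ [u]) i j ≠ 0 := (good_iff_test.1 hext.1).1
    have hk : (if (i : ℕ) * q + j = s.v 8 then s.v 9 else 0) < rest (l ++ [u]) i j := by
      have := hext.2.2.2
      split_ifs <;> omega
    have hb : s1.v 23 < s1.v 5 := by rw [h'.base, h23]; exact box_lt i j
    have hi := i.2
    have hj := j.2
    have hp := hM.rows
    have hq := hM.cols
    have hd := h'.length_le
    refine (SkewGen.tri_pushCmd (i := i) (j := j) h22 h26 h27 (by rw [h23, h'.hq]) hb ?_ ?_ ?_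
      (by omega) (by omega) (by omega) (by rw [h'.depth]; omega)).mono le_rfl fun s2 h2 => ?_
    · rw [h23]
      have := h'.num_lt i j _ (hk.trans_le hr)
      omega
    · rw [h23, h'.count]
      have := h'.num_lt i j (rest (l ++ [u]) i j - 1) (by omega)
      omega
    · rw [h23, h'.count]; omega
    · refine Or.inr ⟨i, j, hext, hmin, hs.pushed h2 ?_⟩
      rw [h.hq, h.base]; exact box_lt i j
  · rcases h1 with ⟨-, h1⟩ | h1
    · exact (h'.tri_popCmd hM).mono le_rfl fun s2 h2 => Or.inl ⟨h1, hs.popped h2 (by rw [h6]; simp)⟩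
    · simp [h1.1] at hneg

end Body

end SkewGen

namespace SkewGen

/-! ### The search tree: completeness, no repetition, and delay -/

section Search

variable {p q : ℕ} {T : Fin p → Fin q → ℕ}

/-- Rounds of the search from `s` to `s'` generate the list of paths; `t` and `t'` are the numbers of
steps since the last output. Two more steps per round are spent on the control of the rounds. -/
inductive Gen (T : Fin p → Fin q → ℕ) (M D : ℕ) :
    St → ℕ → List (List (Vertex T)) → St → ℕ → Prop
  | nil (s : St) (t : ℕ) : Gen T M D s t [] s t
  | silent {s s' : St} {t t' : ℕ} {L : List (List (Vertex T))} (hd : 0 < s.v 6)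
      (hok : bodyCmd.ok M s) (hout : (bodyCmd.exec s).out = s.out)
      (h : Gen T M D (bodyCmd.exec s) (t + (bodyCmd.cost s + 2)) L s' t') : Gen T M D s t L s' t'
  | emit {s s' : St} {t t' : ℕ} {L : List (List (Vertex T))} {P : List (Vertex T)} (hd : 0 < s.v 6)
      (hok : bodyCmd.ok M s) (hout : (bodyCmd.exec s).out = s.out ++ encodePath P)
      (ht : t + (bodyCmd.cost s + 2) ≤ D) (h : Gen T M D (bodyCmd.exec s) 0 L s' t') :
      Gen T M D s t (P :: L) s' t'

theorem Gen.trans {M D : ℕ} {s s' s'' : St} {t t' t'' : ℕ} {L L' : List (List (Vertex T))}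
    (h : Gen T M D s t L s' t') (h' : Gen T M D s' t' L' s'' t'') :
    Gen T M D s t (L ++ L') s'' t'' := by
  induction h with
  | nil s t => exact h'
  | silent hd hok hout _ ih => exact .silent hd hok hout (ih h')
  | emit hd hok hout ht _ ih => exact .emit hd hok hout ht (ih h')

/-- The list is the vertex sequence of a Hamiltonian path. -/
def Full (P : List (Vertex T)) : Prop :=
  P.IsChain (skewGraph T).Adj ∧ P.Nodup ∧ ∀ x, x ∈ P

/-- The path `P` extends `l` by a vertex that is not before the position `pos`. -/
def After (s : St) (l : List (Vertex T)) (pos : ℕ) (P : List (Vertex T)) : Prop :=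
  ∃ (w : Vertex T) (r : List (Vertex T)) (k : ℕ), P = l ++ w :: r ∧ k < T w.1.1 w.1.2 ∧
    (w.2 : ℕ) = s.num k (w.1.1 * q + w.1.2) ∧
    pos ≤ (w.1.1 * q + w.1.2) * (Fintype.card (Vertex T) + 1) + k

/-- A position (box, place) is coded as one number with n + 1 as base. The base exceeds n because
the place behind the last vertex of a box may be n. -/
theorem pos_le_iff {n a b m k : ℕ} (hm : m ≤ n) (hk : k ≤ n) :
    a * (n + 1) + m ≤ b * (n + 1) + k ↔ a < b ∨ a = b ∧ m ≤ k := by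
  constructor
  · intro h
    rcases lt_trichotomy a b with hab | rfl | hab
    · exact Or.inl hab
    · exact Or.inr ⟨rfl, by omega⟩
    · have := Nat.mul_le_mul_right (n + 1) (show b + 1 ≤ a from hab)
      rw [add_mul] at this
      omega
  · rintro (hab | ⟨rfl, h⟩)
    · have := Nat.mul_le_mul_right (n + 1) (show a + 1 ≤ b from hab)
      rw [add_mul] at this
      omega
    · omega

/-- The numbering of a box is an injective map of a finite set into itself, so every vertex has a
place. -/
theorem Inv.exists_num {l : List (Vertex T)} {s : St} (h : Inv l s) (w : Vertex T) :
    ∃ k, k < T w.1.1 w.1.2 ∧ (w.2 : ℕ) = s.num k (w.1.1 * q + w.1.2) := by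
  let f : Fin (T w.1.1 w.1.2) → Fin (T w.1.1 w.1.2) := fun k =>
    ⟨s.num k (w.1.1 * q + w.1.2), h.num_lt _ _ _ k.2⟩
  have hf : Function.Injective f := fun k k' hkk =>
    Fin.ext (h.num_inj _ _ _ _ k.2 k'.2 (congrArg Fin.val hkk))
  obtain ⟨k, hk⟩ := Finite.injective_iff_surjective.1 hf w.2
  exact ⟨k, k.2, by rw [← hk]⟩

/-- No path is lost: if a Hamiltonian path continues with w, then the box of w is good by
`good_boxTable`, and w lies below the remaining count because it is unused. So the scan finds its
box. -/
theorem Inv.ext_of_full {l r : List (Vertex T)} {u w : Vertex T} {s : St} (h : Inv (l ++ [u]) s)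
    (hP : Full (l ++ [u] ++ w :: r)) {k : ℕ} (hk : k < T w.1.1 w.1.2)
    (hw : (w.2 : ℕ) = s.num k (w.1.1 * q + w.1.2))
    (h9 : s.v 9 ≤ Fintype.card (Vertex T))
    (hpos : s.v 8 * (Fintype.card (Vertex T) + 1) + s.v 9 ≤
      (w.1.1 * q + w.1.2) * (Fintype.card (Vertex T) + 1) + k) :
    Ext (rest (l ++ [u])) u.1 (s.v 8) (s.v 9) w.1.1 w.1.2 ∧
      (s.v 8 < w.1.1 * q + w.1.2 ∨ s.v 8 = w.1.1 * q + w.1.2 ∧ s.v 9 ≤ k) := by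
  obtain ⟨hch, hnd, hall⟩ := hP
  have hc := entry_le_card (T := T) w.1.1 w.1.2
  rw [pos_le_iff h9 (by omega)] at hpos
  have hr := rest_eq_boxTable hnd hall
  rw [List.isChain_append] at hch
  have hadj : (skewGraph T).Adj u w := hch.2.2 u (by simp) w (by simp)
  have hkr : k < rest (l ++ [u]) w.1.1 w.1.2 := by
    by_contra hcon
    obtain ⟨w', hw', h1, h2⟩ := (h.used w.1.1 w.1.2 k hk).2 (by omega)
    obtain rfl : w' = w := Vertex.ext_val h1 (h2.trans hw.symm)
    rw [List.nodup_append'] at hnd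
    exact hnd.2.2 hw' (by simp)
  refine ⟨⟨?_, fun e => hadj.1 e.symm, fun e => hadj.2 e.symm, by omega⟩, hpos⟩
  rw [hr]
  exact good_boxTable w r hch.2.1

theorem Full.length {P : List (Vertex T)} (h : Full P) : P.length = Fintype.card (Vertex T) :=
  length_eq_card h.2.1 h.2.2

/-- What is to be shown for a vertex of the search tree. -/
def NodeSpec (T : Fin p → Fin q → ℕ) (M D K K' h : ℕ) : Prop :=
  ∀ (l : List (Vertex T)) (u : Vertex T) (s : St) (t : ℕ), Inv (l ++ [u]) s →
    Good (rest l) u.1.1 u.1.2 → s.v 8 = 0 → s.v 9 = 0 →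
    (l ++ [u]).length + h = Fintype.card (Vertex T) → t + (h * K + K') ≤ D →
    ∃ L s' t', Gen T M D s t L s' t' ∧ Popped s s' ∧ L ≠ [] ∧ t' ≤ h * K ∧ L.Nodup ∧
      ∀ P, P ∈ L ↔ Full P ∧ l ++ [u] <+: P

/-- A leaf prints its path and removes the last vertex in one round. The reserve K' is the cost of
this round, and the time since the last output is zero afterwards. -/
theorem nodeSpec_zero {M D K K' : ℕ} (hM : Big T M)
    (hK' : 402 + 40 * Fintype.card (Vertex T) ≤ K') : NodeSpec T M D K K' 0 := by
  intro l u s t h _ _ _ hl ht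
  obtain ⟨hok, hcost, hpop, hout⟩ := h.tri_print hM (by omega)
  refine ⟨[l ++ [u]], _, _, .emit ?_ hok hout (by omega) (.nil _ _), hpop, by simp, by simp,
    by simp, fun P => ?_⟩
  · rw [h.depth]; simp
  · rw [List.mem_singleton]
    refine ⟨?_, fun ⟨h1, h2⟩ => (h2.eq_of_length ?_).symm⟩
    · rintro rfl
      exact ⟨⟨h.chain, h.nodup, mem_of_length_eq_card h.nodup (by omega)⟩, List.prefix_rfl⟩
    · rw [h1.length]; omega

/-- This treats the part of a node's subtree from the current position on. Each child leaves at most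
h · K steps since its last output, and each search round costs at most K. If no child remains, the
clock merely runs on by one round; otherwise it was reset in the last child and ends at no more than
(h + 1) · K. Before the next path at most about n rounds lead up and n lead down, whence D ≥ 2nK +
K'. -/
theorem exists_rest {M D K K' h : ℕ} (hM : Big T M)
    (hK : 1200 * (p * q) + 500 * p + 500 * q + 902 ≤ K)
    (hD : 2 * Fintype.card (Vertex T) * K + K' ≤ D) (hn : NodeSpec T M D K K' h)
    {l : List (Vertex T)} {u : Vertex T} {s : St} {t : ℕ} (hs : Inv (l ++ [u]) s)
    (h9 : s.v 9 ≤ Fintype.card (Vertex T))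
    (hl : (l ++ [u]).length + (h + 1) = Fintype.card (Vertex T))
    (ht : t + (K + h * K + K') ≤ D) :
    ∃ L s' t', Gen T M D s t L s' t' ∧ Popped s s' ∧ L.Nodup ∧
      (L = [] ∧ t' ≤ t + K ∨ t' ≤ (h + 1) * K) ∧
      ((∃ i j, Ext (rest (l ++ [u])) u.1 (s.v 8) (s.v 9) i j) → L ≠ []) ∧
      ∀ P, P ∈ L ↔ Full P ∧
        After s (l ++ [u]) (s.v 8 * (Fintype.card (Vertex T) + 1) + s.v 9) P := by
  -- The position strictly increases after each child, so what lies between it and the end of all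
  -- boxes serves as measure.
  induction hN : p * q * (Fintype.card (Vertex T) + 1) -
    (s.v 8 * (Fintype.card (Vertex T) + 1) + s.v 9) using Nat.strong_induction_on
    generalizing s t with
  | _ N ih =>
  set n := Fintype.card (Vertex T) with hn_def
  obtain ⟨hok, hcost, hout, hcase⟩ := hs.tri_search hM (by have := hM.verts; omega) (by omega)
  have hdepth : 0 < s.v 6 := by rw [hs.depth]; simp
  rcases hcase with ⟨hno, hpop⟩ | ⟨i, j, hext, hmin, hpush⟩
  · refine ⟨[], _, _, .silent hdepth hok hout (.nil _ _), hpop, by simp, Or.inl ⟨rfl, by omega⟩,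
      fun ⟨i, j, hij⟩ => absurd hij (hno i j), fun P => ?_⟩
    simp only [List.not_mem_nil, false_iff, not_and]
    rintro hP ⟨w, r, k, rfl, hk, hw, hpos⟩
    exact hno _ _ (hs.ext_of_full hP hk hw h9 hpos).1
  set b := (i : ℕ) * q + j with hb
  set k := if b = s.v 8 then s.v 9 else 0 with hk
  have hkr : k < rest (l ++ [u]) i j := by
    have h1 := hext.2.2.2
    have h2 : rest (l ++ [u]) i j ≠ 0 := (good_iff_test.1 hext.1).1
    rw [hk]
    split_ifs <;> omega
  have hkT : k < T i j := hkr.trans_le (Nat.sub_le _ _)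
  have hkn : k < n := hkT.trans_le (entry_le_card i j)
  have hposb : s.v 8 * (n + 1) + s.v 9 ≤ b * (n + 1) + k := by
    rw [pos_le_iff h9 hkn.le]
    have h1 := hext.2.2.2
    rw [hk]
    split_ifs <;> omega
  let w : Vertex T := ⟨(i, j), ⟨s.num k b, hs.num_lt i j k hkT⟩⟩
  have hadj : (skewGraph T).Adj u w := ⟨fun e => hext.2.1 e.symm, fun e => hext.2.2.1 e.symm⟩
  have hch : (l ++ [u] ++ [w]).IsChain (skewGraph T).Adj := by
    rw [List.isChain_append]
    refine ⟨hs.chain, by simp, fun x hx y hy => ?_⟩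
    simp only [List.getLast?_append, List.getLast?_singleton, Option.some_or, Option.mem_def,
      Option.some.injEq, List.head?_cons] at hx hy
    exact hx ▸ hy ▸ hadj
  have hs1 : Inv (l ++ [u] ++ [w]) (bodyCmd.exec s) := hs.push (w := w) hkr rfl hch hpush
  obtain ⟨L1, s2, t2, hg1, hpop1, hne, ht2, hnd1, hmem1⟩ := hn (l ++ [u]) w _ (t + (bodyCmd.cost s + 2))
    hs1 hext.1 hpush.box hpush.place
    (by simp only [List.length_append, List.length_singleton] at hl ⊢; omega) (by omega)
  have hb0 : 0 < s.a 0 (i * s.v 1 + j) := by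
    rw [hs.hq, hs.count]; omega
  obtain ⟨hsame, h8', h9'⟩ := hpush.popped hpop1 hb0
  rw [hs.hq, ← hb] at h8'
  have hs2 := hs.same hsame
  have hbpq : (b + 1) * (n + 1) ≤ p * q * (n + 1) := Nat.mul_le_mul_right _ (box_lt i j)
  rw [add_mul, one_mul] at hbpq
  have hh : (h + 1) * K ≤ n * K := Nat.mul_le_mul_right _ (by omega)
  rw [add_mul, one_mul] at hh
  have hnK : 2 * n * K = n * K + n * K := by ring
  obtain ⟨L2, s3, t3, hg2, hpop2, hnd2, ht3, -, hmem2⟩ := ih _ (by rw [h8', h9']; omega) (s := s2)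
    (t := t2) hs2 (by rw [h9']; omega) (by omega) rfl
  rw [h8', h9'] at hmem2
  have hafter : ∀ pos P, After s2 (l ++ [u]) pos P ↔ After s (l ++ [u]) pos P := fun pos P => by
    unfold After
    refine exists_congr fun w => exists_congr fun r => exists_congr fun k => ?_
    rw [hsame.num k _ (by rw [hs.base]; exact box_lt _ _)]
  refine ⟨L1 ++ L2, s3, t3, .silent hdepth hok hout (hg1.trans hg2), hsame.popped hpop2 hdepth, ?_,
    Or.inr ?_, fun _ => by simp [hne], fun P => ?_⟩
  -- A path produced twice would continue both with the vertex at place k and with one at a later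
  -- position, contrary to the injectivity of the numbering.
  · rw [List.nodup_append']
    refine ⟨hnd1, hnd2, fun P hP1 hP2 => ?_⟩
    obtain ⟨-, r, hr⟩ := (hmem1 P).1 hP1
    obtain ⟨-, w', r', k', hr', hk', hw', hpos'⟩ := (hmem2 P).1 hP2
    rw [hr', List.append_assoc] at hr
    have hww := List.append_cancel_left hr
    simp only [List.cons_append, List.nil_append, List.cons.injEq] at hww
    obtain ⟨rfl, -⟩ := hww
    rw [hsame.num k' _ (by rw [hs.base]; exact box_lt _ _)] at hw'
    have := hs.num_inj i j k k' hkT hk' hw'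
    change b * (n + 1) + (k + 1) ≤ b * (n + 1) + k' at hpos'
    omega
  · rw [add_mul, one_mul]
    rcases ht3 with ⟨-, ht3⟩ | ht3
    · omega
    · rwa [add_mul, one_mul] at ht3
  · rw [List.mem_append, hmem1, hmem2, hafter, ← and_or_left]
    refine and_congr_right fun hP => ⟨?_, ?_⟩
    · rintro (⟨r, rfl⟩ | ⟨w', r, k', rfl, hk', hw', hpos'⟩)
      · exact ⟨w, r, k, by simp, hkT, rfl, hposb⟩
      · exact ⟨w', r, k', rfl, hk', hw', by omega⟩
    · rintro ⟨w', r, k', rfl, hk', hw', hpos'⟩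
      obtain ⟨hext', hlex⟩ := hs.ext_of_full hP hk' hw' h9 hpos'
      have hle := hmin _ _ hext'
      have hk'n := entry_le_card (T := T) w'.1.1 w'.1.2
      -- The next vertex of a remaining path is either the child just explored or lies behind it,
      -- because the scan chose the first extension.
      by_cases hwk : b = w'.1.1 * q + w'.1.2 ∧ k = k'
      · left
        obtain ⟨h1, rfl⟩ := hwk
        have hij := box_inj.1 h1
        have : w' = w := Vertex.ext_val (Prod.ext hij.1.symm hij.2.symm) (by rw [hw', ← h1])
        subst this
        exact ⟨r, by simp⟩
      · right
        refine ⟨w', r, k', rfl, hk', hw', ?_⟩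
        rw [pos_le_iff (by omega) (by omega)]
        have : k = if b = s.v 8 then s.v 9 else 0 := hk
        split_ifs at this <;> omega

/-- At a good node with vertices left, `exists_good_of_good_addOne` gives a child, so the list is
nonempty and the clock bound survives. From position 0 on, all continuations are covered. -/
theorem nodeSpec_succ {M D K K' h : ℕ} (hM : Big T M)
    (hK : 1200 * (p * q) + 500 * p + 500 * q + 902 ≤ K)
    (hD : 2 * Fintype.card (Vertex T) * K + K' ≤ D) (hn : NodeSpec T M D K K' h) :
    NodeSpec T M D K K' (h + 1) := by
  intro l u s t hs hg h8 h9 hl ht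
  obtain ⟨L, s', t', hgen, hpop, hnd, ht', hne, hmem⟩ := exists_rest (t := t) hM hK hD hn hs (by omega) hl
    (by rw [add_mul, one_mul] at ht; omega)
  have hL : L ≠ [] := by
    refine hne ?_
    rw [rest_eq_addOne hs.nodup] at hg
    have htot := total_rest hs.nodup
    obtain ⟨i, j, hi, hj, hij⟩ := exists_good_of_good_addOne hg (by omega)
    have := (good_iff_test.1 hij).1
    exact ⟨i, j, hij, hi, hj, by omega⟩
  refine ⟨L, s', t', hgen, hpop, hL, ?_, hnd, fun P => ?_⟩
  · rcases ht' with ht' | ht'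
    · exact absurd ht'.1 hL
    · exact ht'
  · rw [hmem]
    refine and_congr_right fun hP => ⟨fun ⟨w, r, k, hr, _⟩ => ⟨w :: r, hr.symm⟩, ?_⟩
    rintro ⟨r, rfl⟩
    have hlen := hP.length
    rw [List.length_append] at hlen
    obtain ⟨w, r, rfl⟩ := List.exists_cons_of_ne_nil (l := r) (by rintro rfl; simp at hlen hl; omega)
    obtain ⟨k, hk, hw⟩ := hs.exists_num w
    exact ⟨w, r, k, rfl, hk, hw, by simp [h8, h9]⟩

theorem nodeSpec {M D K K' : ℕ} (hM : Big T M)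
    (hK : 1200 * (p * q) + 500 * p + 500 * q + 902 ≤ K)
    (hK' : 402 + 40 * Fintype.card (Vertex T) ≤ K')
    (hD : 2 * Fintype.card (Vertex T) * K + K' ≤ D) (h : ℕ) : NodeSpec T M D K K' h := by
  induction h with
  | zero => exact nodeSpec_zero hM hK'
  | succ h ih => exact nodeSpec_succ hM hK hD ih

end Search

end SkewGen

namespace SkewGen

/-! ### The program: initialization -/

/-- Read the table and count the vertices. -/
def readCmd : Cmd :=
  .loop 18 (.var 5) (.seq (.input 28 (.var 18)) (.seq (.store 0 (.var 18) (.var 28))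
    (.assign 7 (.add (.var 7) (.var 28)))))

/-- Start the path with the given vertex. -/
def rootCmd : Cmd :=
  .seq (.assign 26 (.var 2)) (.seq (.assign 27 (.var 3)) (.seq (.assign 23 (boxE (.var 2) (.var 3)))
    (.seq (.assign 22 (.var 4)) pushCmd)))

/-- Before the first test the row and column to be avoided are set to p and q, which are out of
range, so the test excludes no box. If the first box is not good, the depth stays 0; the assignment
to variable 17 merely fills the branch. -/
def initCmd : Cmd :=
  .seq readCmd (.seq (.assign 10 (.var 0)) (.seq (.assign 11 (.var 1)) (.seq goodCmd
    (.ite (.arr 12 (boxE (.var 2) (.var 3))) rootCmd (.assign 17 (.num 0))))))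

section Init

variable {p q : ℕ} {T : Fin p → Fin q → ℕ}

/-- The state at the start of the initialization. -/
def initState (T : Fin p → Fin q → ℕ) (v : Vertex T) : St where
  v x := [p, q, v.1.1.val, v.1.2.val, v.2.val, p * q].getD x 0
  a _ _ := 0
  inp := (inputConfig T v).mem
  out := []

theorem inputConfig_mem (v : Vertex T) (i : Fin p) (j : Fin q) :
    (inputConfig T v).mem (i * q + j) = T i j := by
  have e : finProdFinEquiv.symm ⟨i * q + j, box_lt i j⟩ = (i, j) := by
    rw [Equiv.symm_apply_eq]
    ext
    simp [finProdFinEquiv]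
    ring
  simp only [inputConfig, dif_pos (box_lt i j), e]

theorem sum_inputConfig_mem (v : Vertex T) :
    ∑ x ∈ Finset.range (p * q), (inputConfig T v).mem x = Fintype.card (Vertex T) := by
  rw [← total_eq_card, Finset.sum_range, ← finProdFinEquiv.sum_comp, Fintype.sum_prod_type]
  refine Finset.sum_congr rfl fun i _ => Finset.sum_congr rfl fun j _ => ?_
  rw [← inputConfig_mem v i j]
  congr 1
  simp [finProdFinEquiv]
  ring

theorem tri_readCmd {M : ℕ} (hM : Big T M) (v : Vertex T) :
    Tri M readCmd (initState T v) (4 + p * q * 30) fun s => (∀ x < 18, x ≠ 7 →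
      s.v x = (initState T v).v x) ∧ (∀ k, k ≠ 0 → s.a k = fun _ => 0) ∧
      (∀ x < p * q, s.a 0 x = (inputConfig T v).mem x) ∧ s.v 7 = Fintype.card (Vertex T) ∧
      s.out = [] := by
  have h5 : (Ex.var 5).eval (initState T v) = p * q := rfl
  have hsum : ∀ x ≤ p * q, ∑ y ∈ Finset.range x, (inputConfig T v).mem y ≤
      Fintype.card (Vertex T) := fun x hx => by
    rw [← sum_inputConfig_mem v]
    exact Finset.sum_le_sum_of_subset (Finset.range_mono hx)
  refine (Tri.loop (M := M) (K := 25) (fun x s => (∀ x < 18, x ≠ 7 → s.v x = (initState T v).v x) ∧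
    (∀ k, k ≠ 0 → s.a k = fun _ => 0) ∧ (∀ y < x, s.a 0 y = (inputConfig T v).mem y) ∧
    s.v 7 = ∑ y ∈ Finset.range x, (inputConfig T v).mem y ∧ s.inp = (inputConfig T v).mem ∧
    s.out = []) (by rw [h5]; exact hM.boxes) ?_ ?_).mono (by rw [h5]; simp) ?_
  · exact ⟨fun _ _ _ => rfl, fun _ _ => rfl, fun _ h => by omega, rfl, rfl, rfl⟩
  · rw [h5]
    rintro x hx s ⟨h1, h2, h3, h4, h6, h8⟩
    have hs := hsum (x + 1) hx
    rw [Finset.sum_range_succ] at hs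
    have hv := hM.verts
    have e5 : s.v 5 = p * q := h1 5 (by decide) (by decide)
    refine ⟨?_, ?_, ?_, ?_, ?_, ?_, ?_, ?_⟩
    · simp [Cmd.ok, Cmd.exec, e5, hx, h6, h4]; omega
    · simp [Cmd.cost]
    · intro y hy hy7
      have : y ≠ 18 := by omega
      have : y ≠ 28 := by omega
      simp [Cmd.exec, *]
    · intro k hk
      simp [Cmd.exec, hk, h2 k hk]
    · intro y hy
      simp only [Cmd.exec, St.setV_a, St.setA_self, Ex.eval_var, St.setV_self, St.setV_inp, h6,
        Function.update_apply]
      rw [St.setV_of_ne _ _ (by decide), St.setV_self]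
      split_ifs with h
      · rw [h]
      · exact h3 y (by omega)
    · simp [Cmd.exec, h4, h6, Finset.sum_range_succ]
    · simp [Cmd.exec, h6]
    · simp [Cmd.exec, h8]
  · rw [h5]
    rintro s ⟨h1, h2, h3, h4, h6, h8⟩
    exact ⟨h1, h2, h3, h4.trans (sum_inputConfig_mem v), h8⟩

theorem rest_nil : rest ([] : List (Vertex T)) = T := by
  funext i j; simp [rest, boxTable]

theorem tri_initCmd {M : ℕ} (hM : Big T M) (v : Vertex T) :
    Tri M initCmd (initState T v) (1030 * (p * q) + 400 * p + 400 * q + 1000) fun s =>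
      s.out = [] ∧ ((¬ Good T v.1.1 v.1.2 ∧ s.v 6 = 0) ∨
        (Good T v.1.1 v.1.2 ∧ Inv [v] s ∧ s.v 8 = 0 ∧ s.v 9 = 0)) := by
  have hp := hM.rows
  have hq := hM.cols
  have hv := hM.verts
  have hc := entry_le_card (T := T) v.1.1 v.1.2
  have hi := v.1.1.2
  have hj := v.1.2.2
  have hk := v.2.2
  refine (Tri.seq (tri_readCmd hM v) (K' := 10 + (10 + ((1000 * (p * q) + 400 * p + 400 * q + 400) +
    400))) fun s ⟨h1, h2, h3, h4, h5⟩ => ?_).mono (by linarith) fun _ h => h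
  have hd : s.v 6 = 0 := h1 6 (by decide) (by decide)
  have hv0 : s.v 0 = p := h1 0 (by decide) (by decide)
  have hv1 : s.v 1 = q := h1 1 (by decide) (by decide)
  have hv5 : s.v 5 = p * q := h1 5 (by decide) (by decide)
  -- Memory beyond the table is zero, so the numbering is the identity without any initialization.
  have hnum : ∀ k b, s.num k b = k := fun k b => by simp [St.num, h2 1]
  have hinv : Inv ([] : List (Vertex T)) s := by
    refine ⟨hv0, hv1, hv5, h4, hd, by simp, by simp, fun i j => ?_, by simp, ?_, ?_, ?_⟩
    · rw [h3 _ (box_lt i j), rest_nil, inputConfig_mem]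
    · intro i j k hk
      rwa [hnum]
    · intro i j k k' _ _ h
      rwa [hnum, hnum] at h
    · intro i j k hk
      rw [rest_nil]
      simp [hk]
  refine Tri.seq (Q := fun s1 => s1 = s.setV 10 p) (Tri.assign ?_ ?_ ?_) ?_
  · simp [hv0]; omega
  · simp
  · simp [hv0]
  rintro s1 hs1
  refine Tri.seq (Q := fun s2 => s2 = s1.setV 11 q) (Tri.assign ?_ ?_ ?_) ?_
  · simp [hs1, hv1]; omega
  · simp
  · simp [hs1, hv1]
  rintro s2 hs2
  have hv2 : ∀ x < 10, s2.v x = s.v x := fun x hx => by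
    rw [hs2, hs1, St.setV_of_ne _ _ (by omega), St.setV_of_ne _ _ (by omega)]
  have ha2 : s2.a = s.a := by simp [hs2, hs1]
  have ho2 : s2.out = [] := by simp [hs2, hs1, h5]
  have e10 : s2.v 10 = p := by simp [hs2, hs1]
  have e11 : s2.v 11 = q := by simp [hs2]
  have henv : Env T s2 := by
    have := hinv.env
    rw [rest_nil] at this
    exact this.congr (hv2 0 (by decide)) (hv2 1 (by decide)) (by rw [ha2])
  have hviol : violations T ≤ M := by
    refine (violations_le _).trans (le_trans ?_ hM.viol)
    rw [total_eq_card]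
  refine Tri.seq ((tri_goodCmd henv hp hq hM.boxes (by rw [total_eq_card]; omega) hviol).frame
    fun s3 h3 hv ha _ ho => (⟨h3, fun x hx => (hv x ?_).trans (hv2 x hx), fun k hk => (ha k ?_).trans
      (by rw [ha2]), (ho ?_).trans ho2⟩ : (∀ (i : Fin p) (j : Fin q), s3.a 12 (i * q + j) =
        mark T (s2.v 10) (s2.v 11) i j) ∧ (∀ x < 10, s3.v x = s.v x) ∧
        (∀ k < 6, s3.a k = s.a k) ∧ s3.out = [])) ?_
  · simp [goodCmd, sumsCmd, countsCmd, creditsCmd, fillCmd, Cmd.vars]; omega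
  · simp [goodCmd, sumsCmd, countsCmd, creditsCmd, fillCmd, Cmd.arrs]; omega
  · simp [goodCmd, sumsCmd, countsCmd, creditsCmd, fillCmd, Cmd.silent]
  rintro s3 ⟨hm, hv3, ha3, ho3⟩
  have hinv3 : Inv ([] : List (Vertex T)) s3 :=
    hinv.same (same_of_eq (fun x hx => hv3 x (by omega)) ha3)
  have i2 : s3.v 2 = v.1.1 := (hv3 2 (by decide)).trans (h1 2 (by decide) (by decide))
  have i3 : s3.v 3 = v.1.2 := (hv3 3 (by decide)).trans (h1 3 (by decide) (by decide))
  have i4 : s3.v 4 = v.2 := (hv3 4 (by decide)).trans (h1 4 (by decide) (by decide))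
  have hnum3 : ∀ k b, s3.num k b = k := fun k b => by simp [St.num, ha3 1, h2 1]
  have hbox : (boxE (.var 2) (.var 3)).eval s3 = v.1.1 * q + v.1.2 := by
    simp [boxE, i2, i3, hinv3.hq]
  have hmark : (Ex.arr 12 (boxE (.var 2) (.var 3))).eval s3 = mark T p q v.1.1 v.1.2 := by
    rw [Ex.eval_arr, hbox, hm, e10, e11]
  refine Tri.ite (K := 350) (fun hpos => ?_) (fun hneg => ?_) (by simp [boxE])
  · rw [hmark, mark_pos] at hpos
    refine (Tri.seq (K := 2) (K' := 348) (Q := fun s4 => s4 = s3.setV 26 v.1.1) (Tri.assign ?_ ?_ ?_)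
      ?_).frame (Q := fun s => Good T v.1.1 v.1.2 ∧ Inv [v] s ∧ s.v 8 = 0 ∧ s.v 9 = 0)
      fun s' h' _ _ _ ho => ⟨(ho ?_).trans ho3, Or.inr h'⟩
    · simp [i2]; omega
    · simp
    · simp [i2]
    swap
    · simp [pushCmd, swapCmd, Cmd.silent]
    rintro s4 hs4
    refine Tri.seq (K := 2) (K' := 346) (Q := fun s5 => s5 = s4.setV 27 v.1.2) (Tri.assign ?_ ?_ ?_)
      ?_
    · simp [hs4, i3]; omega
    · simp
    · simp [hs4, i3]
    rintro s5 hs5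
    have hbox' : (boxE (.var 2) (.var 3)).eval s5 = v.1.1 * q + v.1.2 := by
      simp [boxE, hs5, hs4, i2, i3, hinv3.hq]
    refine Tri.seq (K := 10) (K' := 336) (Q := fun s6 => s6 = s5.setV 23 (v.1.1 * q + v.1.2))
      (Tri.assign ?_ ?_ ?_) ?_
    · rw [hbox']; exact (box_lt _ _).le.trans hM.boxes
    · simp [boxE]
    · rw [hbox']
    rintro s6 hs6
    refine Tri.seq (K := 2) (K' := 334) (Q := fun s7 => s7 = s6.setV 22 v.2)
      (Tri.assign ?_ ?_ ?_) ?_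
    · simp [hs6, hs5, hs4, i4]; omega
    · simp
    · simp [hs6, hs5, hs4, i4]
    rintro s7 hs7
    have hv7 : ∀ x < 10, s7.v x = s3.v x := fun x hx => by
      rw [hs7, hs6, hs5, hs4, St.setV_of_ne _ _ (by omega), St.setV_of_ne _ _ (by omega),
        St.setV_of_ne _ _ (by omega), St.setV_of_ne _ _ (by omega)]
    have ha7 : s7.a = s3.a := by simp [hs7, hs6, hs5, hs4]
    have hinv7 : Inv ([] : List (Vertex T)) s7 :=
      hinv3.same (same_of_eq (fun x hx => hv7 x (by omega)) fun k _ => by rw [ha7])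
    have hnum7 : ∀ k b, s7.num k b = k := fun k b => by
      simp [St.num, ha7, ha3 1, h2 1]
    have j22 : s7.v 22 = v.2 := by simp [hs7]
    have j23 : s7.v 23 = v.1.1 * q + v.1.2 := by simp [hs7, hs6]
    have j26 : s7.v 26 = v.1.1 := by simp [hs7, hs6, hs5, hs4]
    have j27 : s7.v 27 = v.1.2 := by simp [hs7, hs6, hs5]
    have hcnt : s7.a 0 (s7.v 23) = T v.1.1 v.1.2 := by rw [j23, hinv7.count, rest_nil]
    refine (tri_pushCmd (i := v.1.1) (j := v.1.2) (k := v.2) j22 j26 j27 (by rw [j23, hinv7.hq])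
      (by rw [j23, hinv7.base]; exact box_lt _ _) ?_ ?_ ?_ (by omega) (by omega) (by omega)
      (by rw [hinv7.depth]; simp; omega)).mono (by omega) fun s8 h8 => ⟨hpos.1, ?_, h8.box, h8.place⟩
    · rw [hnum7]; omega
    · rw [hnum7, hcnt]; omega
    · rw [hcnt]; omega
    · exact hinv7.push (by rw [rest_nil]; exact hk) (by rw [hnum7]) (by simp) h8
  · refine Tri.assign (by simp) (by simp) ⟨ho3, Or.inl ⟨fun hg => hneg ?_, ?_⟩⟩
    · rw [hmark, mark_pos]
      exact ⟨hg, by omega, by omega⟩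
    · rw [St.setV_of_ne _ _ (by decide)]
      exact hinv3.depth

end Init

end SkewGen

namespace SkewGen

/-! ### The machine program -/

/-- The position of the test at the head of the main loop. -/
def headPos : ℕ := initCmd.size + 2

/-- The machine program. -/
def machine : Program :=
  [.mul 5 0 1] ++ (initCmd.comp 1 32 ++ ([.const 32 0, .jumpLT 32 6 (headPos + 2), .halt] ++
    (bodyCmd.comp (headPos + 2) 33 ++ [.jump headPos])))

theorem codeAt_machine : CodeAt machine 0 machine := fun i _ => by rw [zero_add]

theorem machine_zero : machine[0]? = some (.mul 5 0 1) := rfl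

theorem codeAt_init : CodeAt machine 1 (initCmd.comp 1 32) := codeAt_machine.right.left

theorem codeAt_head :
    CodeAt machine (1 + initCmd.size) [.const 32 0, .jumpLT 32 6 (headPos + 2), .halt] := by
  have h := codeAt_machine.right.right.left
  rwa [Cmd.length_comp] at h

theorem codeAt_body : CodeAt machine (headPos + 2) (bodyCmd.comp (headPos + 2) 33) := by
  have h := codeAt_machine.right.right.right.left
  rw [Cmd.length_comp] at h
  convert h using 1
  simp [headPos]
  omega

theorem machine_last : machine[headPos + 2 + bodyCmd.size]? = some (.jump headPos) := by
  have h := codeAt_machine.right.right.right.right.get 0 rfl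
  rw [Cmd.length_comp, Cmd.length_comp] at h
  rw [← h]
  congr 1

theorem machine_const : machine[1 + initCmd.size]? = some (.const 32 0) := codeAt_head.get 0 rfl

theorem machine_head : machine[headPos]? = some (.jumpLT 32 6 (headPos + 2)) := by
  rw [← codeAt_head.get 1 rfl]
  congr 1

theorem machine_halt : machine[headPos + 1]? = some .halt := by
  rw [← codeAt_head.get 2 rfl]
  congr 1

theorem wf_init : initCmd.wf := by
  simp [initCmd, readCmd, rootCmd, pushCmd, swapCmd, goodCmd, sumsCmd, countsCmd, creditsCmd, fillCmd,
    testE, excessE, entryE, boxE, numE, placeE, Cmd.wf, Ex.wf, Ex.pos, Ex.eq, Ex.not]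

theorem wf_body : bodyCmd.wf := by
  simp [bodyCmd, searchCmd, scanCmd, recordCmd, candE, printCmd, popCmd, pushCmd, swapCmd, goodCmd,
    sumsCmd, countsCmd, creditsCmd, fillCmd, testE, excessE, entryE, boxE, numE, placeE, Cmd.wf,
    Ex.wf, Ex.pos, Ex.eq, Ex.not]

/-- The machine is at the head of the main loop, in the state `s`. -/
structure Head (M : ℕ) (s : St) (c : Config) : Prop where
  pc : c.pc = headPos
  zero : c.reg 32 = 0
  sim : Sim s c
  bd : s.Bd M

section Run

variable {p q : ℕ} {T : Fin p → Fin q → ℕ}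

/-- One round of the main loop. -/
theorem Head.round {M B t : ℕ} {s : St} {c c₀ : Config} (h : Head M s c) (hB : bodyCmd.bd M ≤ B)
    (hs : Steps machine B c₀ t c) (hd : 0 < s.v 6) (hok : bodyCmd.ok M s) :
    ∃ c', Steps machine B c₀ (t + (bodyCmd.cost s + 2)) c' ∧ Head M (bodyCmd.exec s) c' := by
  have n1 := hs.next (by rw [h.pc]; exact machine_head) (by simpa [Bnd, Instr.exec] using hs.bnd)
  have hlt : c.reg 32 < c.reg 6 := by rw [h.zero, h.sim.reg 6 (by decide)]; exact hd
  simp only [Instr.exec, hlt, if_true] at n1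
  have hsim : Sim s { c with pc := headPos + 2 } := h.sim.of_reg (fun _ _ => rfl) rfl rfl
  obtain ⟨c2, hs2, hpc2, hsim2, hbd2, hr2⟩ := bodyCmd.correct wf_body (headPos + 2) 33 M s _ (by omega)
    codeAt_body rfl hsim h.bd n1.bnd hB hok
  have n2 := n1.trans hs2
  have n3 := n2.next (by rw [hpc2]; exact machine_last) (by simpa [Bnd, Instr.exec] using n2.bnd)
  refine ⟨_, n3.cast (by omega), rfl, ?_, hsim2.of_reg (fun _ _ => rfl) rfl rfl, hbd2⟩
  exact (hr2 32 (by omega) (by omega)).trans h.zero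

/-- Here t₀ is the time of the last output (or the start) and t the number of steps since then.
Silent rounds only advance t; a printing round ends at the next value of τ and sets t back to 0. -/
theorem Gen.run_machine {M B D : ℕ} {s s' : St} {t t' : ℕ} {L : List (List (Vertex T))}
    (h : Gen T M D s t L s' t') {c₀ : Config} (hB : bodyCmd.bd M ≤ B) :
    ∀ (t₀ : ℕ) (c : Config), Steps machine B c₀ (t₀ + t) c → Head M s c →
      ∃ (τ : ℕ → ℕ) (c' : Config), τ 0 = t₀ ∧
        (∀ m < L.length, τ (m + 1) ≤ τ m + D ∧
          (run machine c₀ (τ (m + 1))).out = s.out ++ (L.take (m + 1)).flatMap encodePath) ∧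
        Steps machine B c₀ (τ L.length + t') c' ∧ Head M s' c' ∧
        s'.out = s.out ++ L.flatMap encodePath := by
  induction h with
  | nil s t =>
    intro t₀ c hs hc
    exact ⟨fun _ => t₀, c, rfl, by simp, hs, hc, by simp⟩
  | silent hd hok hout _ ih =>
    intro t₀ c hs hc
    obtain ⟨c1, hs1, hc1⟩ := hc.round hB hs hd hok
    obtain ⟨τ, c', h0, h1, h2, h3, h4⟩ := ih t₀ c1 (hs1.cast (by omega)) hc1
    rw [hout] at h1 h4
    exact ⟨τ, c', h0, h1, h2, h3, h4⟩
  | @emit s s' t t' L P hd hok hout ht _ ih =>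
    intro t₀ c hs hc
    obtain ⟨c1, hs1, hc1⟩ := hc.round hB hs hd hok
    obtain ⟨τ, c', h0, h1, h2, h3, h4⟩ := ih (t₀ + t + (bodyCmd.cost s + 2)) c1 hs1 hc1
    rw [hout] at h1 h4
    -- The times of the later paths are shifted by one, with t₀ put in front. The time of a path is
    -- the end of its round, when its last vertex has already been removed.
    refine ⟨fun m => Nat.casesOn m t₀ τ, c', rfl, fun m hm => ?_, h2, h3, by simp [h4]⟩
    cases m with
    | zero =>
      refine ⟨?_, ?_⟩
      · change τ 0 ≤ t₀ + D
        omega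
      · change (run machine c₀ (τ 0)).out = _
        rw [h0, hs1.1, hc1.sim.out, hout]
        simp
    | succ m =>
      obtain ⟨g1, g2⟩ := h1 m (by simpa using hm)
      refine ⟨g1, ?_⟩
      change (run machine c₀ (τ (m + 1))).out = _
      rw [g2]
      simp

theorem run_of_halt {prog : Program} {c₀ c : Config} {t : ℕ} (h : run prog c₀ t = c)
    (hc : prog[c.pc]? = some .halt) (u : ℕ) : run prog c₀ (t + u) = c := by
  induction u with
  | zero => exact h
  | succ u ih =>
    have : run prog c₀ (t + (u + 1)) = step prog (run prog c₀ (t + u)) := by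
      unfold run
      rw [← add_assoc, Function.iterate_succ_apply']
    rw [this, ih]
    simp [step, hc, Instr.exec]

theorem Head.halts {M B t : ℕ} {s : St} {c c₀ : Config} (h : Head M s c)
    (hs : Steps machine B c₀ t c) (hd : s.v 6 = 0) :
    ∃ c', Steps machine B c₀ (t + 1) c' ∧ machine[c'.pc]? = some .halt ∧ c'.out = s.out := by
  have n1 := hs.next (by rw [h.pc]; exact machine_head) (by simpa [Bnd, Instr.exec] using hs.bnd)
  have hlt : ¬ c.reg 32 < c.reg 6 := by rw [h.zero, h.sim.reg 6 (by decide), hd]; omega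
  simp only [Instr.exec, hlt, if_false, h.pc] at n1
  exact ⟨_, n1, machine_halt, h.sim.out⟩

/-- The first instruction puts pq into register 5, the base of the arrays. It and the final reset of
register 32 are the two steps beyond the cost of the command; register 32 is the zero against which
the depth is compared, and it survives because the body uses scratch registers from 33 on. -/
theorem steps_init {M B : ℕ} (hM : Big T M) (v : Vertex T) (hB : initCmd.bd M + M ≤ B)
    (hok : initCmd.ok M (initState T v)) :
    ∃ c, Steps machine B (inputConfig T v) (initCmd.cost (initState T v) + 2) c ∧
      Head M (initCmd.exec (initState T v)) c := by
  have hp := hM.rows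
  have hq := hM.cols
  have hpq := hM.boxes
  have hv := hM.verts
  have hi := v.1.1.2
  have hj := v.1.2.2
  have hk := v.2.2
  have hc := entry_le_card (T := T) v.1.1 v.1.2
  have hreg : ∀ k, (inputConfig T v).reg k ≤ M := by
    intro k
    rcases k with _ | _ | _ | _ | _ | k <;> simp [inputConfig] <;> omega
  have hmem : ∀ k, (inputConfig T v).mem k ≤ M := by
    intro k
    simp only [inputConfig]
    split_ifs with h
    · exact (entry_le_card (T := T) _ _).trans (by omega)
    · omega
  have h0 : Steps machine B (inputConfig T v) 0 (inputConfig T v) := .refl fun k =>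
    ⟨(hreg k).trans (by omega), (hmem k).trans (by omega)⟩
  have n1 := h0.next machine_zero (h0.bnd.reg (by simp [inputConfig]; omega))
  have hbd : (initState T v).Bd M := by
    refine ⟨fun x _ => ?_, fun k _ x => Nat.zero_le M⟩
    rcases x with _ | _ | _ | _ | _ | _ | x <;> simp [initState] <;> omega
  have hsim : Sim (initState T v) (Instr.exec (inputConfig T v) (.mul 5 0 1)) := by
    refine ⟨fun x _ => ?_, fun k _ x => ?_, fun x _ => rfl, rfl⟩
    · rcases x with _ | _ | _ | _ | _ | _ | x <;> simp [initState, Instr.exec, inputConfig]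
    · simp [initState, Instr.exec, inputConfig]
  obtain ⟨c2, hs2, hpc2, hsim2, hbd2, -⟩ := initCmd.correct wf_init 1 32 M _ _ le_rfl codeAt_init rfl
    hsim hbd n1.bnd (by omega) hok
  have n2 := n1.trans hs2
  have n3 := n2.next (by rw [hpc2]; exact machine_const) (n2.bnd.reg (Nat.zero_le B))
  refine ⟨_, n3.cast (by omega), ?_, by simp [Instr.exec], hsim2.of_reg (fun y hy => ?_) rfl rfl,
    hbd2⟩
  · simp [Instr.exec, hpc2, headPos]; omega
  · simp [Instr.exec, Function.update_of_ne (show y ≠ 32 by omega)]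

end Run

end SkewGen

namespace SkewGen

section Main

variable {p q : ℕ} {T : Fin p → Fin q → ℕ}

/-- If the first box is not good, necessity shows that the empty list is the correct answer.
Otherwise the root is a node of height n - 1, and its final pop brings the depth to 0, which ends
the main loop. -/
theorem exists_gen {M D K K' : ℕ} (hM : Big T M) (v : Vertex T)
    (hK : 1200 * (p * q) + 500 * p + 500 * q + 902 ≤ K)
    (hK' : 402 + 40 * Fintype.card (Vertex T) ≤ K')
    (hD : 2 * Fintype.card (Vertex T) * K + K' + (1030 * (p * q) + 400 * p + 400 * q + 1003) ≤ D) :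
    ∃ L s' t', Gen T M D (initCmd.exec (initState T v)) (initCmd.cost (initState T v) + 2) L s' t' ∧
      s'.v 6 = 0 ∧ t' + 1 ≤ D ∧ L.Nodup ∧ ∀ P, P ∈ L ↔ Full P ∧ [v] <+: P := by
  obtain ⟨-, hcost, hout, ⟨hng, hd⟩ | ⟨hg, hs, h8, h9⟩⟩ := tri_initCmd hM v
  · refine ⟨[], _, _, .nil _ _, hd, by omega, by simp, fun P => ?_⟩
    simp only [List.not_mem_nil, false_iff, not_and]
    rintro hP ⟨r, rfl⟩
    apply hng
    have h := good_boxTable v r hP.1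
    have e : boxTable (v :: r) = T := by
      funext i j
      exact boxTable_of_complete _ hP.2.1 hP.2.2 i j
    rwa [e] at h
  · have hn := hs.length_le
    simp only [List.length_singleton] at hn
    obtain ⟨h, hh⟩ := Nat.exists_eq_add_of_le hn
    have hhK : h * K ≤ Fintype.card (Vertex T) * K := Nat.mul_le_mul_right _ (by omega)
    have hnK : 2 * Fintype.card (Vertex T) * K =
      Fintype.card (Vertex T) * K + Fintype.card (Vertex T) * K := by ring
    obtain ⟨L, s', t', hgen, hpop, -, ht', hnd, hmem⟩ :=
      nodeSpec (D := D) hM hK hK' (by omega) h [] v _ (initCmd.cost (initState T v) + 2) hs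
        (by rw [rest_nil]; exact hg) h8 h9 (by simp only [List.nil_append, List.length_singleton]; omega)
        (by omega)
    refine ⟨L, s', t', hgen, ?_, by omega, hnd, hmem⟩
    rw [hpop.depth, hs.depth]
    rfl

theorem machine_correct {M B D K K' : ℕ} (hM : Big T M) (v : Vertex T)
    (hK : 1200 * (p * q) + 500 * p + 500 * q + 902 ≤ K)
    (hK' : 402 + 40 * Fintype.card (Vertex T) ≤ K')
    (hD : 2 * Fintype.card (Vertex T) * K + K' + (1030 * (p * q) + 400 * p + 400 * q + 1003) ≤ D)
    (hB : initCmd.bd M + bodyCmd.bd M + M ≤ B) :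
    ∃ L : List (List (Vertex T)), L.Nodup ∧ (∀ P, P ∈ L ↔ IsHamPathFrom (skewGraph T) v P) ∧
      GeneratesWithDelay machine (inputConfig T v) L D ∧
      WordsBounded machine (inputConfig T v) B := by
  obtain ⟨L, s', t', hgen, hd, ht', hnd, hmem⟩ := exists_gen hM v hK hK' hD
  have hinit := tri_initCmd hM v
  obtain ⟨c, hs, hc⟩ := steps_init hM v (show initCmd.bd M + M ≤ B by omega) hinit.1
  obtain ⟨τ, c', h0, h1, h2, h3, h4⟩ := hgen.run_machine (B := B) (by omega) 0 c
    (hs.cast (by omega)) hc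
  obtain ⟨c'', hs'', hhalt, hout⟩ := h3.halts h2 hd
  rw [hinit.2.2.1] at h1 h4
  -- A halted machine keeps its configuration, so the word bound extends to all times and the stop
  -- holds at every later time.
  have hfin : ∀ u, τ L.length + t' + 1 ≤ u → run machine (inputConfig T v) u = c'' := fun u hu => by
    obtain ⟨w, rfl⟩ := Nat.exists_eq_add_of_le hu
    exact run_of_halt hs''.1 hhalt w
  refine ⟨L, hnd, fun P => ?_, ⟨τ, h0, by simpa using h1, ?_, ?_⟩, fun u k => ?_⟩
  · rw [hmem, isHamPathFrom_iff]
    refine ⟨fun ⟨⟨a, b, c⟩, r, hr⟩ => ⟨⟨r, hr.symm⟩, a, b, c⟩, ?_⟩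
    rintro ⟨⟨r, rfl⟩, a, b, c⟩
    exact ⟨⟨a, b, c⟩, r, rfl⟩
  · rw [hfin _ (by omega)]
    exact Or.inr hhalt
  · rw [hfin _ (by omega), hout, h4]
    simp
  · rcases le_total u (τ L.length + t' + 1) with hu | hu
    · exact hs''.2 u hu k
    · rw [hfin u hu]
      exact hs''.bnd k

end Main

end SkewGen

theorem mainTheorem9 :
    ∃ (prog : SkewGen.Program) (C : ℕ),
      ∀ (p q : ℕ) (T : Fin p → Fin q → ℕ) (v : SkewGen.Vertex T),
        SkewGen.IsTough (SkewGen.skewGraph T) v →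
          (∃ L : List (List (SkewGen.Vertex T)),
            L.Nodup ∧
            (∀ P : List (SkewGen.Vertex T),
              P ∈ L ↔ SkewGen.IsHamPathFrom (SkewGen.skewGraph T) v P) ∧
            SkewGen.GeneratesWithDelay prog (SkewGen.inputConfig T v) L
              (C * (p * q * Fintype.card (SkewGen.Vertex T))) ∧
            SkewGen.WordsBounded prog (SkewGen.inputConfig T v)
              (C * (p * q * Fintype.card (SkewGen.Vertex T)) ^ C)) ∧
          (∀ P : List (SkewGen.Vertex T),
            SkewGen.IsHamPathFrom (SkewGen.skewGraph T) v P ↔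
              SkewGen.IsToughRun (SkewGen.skewGraph T) v P ∧
                P.length = Fintype.card (SkewGen.Vertex T)) := by
  obtain ⟨A, hA⟩ := (SkewGen.initCmd.polyBdd_bd.add SkewGen.bodyCmd.polyBdd_bd).add
    SkewGen.PolyBdd.id
  -- The summand 20000 serves the delay, and A * 11 ^ A, with A the constant of the polynomial
  -- bound, serves the word size; the factor 11 absorbs 10 * X + 1 ≤ 11 * X for X = pqn.
  refine ⟨SkewGen.machine, 20000 + A * 11 ^ A, fun p q T v _ =>
    ⟨?_, fun P => SkewGen.isHamPathFrom_iff_isToughRun _ v P⟩⟩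
  set n := Fintype.card (SkewGen.Vertex T) with hn
  have hn1 : 1 ≤ n := Fintype.card_pos_iff.2 ⟨v⟩
  have hp1 : 1 ≤ p := by have := v.1.1.2; omega
  have hq1 : 1 ≤ q := by have := v.1.2.2; omega
  have hpq : 1 ≤ p * q := Nat.mul_pos hp1 hq1
  have hX1 : p * q ≤ p * q * n := Nat.le_mul_of_pos_right _ hn1
  have hX2 : n ≤ p * q * n := Nat.le_mul_of_pos_left _ hpq
  have hp : p ≤ p * q := Nat.le_mul_of_pos_right _ hq1
  have hq : q ≤ p * q := Nat.le_mul_of_pos_left _ hp1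
  have hpn : p * n ≤ p * q * n := Nat.mul_le_mul_right _ hp
  have hqn : q * n ≤ p * q * n := Nat.mul_le_mul_right _ hq
  have hC : A ≤ 20000 + A * 11 ^ A :=
    (Nat.le_mul_of_pos_right A (by positivity)).trans (Nat.le_add_left _ _)
  -- As p, q and n are at least 1, each of p, q and 1 is at most pq, so 3200 pq bounds a search
  -- round and 450 n the printing round; the side conditions on M need only a small multiple of pqn.
  refine SkewGen.machine_correct (M := 10 * (p * q * n)) (K := 3200 * (p * q)) (K' := 450 * n)
    ⟨by omega, by omega, by omega, by omega, ?_⟩ v (by omega) (by omega) ?_ ?_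
  · have : p * (q * (n + 1)) = p * q * n + p * q := by ring
    rw [← hn, this]
    omega
  · rw [← hn]
    have h1 : 2 * n * (3200 * (p * q)) = 6400 * (p * q * n) := by ring
    have h2 : 20000 * (p * q * n) ≤ (20000 + A * 11 ^ A) * (p * q * n) :=
      Nat.mul_le_mul_right _ (Nat.le_add_right _ _)
    omega
  · refine (hA _).trans ?_
    calc A * (10 * (p * q * n) + 1) ^ A ≤ A * (11 * (p * q * n)) ^ A :=
          Nat.mul_le_mul_left _ (Nat.pow_le_pow_left (by omega) _)
      _ = A * 11 ^ A * (p * q * n) ^ A := by rw [mul_pow, mul_assoc A]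
      _ ≤ (20000 + A * 11 ^ A) * (p * q * n) ^ (20000 + A * 11 ^ A) :=
          Nat.mul_le_mul (Nat.le_add_left _ _) (Nat.pow_le_pow_right (by omega) hC)
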